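/- Let $Q=[0,\pi]\times[0,2\pi]$ and $\Box=\partial_t^2-\partial_x^2$, acting on functions that are $\pi$-periodic in $x$ and $2\pi$-periodic in $t$, $u(x,t)=\sum_{(j,k)\in\mathbb Z^2}\hat u(j,k)e^{2ijx+ikt}$. Let $E$ be the space of such real functions in $L^2(Q)$ with $$\|u\|_E^2=\sum_{2j\ne\pm k}\tfrac{|Q|}{4}|k^2-4j^2||\hat u(j,k)|^2+\sum_{2j=\pm k}4j^2|\hat u(j,k)|^2+|\hat u(0,0)|^2<\infty ,$$ let $N\subset E$ be the subspace of functions with $\hat u(j,k)=0$ whenever $2|j|\neq|k|$ (the kernel of $\Box$), and $E^\pm\subset E$ the subspaces of functions with only frequencies $\pm(|k|-2|j|)>0$; every $u\in E$ is uniquely $u=v+w$ with $v\in N$, $w\in E^+\oplus E^-$. Let $f\in C^1([0,\pi]\times\mathbb R)$, and suppose that there are constants $s>1$, $0<c_1\le c_2$ with $c_1>\frac{2c_2}{s+1}$, and $C\in\mathbb R$ such that for all $x\in[0,\pi]$ and $u\in\mathbb R$ $$c_1|u|^{s+1}-C|u|\;\le\; u f(x,u)\;\le\; c_2|u|^{s+1}+C|u|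 .$$ Put $F(x,u)=\int_0^u f(x,\sigma)\,d\sigma$ and, for $\beta>0$, $$I_\beta(u)=\int_Q\Big[\tfrac12\big(u_t^2-u_x^2-\beta(v^2+v_t^2)\big)-F(x,u)\Big]dx\,dt .$$ For integers $m,l$ let $E^m,E^{-m},E^{+l},N^m$ be the spans of the functions $\sin 2jx\cos kt$, $\sin 2jx\sin kt$, $\cos 2jx\cos kt$, $\cos 2jx\sin kt$ $(j,k\ge0)$ with, respectively, $2j+k\le m,\ 2j\ne k$; $2j+k\le m,\ k<2j$; $2j+k\le l,\ k>2j$; $2j=k\le m$. Let $V_l=N^m\oplus E^{-m}\oplus E^{+l}$ and let $G_l$ be the set of continuous maps $h:V_l\to E^m\oplus N^m$ that commute with the time translations $(g_\theta u)(x,t)=u(x,t+\theta)$, satisfy $h(u)=u$ for all $u\in V_l$ fixed by every $g_\theta$, satisfy $h(u)=u$ for all $u\in V_l$ with $\|u\|_E\ge r$ for some $r=r(h)$, and whose component in $N^m\oplus E^{-m}$ has the form $\alpha(u)v+\alpha^-(u)w^-+\phi(u)$ for $u=w^++w^-+v\in V_l$, with continuous $\alpha,\alpha^-:V_l\to[1,\bar\alpha]$,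 $\bar\alpha=\bar\alpha(h)>1$, and continuous $\phi:V_l\to N^m\oplus E^{-m}$. Put $$c_l(\beta)=c_l^m(\beta)=\inf_{h\in G_l}\ \sup_{u\in V_l} I_\beta(h(u)).$$ **Theorem.** There is $l_0$, depending only on $f$, such that for all $\beta>0$ and all $l\ge l_0$ the modified equation $$\Box u=\beta v_{tt}-f(x,u)-\beta v$$ has a solution $u=v+w$ with $v\in N\cap C^2$ and $w\in (E^+\oplus E^-)\cap C^{\gamma}$ for every $0<\gamma<\frac12$, in the sense of distributions: for all real $\varphi\in C^\infty(\mathbb R^2)$ that are $\pi$-periodic in $x$ and $2\pi$-periodic in $t$, $$\int_Q u\,\Box\varphi\,dx\,dt=\int_Q\big(\beta v\,\varphi_{tt}-f(x,u)\varphi-\beta v\varphi\big)dx\,dt .$$ Moreover $u$ is a Galerkin limit: for every $m\ge l$ there are $v^m\in N^m$ and $w^m\in E^m$ such that $u^m=v^m+w^m$ is a critical point of $I_\beta$ on $E^m\oplus N^m$ with $I_\beta(u^m)=c_l^m(\beta)$, and along a subsequence $m\to\infty$, $v^m\to v$ and $w^m\to w$ uniformly. -/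

import Mathlib

noncomputable section

namespace PeriodicWave

open Set MeasureTheory

/-! Functions of `(x, t)` are functions `u : ℝ × ℝ → ℝ`, with `x = p.1` and `t = p.2`. -/

/-- The fundamental domain `Q = [0, π] × [0, 2π]`. -/
def Q : Set (ℝ × ℝ) := Icc 0 Real.pi ×ˢ Icc 0 (2 * Real.pi)

/-- `π`-periodic in `x` and `2π`-periodic in `t`. -/
def Periodic (u : ℝ × ℝ → ℝ) : Prop :=
  ∀ x t : ℝ, u (x + Real.pi, t) = u (x, t) ∧ u (x, t + 2 * Real.pi) = u (x, t)

/-- The partial derivative in `x`. -/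
def dx (u : ℝ × ℝ → ℝ) (p : ℝ × ℝ) : ℝ := deriv (fun y => u (y, p.2)) p.1

/-- The partial derivative in `t`. -/
def dt (u : ℝ × ℝ → ℝ) (p : ℝ × ℝ) : ℝ := deriv (fun s => u (p.1, s)) p.2

/-- The d'Alembertian `u_tt - u_xx`. -/
def box (u : ℝ × ℝ → ℝ) (p : ℝ × ℝ) : ℝ := dt (dt u) p - dx (dx u) p

/-! ### Fourier series and the spaces `E`, `N` -/

/-- The character `e^{i 2 j x} e^{i k t}`. -/
def character (j k : ℤ) (p : ℝ × ℝ) : ℂ :=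
  Complex.exp (Complex.I * ((2 * j * p.1 + k * p.2 : ℝ) : ℂ))

/-- The Fourier coefficient `û(j, k)`; note that `|Q| = 2 π ^ 2`. -/
def coeff (u : ℝ × ℝ → ℝ) (j k : ℤ) : ℂ :=
  ((1 / (2 * Real.pi ^ 2) : ℝ) : ℂ) * ∫ p in Q, (u p : ℂ) * character (-j) (-k) p

/-- The frequencies of the kernel of the d'Alembertian: `2 j = ± k`. -/
def kernelModes : Set (ℤ × ℤ) := {q | 2 * |q.1| = |q.2|}

/-- The frequencies of `E⁻`: `|k| < 2 |j|`. -/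
def minusModes : Set (ℤ × ℤ) := {q | |q.2| < 2 * |q.1|}

open Classical in
/-- The weight of the frequency `(j, k)` in the squared norm of `E`. -/
def weightE (q : ℤ × ℤ) : ℝ :=
  if q ∉ kernelModes then
    (2 * Real.pi ^ 2) / 4 * |(q.2 : ℝ) ^ 2 - 4 * (q.1 : ℝ) ^ 2|
  else if q = (0, 0) then 1 else 4 * (q.1 : ℝ) ^ 2

/-- The norm of `E`. -/
def normE (u : ℝ × ℝ → ℝ) : ℝ :=
  Real.sqrt (∑' q : ℤ × ℤ, weightE q * ‖coeff u q.1 q.2‖ ^ 2)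

/-- `u ∈ E`. -/
def MemE (u : ℝ × ℝ → ℝ) : Prop :=
  Periodic u ∧ MemLp u 2 (volume.restrict Q) ∧
    Summable fun q : ℤ × ℤ => weightE q * ‖coeff u q.1 q.2‖ ^ 2

/-- `v ∈ N`: `v ∈ E` and only frequencies `2 j = ± k` occur. -/
def MemN (v : ℝ × ℝ → ℝ) : Prop :=
  MemE v ∧ ∀ j k : ℤ, (j, k) ∉ kernelModes → coeff v j k = 0

/-- `w ∈ E⁺ ⊕ E⁻`: `w ∈ E` and no frequency `2 j = ± k` occurs. -/
def MemRange (w : ℝ × ℝ → ℝ) : Prop :=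
  MemE w ∧ ∀ j k : ℤ, (j, k) ∈ kernelModes → coeff w j k = 0

/-- The part of the Fourier series of `u` with frequencies in `S` (used for trigonometric
polynomials `u` and for `S = -S`, where the sum is finite and real). -/
def fourierPart (S : Set (ℤ × ℤ)) (u : ℝ × ℝ → ℝ) (p : ℝ × ℝ) : ℝ :=
  (∑' q : ℤ × ℤ, S.indicator (fun q => coeff u q.1 q.2 * character q.1 q.2 p) q).re

/-- The component `v` of `u` in the kernel of the d'Alembertian. -/
def kernelPart (u : ℝ × ℝ → ℝ) : ℝ × ℝ → ℝ := fourierPart kernelModes u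

/-- The component `w⁻` of `u`. -/
def minusPart (u : ℝ × ℝ → ℝ) : ℝ × ℝ → ℝ := fourierPart minusModes u

/-! ### The Galerkin spaces -/

/-- The span of the products of `sin 2jx` or `cos 2jx` with `sin kt` or `cos kt`,
over the `j, k ≥ 0` satisfying `S j k`. -/
def trigSpan (S : ℕ → ℕ → Prop) : Submodule ℝ (ℝ × ℝ → ℝ) :=
  Submodule.span ℝ {u | ∃ j k : ℕ, S j k ∧
    (u = (fun p => Real.sin (2 * j * p.1) * Real.cos (k * p.2)) ∨
     u = (fun p => Real.sin (2 * j * p.1) * Real.sin (k * p.2)) ∨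
     u = (fun p => Real.cos (2 * j * p.1) * Real.cos (k * p.2)) ∨
     u = (fun p => Real.cos (2 * j * p.1) * Real.sin (k * p.2)))}

/-- `E^m`. -/
def Em (m : ℕ) : Submodule ℝ (ℝ × ℝ → ℝ) := trigSpan fun j k => 2 * j + k ≤ m ∧ 2 * j ≠ k

/-- `E^{+l}`, on which the quadratic form `∫ (u_t² - u_x²)` is positive. -/
def Eplus (l : ℕ) : Submodule ℝ (ℝ × ℝ → ℝ) := trigSpan fun j k => 2 * j + k ≤ l ∧ 2 * j < k

/-- `E^{-m}`, on which the quadratic form `∫ (u_t² - u_x²)` is negative. -/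
def Eminus (m : ℕ) : Submodule ℝ (ℝ × ℝ → ℝ) := trigSpan fun j k => 2 * j + k ≤ m ∧ k < 2 * j

/-- `N^m`. -/
def Nm (m : ℕ) : Submodule ℝ (ℝ × ℝ → ℝ) := trigSpan fun j k => 2 * j ≤ m ∧ 2 * j = k

/-- `V_l = N^m ⊕ E^{-m} ⊕ E^{+l}`. -/
def V (l m : ℕ) : Submodule ℝ (ℝ × ℝ → ℝ) := Nm m ⊔ Eminus m ⊔ Eplus l

/-! ### The functional and the minimax levels -/

/-- The primitive `F(x, u)` of `f(x, u)` in `u`. -/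
def primitive (f : ℝ → ℝ → ℝ) (x u : ℝ) : ℝ := ∫ s in (0 : ℝ)..u, f x s

/-- `I_β(u) = ∫_Q ½ (u_t² - u_x² - β (v² + v_t²)) - F(x, u)`,
where `v` is the component of `u` in the kernel of the d'Alembertian. -/
def action (f : ℝ → ℝ → ℝ) (β : ℝ) (u : ℝ × ℝ → ℝ) : ℝ :=
  ∫ p in Q, (1 / 2 * (dt u p ^ 2 - dx u p ^ 2 -
    β * (kernelPart u p ^ 2 + dt (kernelPart u) p ^ 2)) - primitive f p.1 (u p))

/-- `u` is a critical point of `I_β` on `E^m ⊕ N^m`: `I_β'(u) φ = 0` for all `φ` there. -/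
def IsCriticalPoint (f : ℝ → ℝ → ℝ) (β : ℝ) (m : ℕ) (u : ℝ × ℝ → ℝ) : Prop :=
  u ∈ Em m ⊔ Nm m ∧
    ∀ φ ∈ Em m ⊔ Nm m, HasDerivAt (fun τ : ℝ => action f β (u + τ • φ)) 0 0

/-- The time translation `(g_θ u)(x, t) = u(x, t + θ)`. -/
def shift (θ : ℝ) (u : ℝ × ℝ → ℝ) : ℝ × ℝ → ℝ := fun p => u (p.1, p.2 + θ)

/-- The class `G_l` of maps `h : V_l → E^m ⊕ N^m`; only the restriction of `h` to `V_l` matters.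
The product topology of `ℝ × ℝ → ℝ` induces the usual topology on the finite-dimensional `V_l`
and `E^m ⊕ N^m`. -/
structure IsAdmissible (l m : ℕ) (h : (ℝ × ℝ → ℝ) → (ℝ × ℝ → ℝ)) : Prop where
  continuousOn : ContinuousOn h (V l m : Set (ℝ × ℝ → ℝ))
  mapsTo : ∀ u ∈ V l m, h u ∈ Em m ⊔ Nm m
  equivariant : ∀ u ∈ V l m, ∀ θ : ℝ, h (shift θ u) = shift θ (h u)
  fixed : ∀ u ∈ V l m, (∀ θ : ℝ, shift θ u = u) → h u = u
  eq_self : ∃ r : ℝ, ∀ u ∈ V l m, r ≤ normE u → h u = u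
  form : ∃ (a : ℝ) (α αm : (ℝ × ℝ → ℝ) → ℝ) (φ : (ℝ × ℝ → ℝ) → (ℝ × ℝ → ℝ)), 1 < a ∧
    ContinuousOn α (V l m : Set (ℝ × ℝ → ℝ)) ∧
    ContinuousOn αm (V l m : Set (ℝ × ℝ → ℝ)) ∧
    ContinuousOn φ (V l m : Set (ℝ × ℝ → ℝ)) ∧
    ∀ u ∈ V l m, α u ∈ Icc 1 a ∧ αm u ∈ Icc 1 a ∧ φ u ∈ Nm m ⊔ Eminus m ∧
      kernelPart (h u) + minusPart (h u) = α u • kernelPart u + αm u • minusPart u + φ u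

/-- The minimax level `c_l(β) = inf_{h ∈ G_l} sup_{u ∈ V_l} I_β(h(u))` on `E^m ⊕ N^m`. -/
def level (f : ℝ → ℝ → ℝ) (β : ℝ) (l m : ℕ) : EReal :=
  ⨅ (h : (ℝ × ℝ → ℝ) → (ℝ × ℝ → ℝ)) (_ : IsAdmissible l m h),
    ⨆ u ∈ V l m, ((action f β (h u) : ℝ) : EReal)

/-! ### Distributional solutions -/

/-- `u = v + w` solves `□u = β v_tt - f(x, u) - β v` in the sense of distributions on the torus,
that is, against all smooth doubly periodic test functions. -/
def IsDistribSolution (f : ℝ → ℝ → ℝ) (β : ℝ) (v w : ℝ × ℝ → ℝ) : Prop :=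
  ∀ φ : ℝ × ℝ → ℝ, ContDiff ℝ (⊤ : ℕ∞) φ → Periodic φ →
    ∫ p in Q, (v p + w p) * box φ p =
      ∫ p in Q, (β * v p * dt (dt φ) p - f p.1 (v p + w p) * φ p - β * v p * φ p)

end PeriodicWave

end

noncomputable section

namespace PeriodicWave

open Set MeasureTheory Filter Topology

/-! ### Characters and Fourier coefficients -/

theorem character_eq_mul (j k : ℤ) (p : ℝ × ℝ) :
    character j k p =
      Complex.exp ((2 * j * Complex.I) * p.1) * Complex.exp ((k * Complex.I) * p.2) := by
  rw [character, ← Complex.exp_add]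
  congr 1
  push_cast
  ring

theorem character_mul (j k j' k' : ℤ) (p : ℝ × ℝ) :
    character j k p * character j' k' p = character (j + j') (k + k') p := by
  simp only [character, ← Complex.exp_add]
  congr 1
  push_cast
  ring

theorem character_zero (p : ℝ × ℝ) : character 0 0 p = 1 := by simp [character]

theorem norm_character (j k : ℤ) (p : ℝ × ℝ) : ‖character j k p‖ = 1 := by
  rw [character, mul_comm, Complex.norm_exp_ofReal_mul_I]

theorem conj_character (j k : ℤ) (p : ℝ × ℝ) :
    (starRingEnd ℂ) (character j k p) = character (-j) (-k) p := by
  rw [character, character, ← Complex.exp_conj]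
  congr 1
  simp only [map_mul, Complex.conj_I, Complex.conj_ofReal]
  push_cast
  ring

theorem continuous_character (j k : ℤ) : Continuous (character j k) := by
  unfold character
  fun_prop

theorem character_re (j k : ℤ) (p : ℝ × ℝ) :
    (character j k p).re = Real.cos (2 * j * p.1 + k * p.2) := by
  rw [character, mul_comm, Complex.exp_ofReal_mul_I_re]

theorem character_im (j k : ℤ) (p : ℝ × ℝ) :
    (character j k p).im = Real.sin (2 * j * p.1 + k * p.2) := by
  rw [character, mul_comm, Complex.exp_ofReal_mul_I_im]

theorem isCompact_Q : IsCompact Q := isCompact_Icc.prod isCompact_Icc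

theorem measurableSet_Q : MeasurableSet Q := measurableSet_Icc.prod measurableSet_Icc

theorem volume_Q : (volume.restrict Q).real univ = 2 * Real.pi ^ 2 := by
  rw [measureReal_restrict_apply_univ, Q, Measure.volume_eq_prod, measureReal_prod_prod]
  simp [Real.pi_pos.le]
  ring

instance : IsFiniteMeasure (volume.restrict Q) :=
  isFiniteMeasure_restrict.2 isCompact_Q.measure_ne_top

theorem setIntegral_Q {E : Type*} [NormedAddCommGroup E] [NormedSpace ℝ E] {g : ℝ × ℝ → E}
    (hg : ContinuousOn g Q) :
    ∫ p in Q, g p = ∫ x in (0 : ℝ)..Real.pi, ∫ t in (0 : ℝ)..(2 * Real.pi), g (x, t) := by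
  have h : IntegrableOn g (Icc 0 Real.pi ×ˢ Icc 0 (2 * Real.pi)) := hg.integrableOn_compact isCompact_Q
  rw [Q, Measure.volume_eq_prod, setIntegral_prod _ h, integral_Icc_eq_integral_Ioc,
    intervalIntegral.integral_of_le Real.pi_pos.le]
  refine setIntegral_congr_fun measurableSet_Ioc fun x _ => ?_
  rw [integral_Icc_eq_integral_Ioc, intervalIntegral.integral_of_le (by positivity)]

theorem setIntegral_Q_symm {E : Type*} [NormedAddCommGroup E] [NormedSpace ℝ E] {g : ℝ × ℝ → E}
    (hg : ContinuousOn g Q) :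
    ∫ p in Q, g p = ∫ t in (0 : ℝ)..(2 * Real.pi), ∫ x in (0 : ℝ)..Real.pi, g (x, t) := by
  have h : IntegrableOn g (Icc 0 Real.pi ×ˢ Icc 0 (2 * Real.pi)) := hg.integrableOn_compact isCompact_Q
  rw [Measure.volume_eq_prod, IntegrableOn, ← Measure.prod_restrict] at h
  rw [Q, Measure.volume_eq_prod, ← Measure.prod_restrict, integral_prod_symm _ h,
    integral_Icc_eq_integral_Ioc, intervalIntegral.integral_of_le (by positivity)]
  refine setIntegral_congr_fun measurableSet_Ioc fun x _ => ?_
  rw [integral_Icc_eq_integral_Ioc, intervalIntegral.integral_of_le (by positivity)]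

theorem integral_exp_int {L : ℝ} {n : ℤ} (hn : n ≠ 0) {c : ℂ} (hc : c * L = n * (2 * Real.pi * Complex.I)) :
    ∫ x in (0 : ℝ)..L, Complex.exp (c * x) = 0 := by
  have h0 : c ≠ 0 := by
    rintro rfl
    have : (n : ℂ) * (2 * Real.pi * Complex.I) ≠ 0 :=
      mul_ne_zero (by exact_mod_cast hn) Complex.two_pi_I_ne_zero
    simp at hc
    exact this (by rw [mul_eq_zero]; tauto)
  rw [integral_exp_mul_complex h0, hc, Complex.exp_int_mul_two_pi_mul_I]
  simp

theorem integral_character (j k : ℤ) :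
    ∫ p in Q, character j k p = if j = 0 ∧ k = 0 then ((2 * Real.pi ^ 2 : ℝ) : ℂ) else 0 := by
  split_ifs with h
  · obtain ⟨rfl, rfl⟩ := h
    simp only [character_zero, integral_const, volume_Q]
    simp
  · rw [setIntegral_Q (continuous_character j k).continuousOn]
    simp only [character_eq_mul, intervalIntegral.integral_const_mul,
      intervalIntegral.integral_mul_const]
    rcases not_and_or.1 h with h | h
    · rw [integral_exp_int h (by ring), zero_mul]
    · rw [integral_exp_int (c := k * Complex.I) (L := 2 * Real.pi) h (by push_cast; ring), mul_zero]

theorem integral_mul_character (u : ℝ × ℝ → ℝ) (q : ℤ × ℤ) :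
    ∫ p in Q, (u p : ℂ) * character q.1 q.2 p =
      ((2 * Real.pi ^ 2 : ℝ) : ℂ) * coeff u (-q.1) (-q.2) := by
  have : ((2 * Real.pi ^ 2 : ℝ) : ℂ) ≠ 0 := by
    exact_mod_cast (by positivity : (2 * Real.pi ^ 2 : ℝ) ≠ 0)
  rw [coeff, neg_neg, neg_neg, ← mul_assoc, ← Complex.ofReal_mul, mul_one_div_cancel, Complex.ofReal_one, one_mul]
  positivity

theorem conj_coeff (u : ℝ × ℝ → ℝ) (j k : ℤ) :
    (starRingEnd ℂ) (coeff u j k) = coeff u (-j) (-k) := by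
  simp only [coeff, map_mul, Complex.conj_ofReal, ← integral_conj, conj_character]

theorem norm_coeff_le (u : ℝ × ℝ → ℝ) (j k : ℤ) :
    ‖coeff u j k‖ ≤ 1 / (2 * Real.pi ^ 2) * ∫ p in Q, |u p| := by
  rw [coeff, norm_mul, Complex.norm_real, Real.norm_of_nonneg (by positivity)]
  gcongr
  refine (norm_integral_le_integral_norm _).trans_eq ?_
  simp [norm_character]

theorem integrable_mul_character {u : ℝ × ℝ → ℝ} (hu : IntegrableOn u Q) (j k : ℤ) :
    IntegrableOn (fun p => (u p : ℂ) * character j k p) Q :=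
  hu.ofReal.mul_bdd (c := 1) (continuous_character j k).aestronglyMeasurable
    (ae_of_all _ fun p => (norm_character j k p).le)

/-! ### Real trigonometric polynomials -/

/-- `u` is the trigonometric polynomial with coefficients `a` and frequencies in `T`. -/
def HasCoeffs (T : Finset (ℤ × ℤ)) (a : ℤ × ℤ → ℂ) (u : ℝ × ℝ → ℝ) : Prop :=
  ∀ p, (u p : ℂ) = ∑ q ∈ T, a q * character q.1 q.2 p

variable {T : Finset (ℤ × ℤ)} {a b : ℤ × ℤ → ℂ} {u φ ψ : ℝ × ℝ → ℝ}

theorem HasCoeffs.re_eq (h : HasCoeffs T a u) (p : ℝ × ℝ) :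
    u p = (∑ q ∈ T, a q * character q.1 q.2 p).re := by
  rw [← h p, Complex.ofReal_re]

theorem HasCoeffs.continuous (h : HasCoeffs T a u) : Continuous u := by
  have : u = fun p => (∑ q ∈ T, a q * character q.1 q.2 p).re := funext h.re_eq
  rw [this]
  exact Complex.continuous_re.comp (continuous_finsetSum _ fun q _ =>
    continuous_const.mul (continuous_character _ _))

theorem HasCoeffs.coeff_eq (h : HasCoeffs T a u) (q : ℤ × ℤ) :
    coeff u q.1 q.2 = if q ∈ T then a q else 0 := by
  have hc : ((2 * Real.pi ^ 2 : ℝ) : ℂ) ≠ 0 := by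
    exact_mod_cast (by positivity : (2 * Real.pi ^ 2 : ℝ) ≠ 0)
  have : ∀ p, (u p : ℂ) * character (-q.1) (-q.2) p =
      ∑ r ∈ T, a r * character (r.1 + -q.1) (r.2 + -q.2) p := fun p => by
    rw [h p, Finset.sum_mul]
    exact Finset.sum_congr rfl fun r _ => by rw [mul_assoc, character_mul]
  rw [coeff, integral_congr_ae (ae_of_all _ this), integral_finsetSum (f := fun (r : ℤ × ℤ) p => a r * character (r.1 + -q.1) (r.2 + -q.2) p) _ fun r _ =>
    ((continuous_const.mul (continuous_character _ _)).continuousOn.integrableOn_compact isCompact_Q)]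
  simp only [integral_const_mul, integral_character]
  rw [Finset.mul_sum]
  have key : ∀ r ∈ T, ((1 / (2 * Real.pi ^ 2) : ℝ) : ℂ) * (a r *
      if r.1 + -q.1 = 0 ∧ r.2 + -q.2 = 0 then ((2 * Real.pi ^ 2 : ℝ) : ℂ) else 0) =
      if q = r then a r else 0 := fun r _ => by
    have hiff : (r.1 + -q.1 = 0 ∧ r.2 + -q.2 = 0) ↔ q = r := by
      rw [Prod.ext_iff]; constructor <;> rintro ⟨h1, h2⟩ <;> constructor <;> omega
    simp only [hiff]
    split_ifs
    · push_cast at hc ⊢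
      field_simp
    · simp
  rw [Finset.sum_congr rfl key, Finset.sum_ite_eq]

theorem HasCoeffs.congr (h : HasCoeffs T a u) (hab : ∀ q ∈ T, a q = b q) : HasCoeffs T b u :=
  fun p => (h p).trans (Finset.sum_congr rfl fun q hq => by rw [hab q hq])

theorem HasCoeffs.self_coeff (h : HasCoeffs T a u) : HasCoeffs T (fun q => coeff u q.1 q.2) u :=
  h.congr fun q hq => by rw [h.coeff_eq, if_pos hq]

theorem HasCoeffs.mono {T' : Finset (ℤ × ℤ)} (h : HasCoeffs T a u) (hT : T ⊆ T') :
    HasCoeffs T' (fun q => coeff u q.1 q.2) u := fun p => by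
  rw [h.self_coeff p]
  refine Finset.sum_subset hT fun q _ hq => ?_
  simp only [h.coeff_eq, if_neg hq, zero_mul]

theorem HasCoeffs.add {v : ℝ × ℝ → ℝ} (hu : HasCoeffs T a u) (hv : HasCoeffs T b v) :
    HasCoeffs T (a + b) (u + v) := fun p => by
  simp [hu p, hv p, add_mul, Finset.sum_add_distrib]

theorem HasCoeffs.smul (hu : HasCoeffs T a u) (c : ℝ) :
    HasCoeffs T (fun q => c * a q) (c • u) := fun p => by
  simp [hu p, Finset.mul_sum, mul_assoc]

theorem hasCoeffs_re (hT : ∀ q ∈ T, -q ∈ T) (ha : ∀ q ∈ T, a (-q) = (starRingEnd ℂ) (a q)) :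
    HasCoeffs T a (fun p => (∑ q ∈ T, a q * character q.1 q.2 p).re) := fun p => by
  refine Complex.conj_eq_iff_re.1 ?_
  rw [map_sum]
  refine Finset.sum_nbij' (fun q => -q) (fun q => -q) hT hT (by simp) (by simp) fun q hq => ?_
  rw [map_mul, conj_character, ha q hq]
  rfl

theorem HasCoeffs.coeff_neg (h : HasCoeffs T a u) (hT : ∀ q ∈ T, -q ∈ T) {q : ℤ × ℤ} (hq : q ∈ T) :
    a (-q) = (starRingEnd ℂ) (a q) := by
  have h1 := h.coeff_eq q
  have h2 := h.coeff_eq (-q)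
  rw [if_pos hq] at h1
  rw [if_pos (hT q hq)] at h2
  rw [← h1, ← h2, conj_coeff]
  rfl

theorem HasCoeffs.integral_mul (h : HasCoeffs T a u) (hψ : IntegrableOn ψ Q) :
    ((∫ p in Q, u p * ψ p : ℝ) : ℂ) =
      ((2 * Real.pi ^ 2 : ℝ) : ℂ) * ∑ q ∈ T, a q * (starRingEnd ℂ) (coeff ψ q.1 q.2) := by
  have h1 : ((∫ p in Q, u p * ψ p : ℝ) : ℂ) =
      ∫ p in Q, ∑ q ∈ T, a q * ((ψ p : ℂ) * character q.1 q.2 p) := by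
    rw [← integral_complex_ofReal]
    refine integral_congr_ae (ae_of_all _ fun p => ?_)
    simp only [Complex.ofReal_mul, h p, Finset.sum_mul]
    exact Finset.sum_congr rfl fun q _ => by ring
  rw [h1, integral_finsetSum _ fun q _ => (integrable_mul_character hψ _ _).const_mul _, Finset.mul_sum]
  refine Finset.sum_congr rfl fun q _ => ?_
  rw [integral_const_mul, integral_mul_character, conj_coeff]
  ring

theorem HasCoeffs.integral_mul_re (h : HasCoeffs T a u) (hψ : IntegrableOn ψ Q) :
    ∫ p in Q, u p * ψ p =
      2 * Real.pi ^ 2 * ∑ q ∈ T, (a q * (starRingEnd ℂ) (coeff ψ q.1 q.2)).re := by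
  have := congrArg Complex.re (h.integral_mul hψ)
  rwa [Complex.ofReal_re, Complex.re_ofReal_mul, Complex.re_sum] at this

theorem _root_.Continuous.integrableOn_Q {E : Type*} [NormedAddCommGroup E] {g : ℝ × ℝ → E} (hg : Continuous g) :
    IntegrableOn g Q := hg.continuousOn.integrableOn_compact isCompact_Q

theorem HasCoeffs.integral_sq (h : HasCoeffs T a u) :
    ∫ p in Q, u p ^ 2 = 2 * Real.pi ^ 2 * ∑ q ∈ T, ‖a q‖ ^ 2 := by
  simp only [pow_two (u _)]
  rw [h.integral_mul_re h.continuous.integrableOn_Q]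
  congr 1
  refine Finset.sum_congr rfl fun q hq => ?_
  rw [h.coeff_eq, if_pos hq, Complex.mul_conj, Complex.ofReal_re, Complex.normSq_eq_norm_sq]

/-- Bessel's inequality. -/
theorem bessel (hψ : ContinuousOn ψ Q) (T : Finset (ℤ × ℤ)) :
    ∑ q ∈ T, ‖coeff ψ q.1 q.2‖ ^ 2 ≤ 1 / (2 * Real.pi ^ 2) * ∫ p in Q, ψ p ^ 2 := by
  classical
  set T' := T ∪ T.image fun q => -q with hT'
  have hsymm : ∀ q ∈ T', -q ∈ T' := fun q hq => by
    simp only [hT', Finset.mem_union, Finset.mem_image] at hq ⊢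
    rcases hq with hq | ⟨r, hr, rfl⟩
    · exact Or.inr ⟨q, hq, rfl⟩
    · exact Or.inl (by simpa using hr)
  have hu := hasCoeffs_re (a := fun q => coeff ψ q.1 q.2) hsymm fun q _ =>
    (conj_coeff ψ q.1 q.2).symm
  set v := fun p => (∑ q ∈ T', coeff ψ q.1 q.2 * character q.1 q.2 p).re
  have h1 := hu.integral_mul_re (hψ.integrableOn_compact isCompact_Q)
  have h2 := hu.integral_sq
  have hcross : ∫ p in Q, v p * ψ p = 2 * Real.pi ^ 2 * ∑ q ∈ T', ‖coeff ψ q.1 q.2‖ ^ 2 := by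
    rw [h1]
    congr 1
    refine Finset.sum_congr rfl fun q _ => ?_
    rw [Complex.mul_conj, Complex.ofReal_re, Complex.normSq_eq_norm_sq]
  have hpos : 0 ≤ ∫ p in Q, (ψ p - v p) ^ 2 := integral_nonneg fun p => sq_nonneg _
  have hexp : ∫ p in Q, (ψ p - v p) ^ 2 =
      (∫ p in Q, ψ p ^ 2) - 2 * (∫ p in Q, v p * ψ p) + ∫ p in Q, v p ^ 2 := by
    have i1 : IntegrableOn (fun p => ψ p ^ 2) Q := (hψ.pow 2).integrableOn_compact isCompact_Q
    have i2 : IntegrableOn (fun p => 2 * (v p * ψ p)) Q :=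
      (continuousOn_const.mul (hu.continuous.continuousOn.mul hψ)).integrableOn_compact isCompact_Q
    have i3 : IntegrableOn (fun p => v p ^ 2) Q := (hu.continuous.pow 2).integrableOn_Q
    have i4 : Integrable (fun p => ψ p ^ 2 - 2 * (v p * ψ p)) (volume.restrict Q) := i1.sub i2
    rw [← integral_const_mul, ← integral_sub i1 i2, ← integral_add i4 i3]
    exact integral_congr_ae (ae_of_all _ fun p => by ring)
  have hle : ∑ q ∈ T, ‖coeff ψ q.1 q.2‖ ^ 2 ≤ ∑ q ∈ T', ‖coeff ψ q.1 q.2‖ ^ 2 :=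
    Finset.sum_le_sum_of_subset_of_nonneg Finset.subset_union_left fun _ _ _ => by positivity
  refine hle.trans ?_
  rw [one_div, ← div_eq_inv_mul, le_div_iff₀ (by positivity)]
  nlinarith [hpos, hexp, hcross, h2]

variable {T : Finset (ℤ × ℤ)} {a b : ℤ × ℤ → ℂ} {u φ ψ : ℝ × ℝ → ℝ} {S S' : ℕ → ℕ → Prop}

/-! ### The spans of trigonometric functions -/

theorem trigSpan_sup : trigSpan S ⊔ trigSpan S' = trigSpan fun j k => S j k ∨ S' j k := by
  rw [trigSpan, trigSpan, trigSpan, ← Submodule.span_union]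
  congr 1
  ext u
  simp only [mem_union, mem_ofPred_eq]
  constructor
  · rintro (⟨j, k, h, hu⟩ | ⟨j, k, h, hu⟩)
    · exact ⟨j, k, Or.inl h, hu⟩
    · exact ⟨j, k, Or.inr h, hu⟩
  · rintro ⟨j, k, h | h, hu⟩
    · exact Or.inl ⟨j, k, h, hu⟩
    · exact Or.inr ⟨j, k, h, hu⟩

/-- The real functions which are complex combinations of the characters in `T`. -/
def charSpan (T : Finset (ℤ × ℤ)) : Submodule ℂ (ℝ × ℝ → ℂ) :=
  Submodule.span ℂ ((fun q : ℤ × ℤ => character q.1 q.2) '' T)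

theorem exists_hasCoeffs_of_mem_charSpan (h : (fun p => (u p : ℂ)) ∈ charSpan T) :
    ∃ a, HasCoeffs T a u := by
  obtain ⟨a, ha⟩ := (Submodule.mem_span_image_finset_iff_exists_fun (R := ℂ)).1 h
  classical
  refine ⟨fun q => if h : q ∈ T then a ⟨q, h⟩ else 0, fun p => ?_⟩
  have := congrFun ha p
  simp only [Finset.sum_apply, Pi.smul_apply, smul_eq_mul] at this
  rw [← this, ← Finset.sum_coe_sort T]
  exact Finset.sum_congr rfl fun q _ => by simp

theorem charSpan_of_trig {j k : ℕ} (hT : ∀ q : ℤ × ℤ, q.1.natAbs = j → q.2.natAbs = k → q ∈ T)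
    {c₁ c₂ c₃ c₄ : ℂ} (hu : ∀ p : ℝ × ℝ, (u p : ℂ) =
      (c₁ * Complex.exp (2 * j * Complex.I * p.1) + c₂ * Complex.exp (-(2 * j * Complex.I * p.1))) *
      (c₃ * Complex.exp (k * Complex.I * p.2) + c₄ * Complex.exp (-(k * Complex.I * p.2)))) :
    (fun p => (u p : ℂ)) ∈ charSpan T := by
  have hmem : ∀ q : ℤ × ℤ, q.1.natAbs = j → q.2.natAbs = k → ∀ c : ℂ,
      (c • character q.1 q.2) ∈ charSpan T := fun q h1 h2 c =>
    Submodule.smul_mem _ _ (Submodule.subset_span ⟨q, hT q h1 h2, rfl⟩)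
  have : (fun p => (u p : ℂ)) = (c₁ * c₃) • character j k + (c₁ * c₄) • character j (-k) +
      (c₂ * c₃) • character (-j) k + (c₂ * c₄) • character (-j) (-k) := by
    ext p
    simp only [hu, Pi.add_apply, Pi.smul_apply, smul_eq_mul, character_eq_mul]
    push_cast
    simp only [mul_neg, neg_mul, mul_assoc]
    ring
  rw [this]
  refine Submodule.add_mem _ (Submodule.add_mem _ (Submodule.add_mem _ ?_ ?_) ?_) ?_
  · exact hmem (j, k) (by simp) (by simp) _
  · exact hmem (j, -k) (by simp) (by simp) _
  · exact hmem (-j, k) (by simp) (by simp) _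
  · exact hmem (-j, -k) (by simp) (by simp) _

theorem charSpan_of_mem_trigSpan (hT : ∀ q : ℤ × ℤ, S q.1.natAbs q.2.natAbs → q ∈ T)
    (hu : u ∈ trigSpan S) : (fun p => (u p : ℂ)) ∈ charSpan T := by
  induction hu using Submodule.span_induction with
  | mem u hu =>
    obtain ⟨j, k, hS, hu⟩ := hu
    have hT' : ∀ q : ℤ × ℤ, q.1.natAbs = j → q.2.natAbs = k → q ∈ T := by
      rintro q rfl rfl
      exact hT q hS
    rcases hu with rfl | rfl | rfl | rfl
    · refine charSpan_of_trig hT' (c₁ := -Complex.I / 2) (c₂ := Complex.I / 2) (c₃ := 1 / 2) (c₄ := 1 / 2)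
        fun p => ?_
      push_cast
      simp only [Complex.sin, Complex.cos]
      ring_nf
    · refine charSpan_of_trig hT' (c₁ := -Complex.I / 2) (c₂ := Complex.I / 2) (c₃ := -Complex.I / 2)
        (c₄ := Complex.I / 2) fun p => ?_
      push_cast
      simp only [Complex.sin]
      ring_nf
    · refine charSpan_of_trig hT' (c₁ := 1 / 2) (c₂ := 1 / 2) (c₃ := 1 / 2) (c₄ := 1 / 2) fun p => ?_
      push_cast
      simp only [Complex.cos]
      ring_nf
    · refine charSpan_of_trig hT' (c₁ := 1 / 2) (c₂ := 1 / 2) (c₃ := -Complex.I / 2) (c₄ := Complex.I / 2)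
        fun p => ?_
      push_cast
      simp only [Complex.sin, Complex.cos]
      ring_nf
  | zero => simp only [Pi.zero_apply, Complex.ofReal_zero]; exact Submodule.zero_mem _
  | add u v _ _ hu hv =>
    simp only [Pi.add_apply, Complex.ofReal_add]
    exact Submodule.add_mem _ hu hv
  | smul c u _ hu =>
    simp only [Pi.smul_apply, smul_eq_mul, Complex.ofReal_mul]
    exact Submodule.smul_mem _ (c : ℂ) hu

theorem re_character_mem_trigSpan {q : ℤ × ℤ} (hq : S q.1.natAbs q.2.natAbs) (c : ℂ) :
    (fun p => (c * character q.1 q.2 p).re) ∈ trigSpan S := by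
  obtain ⟨j, k⟩ := q
  obtain ⟨ε, hε⟩ : ∃ ε : ℝ, (j : ℝ) = ε * j.natAbs ∧ (ε = 1 ∨ ε = -1) := by
    rcases Int.natAbs_eq j with h | h
    · exact ⟨1, by rw [h]; simp, Or.inl rfl⟩
    · exact ⟨-1, by rw [h]; simp, Or.inr rfl⟩
  obtain ⟨δ, hδ⟩ : ∃ δ : ℝ, (k : ℝ) = δ * k.natAbs ∧ (δ = 1 ∨ δ = -1) := by
    rcases Int.natAbs_eq k with h | h
    · exact ⟨1, by rw [h]; simp, Or.inl rfl⟩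
    · exact ⟨-1, by rw [h]; simp, Or.inr rfl⟩
  set J := j.natAbs
  set K := k.natAbs
  have hss : (fun p : ℝ × ℝ => Real.sin (2 * J * p.1) * Real.sin (K * p.2)) ∈ trigSpan S :=
    Submodule.subset_span ⟨J, K, hq, by simp⟩
  have hsc : (fun p : ℝ × ℝ => Real.sin (2 * J * p.1) * Real.cos (K * p.2)) ∈ trigSpan S :=
    Submodule.subset_span ⟨J, K, hq, by simp⟩
  have hcs : (fun p : ℝ × ℝ => Real.cos (2 * J * p.1) * Real.sin (K * p.2)) ∈ trigSpan S :=
    Submodule.subset_span ⟨J, K, hq, by simp⟩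
  have hcc : (fun p : ℝ × ℝ => Real.cos (2 * J * p.1) * Real.cos (K * p.2)) ∈ trigSpan S :=
    Submodule.subset_span ⟨J, K, hq, by simp⟩
  convert Submodule.add_mem _ (Submodule.add_mem _ (Submodule.smul_mem _ c.re hcc)
    (Submodule.smul_mem _ (-(c.re * ε * δ)) hss)) (Submodule.add_mem _
    (Submodule.smul_mem _ (-(c.im * ε)) hsc) (Submodule.smul_mem _ (-(c.im * δ)) hcs)) using 1
  ext p
  simp only [Complex.mul_re, character_re, character_im, Pi.add_apply, Pi.smul_apply, smul_eq_mul]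
  rw [hε.1, hδ.1, Real.cos_add, Real.sin_add, show 2 * (ε * (J : ℝ)) * p.1 = ε * (2 * J * p.1) by ring,
    show δ * (K : ℝ) * p.2 = δ * (K * p.2) by ring]
  rcases hε.2 with rfl | rfl <;> rcases hδ.2 with rfl | rfl <;>
    simp only [one_mul, neg_mul, Real.cos_neg, Real.sin_neg] <;> ring

theorem mem_trigSpan_of_hasCoeffs (hT : ∀ q ∈ T, S q.1.natAbs q.2.natAbs) (h : HasCoeffs T a u) :
    u ∈ trigSpan S := by
  have : u = ∑ q ∈ T, fun p => (a q * character q.1 q.2 p).re := by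
    ext p
    rw [h.re_eq, Complex.re_sum, Finset.sum_apply]
  rw [this]
  exact Submodule.sum_mem _ fun q hq => re_character_mem_trigSpan (hT q hq) _

theorem mem_trigSpan_iff (hT : ∀ q : ℤ × ℤ, q ∈ T ↔ S q.1.natAbs q.2.natAbs) :
    u ∈ trigSpan S ↔ HasCoeffs T (fun q => coeff u q.1 q.2) u := by
  constructor
  · intro h
    obtain ⟨a, ha⟩ := exists_hasCoeffs_of_mem_charSpan (charSpan_of_mem_trigSpan (fun q => (hT q).2) h)
    exact ha.self_coeff
  · exact mem_trigSpan_of_hasCoeffs fun q => (hT q).1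

/-! ### Operations on trigonometric polynomials -/

theorem HasCoeffs.translate (h : HasCoeffs T a u) (θ : ℝ) :
    HasCoeffs T (fun q => a q * character 0 q.2 (0, θ)) (shift θ u) := fun p => by
  rw [shift, h]
  refine Finset.sum_congr rfl fun q _ => ?_
  rw [mul_assoc]
  congr 1
  simp only [character, ← Complex.exp_add]
  congr 1
  push_cast
  ring

theorem hasDerivAt_character_t (j k : ℤ) (x t : ℝ) :
    HasDerivAt (fun s : ℝ => character j k (x, s)) (Complex.I * k * character j k (x, t)) t := by
  have h1 : HasDerivAt (fun s : ℝ => Complex.I * ((2 * j * x + k * s : ℝ) : ℂ)) (Complex.I * (k : ℝ)) t := by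
    refine (HasDerivAt.ofReal_comp ?_).const_mul _
    simpa using ((hasDerivAt_id t).const_mul (k : ℝ)).const_add (2 * (j : ℝ) * x)
  refine h1.cexp.congr_deriv ?_
  rw [show character j k (x, t) = Complex.exp (Complex.I * ((2 * j * x + k * t : ℝ) : ℂ)) from rfl]
  push_cast
  ring

theorem hasDerivAt_character_x (j k : ℤ) (x t : ℝ) :
    HasDerivAt (fun s : ℝ => character j k (s, t)) (Complex.I * (2 * j) * character j k (x, t)) x := by
  have h1 : HasDerivAt (fun s : ℝ => Complex.I * ((2 * j * s + k * t : ℝ) : ℂ))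
      (Complex.I * ((2 * j : ℝ) : ℂ)) x := by
    refine (HasDerivAt.ofReal_comp ?_).const_mul _
    simpa using ((hasDerivAt_id x).const_mul (2 * (j : ℝ))).add_const ((k : ℝ) * t)
  refine h1.cexp.congr_deriv ?_
  rw [show character j k (x, t) = Complex.exp (Complex.I * ((2 * j * x + k * t : ℝ) : ℂ)) from rfl]
  push_cast
  ring

theorem hasDerivAt_re {g : ℝ → ℂ} {g' : ℂ} {x : ℝ} (h : HasDerivAt g g' x) :
    HasDerivAt (fun y => (g y).re) g'.re x :=
  (Complex.reCLM.hasFDerivAt (x := g x)).comp_hasDerivAt x h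

theorem HasCoeffs.deriv_t (h : HasCoeffs T a u) (hT : ∀ q ∈ T, -q ∈ T) :
    HasCoeffs T (fun q => Complex.I * q.2 * a q) (dt u) := by
  have key : dt u = fun p => (∑ q ∈ T, Complex.I * q.2 * a q * character q.1 q.2 p).re := by
    ext p
    have : (fun s => u (p.1, s)) = fun s => (∑ q ∈ T, a q * character q.1 q.2 (p.1, s)).re :=
      funext fun s => h.re_eq _
    rw [dt, this]
    refine (hasDerivAt_re (HasDerivAt.fun_sum fun q _ =>
      (hasDerivAt_character_t q.1 q.2 p.1 p.2).const_mul (a q))).deriv.trans ?_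
    congr 1
    exact Finset.sum_congr rfl fun q _ => by ring
  rw [key]
  refine hasCoeffs_re hT fun q hq => ?_
  simp [h.coeff_neg hT hq]

theorem HasCoeffs.deriv_x (h : HasCoeffs T a u) (hT : ∀ q ∈ T, -q ∈ T) :
    HasCoeffs T (fun q => Complex.I * (2 * q.1) * a q) (dx u) := by
  have key : dx u = fun p => (∑ q ∈ T, Complex.I * (2 * q.1) * a q * character q.1 q.2 p).re := by
    ext p
    have : (fun s => u (s, p.2)) = fun s => (∑ q ∈ T, a q * character q.1 q.2 (s, p.2)).re :=
      funext fun s => h.re_eq _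
    rw [dx, this]
    refine (hasDerivAt_re (HasDerivAt.fun_sum fun q _ =>
      (hasDerivAt_character_x q.1 q.2 p.1 p.2).const_mul (a q))).deriv.trans ?_
    congr 1
    exact Finset.sum_congr rfl fun q _ => by ring
  rw [key]
  refine hasCoeffs_re hT fun q hq => ?_
  simp [h.coeff_neg hT hq, Complex.conj_ofNat]

open Classical in
theorem HasCoeffs.modePart (h : HasCoeffs T a u) (hT : ∀ q ∈ T, -q ∈ T) {M : Set (ℤ × ℤ)}
    (hM : ∀ q ∈ M, -q ∈ M) : HasCoeffs T (M.indicator a) (fourierPart M u) := by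
  have key : fourierPart M u = fun p => (∑ q ∈ T, M.indicator a q * character q.1 q.2 p).re := by
    ext p
    rw [fourierPart]
    congr 1
    rw [tsum_eq_sum (s := T)]
    · refine Finset.sum_congr rfl fun q hq => ?_
      by_cases hqM : q ∈ M
      · simp [hqM, h.coeff_eq, hq]
      · simp [hqM]
    · intro q hq
      by_cases hqM : q ∈ M
      · simp [hqM, h.coeff_eq, hq]
      · simp [hqM]
  rw [key]
  refine hasCoeffs_re hT fun q hq => ?_
  by_cases hqM : q ∈ M
  · rw [indicator_of_mem hqM, indicator_of_mem (hM q hqM), h.coeff_neg hT hq]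
  · have : -q ∉ M := fun h' => hqM (by simpa using hM _ h')
    rw [indicator_of_notMem hqM, indicator_of_notMem this, map_zero]

theorem neg_mem_kernelModes : ∀ q ∈ kernelModes, -q ∈ kernelModes := fun q hq => by
  simpa [kernelModes] using hq

theorem neg_mem_minusModes : ∀ q ∈ minusModes, -q ∈ minusModes := fun q hq => by
  simpa [minusModes] using hq

open Classical in
/-- The frequencies of `trigSpan S`, when `S` is bounded by `n`. -/
def modeSet (S : ℕ → ℕ → Prop) (n : ℕ) : Finset (ℤ × ℤ) :=
  (Finset.Icc (-n : ℤ) n ×ˢ Finset.Icc (-n : ℤ) n).filter fun q => S q.1.natAbs q.2.natAbs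

theorem mem_modeSet {n : ℕ} (hS : ∀ j k, S j k → j ≤ n ∧ k ≤ n) (q : ℤ × ℤ) :
    q ∈ modeSet S n ↔ S q.1.natAbs q.2.natAbs := by
  simp only [modeSet, Finset.mem_filter, Finset.mem_product, Finset.mem_Icc, and_iff_right_iff_imp]
  intro h
  have := hS _ _ h
  omega

theorem neg_mem_of_mem_iff (hT : ∀ q : ℤ × ℤ, q ∈ T ↔ S q.1.natAbs q.2.natAbs) : ∀ q ∈ T, -q ∈ T :=
  fun q hq => by
    rw [hT] at hq ⊢
    simpa using hq

variable {T : Finset (ℤ × ℤ)} {a b : ℤ × ℤ → ℂ} {u φ ψ : ℝ × ℝ → ℝ} {S S' : ℕ → ℕ → Prop}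

/-! ### The topology of the space of trigonometric polynomials -/

theorem HasCoeffs.coeff_add {v : ℝ × ℝ → ℝ} (hu : HasCoeffs T a u) (hv : HasCoeffs T b v) (q : ℤ × ℤ) :
    coeff (u + v) q.1 q.2 = coeff u q.1 q.2 + coeff v q.1 q.2 := by
  rw [(hu.add hv).coeff_eq, hu.coeff_eq, hv.coeff_eq]
  split_ifs <;> simp

theorem HasCoeffs.coeff_smul (hu : HasCoeffs T a u) (c : ℝ) (q : ℤ × ℤ) :
    coeff (c • u) q.1 q.2 = c * coeff u q.1 q.2 := by
  rw [(hu.smul c).coeff_eq, hu.coeff_eq]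
  split_ifs <;> simp

/-- The real trigonometric polynomials with frequencies in `T`. -/
def trigPoly (T : Finset (ℤ × ℤ)) : Submodule ℝ (ℝ × ℝ → ℝ) where
  carrier := {u | HasCoeffs T (fun q => coeff u q.1 q.2) u}
  add_mem' hu hv := (hu.add hv).self_coeff
  zero_mem' := HasCoeffs.self_coeff (a := 0) fun p => by simp
  smul_mem' c _ hu := (hu.smul c).self_coeff

theorem mem_trigPoly : u ∈ trigPoly T ↔ HasCoeffs T (fun q => coeff u q.1 q.2) u := Iff.rfl

theorem HasCoeffs.mem (h : HasCoeffs T a u) : u ∈ trigPoly T := h.self_coeff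

theorem trigSpan_eq (hT : ∀ q : ℤ × ℤ, q ∈ T ↔ S q.1.natAbs q.2.natAbs) :
    trigSpan S = trigPoly T := by
  ext u
  rw [mem_trigSpan_iff hT, mem_trigPoly]

/-- The Fourier coefficients of a trigonometric polynomial. -/
def coeffMap (T : Finset (ℤ × ℤ)) : trigPoly T →ₗ[ℝ] (T → ℂ) where
  toFun u q := coeff u q.1.1 q.1.2
  map_add' u v := funext fun q => HasCoeffs.coeff_add u.2 v.2 q.1
  map_smul' c u := funext fun q => by simpa using HasCoeffs.coeff_smul u.2 c q.1

/-- The trigonometric polynomial with given coefficients. -/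
def synth (T : Finset (ℤ × ℤ)) (a : T → ℂ) (p : ℝ × ℝ) : ℝ :=
  (∑ q : T, a q * character q.1.1 q.1.2 p).re

theorem synth_coeffMap (u : trigPoly T) (p : ℝ × ℝ) : synth T (coeffMap T u) p = u.1 p := by
  rw [HasCoeffs.re_eq u.2 p, synth, ← Finset.sum_coe_sort T]
  rfl

theorem coeffMap_injective : Function.Injective (coeffMap T) := fun u v h =>
  Subtype.ext (funext fun p => by rw [← synth_coeffMap u, ← synth_coeffMap v, h])

instance : FiniteDimensional ℝ (trigPoly T) :=
  FiniteDimensional.of_injective (coeffMap T) coeffMap_injective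

theorem continuous_coeffMap : Continuous (coeffMap T) :=
  (coeffMap T).continuous_of_finiteDimensional

theorem continuous_synth : Continuous fun z : (T → ℂ) × (ℝ × ℝ) => synth T z.1 z.2 := by
  unfold synth
  refine Complex.continuous_re.comp (continuous_finsetSum _ fun q _ => ?_)
  exact ((continuous_apply q).comp continuous_fst).mul ((continuous_character _ _).comp continuous_snd)

theorem continuous_coeff (q : ℤ × ℤ) : Continuous fun u : trigPoly T => coeff u q.1 q.2 := by
  by_cases hq : q ∈ T
  · exact (continuous_apply (⟨q, hq⟩ : T)).comp continuous_coeffMap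
  · have : (fun u : trigPoly T => coeff u q.1 q.2) = fun _ => 0 := funext fun u => by
      rw [HasCoeffs.coeff_eq u.2, if_neg hq]
    rw [this]
    exact continuous_const

theorem continuous_integral_comp {E : Type*} [NormedAddCommGroup E] [NormedSpace ℝ E]
    {H : (ℝ × ℝ) → ℝ → E} (hH : Continuous fun z : (ℝ × ℝ) × ℝ => H z.1 z.2) :
    Continuous fun u : trigPoly T => ∫ p in Q, H p (u.1 p) := by
  have h1 : Continuous (Function.uncurry fun (a : T → ℂ) (p : ℝ × ℝ) => H p (synth T a p)) :=
    hH.comp (continuous_snd.prodMk continuous_synth)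
  have h2 := (continuous_parametric_integral_of_continuous (μ := volume) h1 isCompact_Q).comp
    (continuous_coeffMap (T := T))
  simpa only [Function.comp_def, synth_coeffMap] using h2

theorem isCompact_of_coeff_le {K : Set (trigPoly T)} (hK : IsClosed K) {R : ℝ}
    (hR : ∀ u ∈ K, ∀ q ∈ T, ‖coeff u q.1 q.2‖ ≤ R) : IsCompact K := by
  have hemb := LinearMap.isClosedEmbedding_of_injective (f := coeffMap T)
    (LinearMap.ker_eq_bot.2 coeffMap_injective)
  refine (hemb.isCompact_preimage (isCompact_univ_pi fun _ : T =>
    isCompact_closedBall (0 : ℂ) R)).of_isClosed_subset hK fun u hu q _ => ?_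
  rw [mem_closedBall_zero_iff]
  exact hR u hu q.1 q.2

/-! ### The action functional on trigonometric polynomials -/

open Classical in
/-- The symbol of the operator `u ↦ -□u + β (v_tt - v)`. -/
def eigen (β : ℝ) (q : ℤ × ℤ) : ℝ :=
  if q ∈ kernelModes then -(β * (1 + (q.2 : ℝ) ^ 2)) else (q.2 : ℝ) ^ 2 - 4 * (q.1 : ℝ) ^ 2

theorem eigen_neg (β : ℝ) (q : ℤ × ℤ) : eigen β (-q) = eigen β q := by
  have : -q ∈ kernelModes ↔ q ∈ kernelModes :=
    ⟨fun h => by simpa using neg_mem_kernelModes _ h, neg_mem_kernelModes q⟩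
  by_cases h : q ∈ kernelModes
  · simp [eigen, h, this.2 h]
  · simp [eigen, h, mt this.1 h]

theorem sq_eq_of_mem_kernelModes {q : ℤ × ℤ} (h : q ∈ kernelModes) :
    (q.2 : ℝ) ^ 2 = 4 * (q.1 : ℝ) ^ 2 := by
  have h' : 2 * |q.1| = |q.2| := h
  have : q.2 ^ 2 = 4 * q.1 ^ 2 := by
    rw [← sq_abs q.2, ← h', mul_pow, sq_abs]; norm_num
  exact_mod_cast this

variable {f : ℝ → ℝ → ℝ} {β : ℝ}

theorem continuous_primitive (hf : Continuous fun p : ℝ × ℝ => f p.1 p.2) :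
    Continuous fun p : ℝ × ℝ => primitive f p.1 p.2 := by
  unfold primitive
  refine intervalIntegral.continuous_parametric_intervalIntegral_of_continuous
    (f := fun (p : ℝ × ℝ) s => f p.1 s) ?_ continuous_snd
  exact hf.comp ((continuous_fst.comp continuous_fst).prodMk continuous_snd)

theorem hasDerivAt_primitive (hf : Continuous fun p : ℝ × ℝ => f p.1 p.2) (x u : ℝ) :
    HasDerivAt (primitive f x) (f x u) u :=
  have h : Continuous (f x) := hf.comp (continuous_const.prodMk continuous_id)
  (intervalIntegral.integral_hasStrictDerivAt_right
    (h.intervalIntegrable _ _) (h.stronglyMeasurableAtFilter volume (𝓝 u)) h.continuousAt).hasDerivAt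

theorem HasCoeffs.action_eq (hf : Continuous fun p : ℝ × ℝ => f p.1 p.2) (hT : ∀ q ∈ T, -q ∈ T)
    (h : HasCoeffs T a u) :
    action f β u = Real.pi ^ 2 * ∑ q ∈ T, eigen β q * ‖a q‖ ^ 2 - ∫ p in Q, primitive f p.1 (u p) := by
  classical
  have ht := h.deriv_t hT
  have hx := h.deriv_x hT
  have hk := h.modePart hT neg_mem_kernelModes
  have hkt := hk.deriv_t hT
  have it : IntegrableOn (fun p => dt u p ^ 2) Q := (ht.continuous.pow 2).integrableOn_Q
  have ix : IntegrableOn (fun p => dx u p ^ 2) Q := (hx.continuous.pow 2).integrableOn_Q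
  have ik : IntegrableOn (fun p => kernelPart u p ^ 2) Q := (hk.continuous.pow 2).integrableOn_Q
  have ikt : IntegrableOn (fun p => dt (kernelPart u) p ^ 2) Q := (hkt.continuous.pow 2).integrableOn_Q
  have iF : IntegrableOn (fun p => primitive f p.1 (u p)) Q :=
    ((continuous_primitive hf).comp (continuous_fst.prodMk h.continuous)).integrableOn_Q
  have i1 : IntegrableOn (fun p => β * (kernelPart u p ^ 2 + dt (kernelPart u) p ^ 2)) Q :=
    (ik.add ikt).const_mul β
  have i2 : IntegrableOn (fun p => dt u p ^ 2 - dx u p ^ 2) Q := it.sub ix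
  have i3 : IntegrableOn (fun p => 1 / 2 * (dt u p ^ 2 - dx u p ^ 2 -
      β * (kernelPart u p ^ 2 + dt (kernelPart u) p ^ 2))) Q := (i2.sub i1).const_mul _
  rw [action, integral_sub i3 iF, integral_const_mul, integral_sub i2 i1, integral_sub it ix,
    integral_const_mul, integral_add ik ikt, ht.integral_sq, hx.integral_sq,
    show (∫ p in Q, dt (kernelPart u) p ^ 2) = _ from hkt.integral_sq,
    show (∫ p in Q, kernelPart u p ^ 2) = _ from hk.integral_sq]
  congr 1
  simp only [Finset.mul_sum, ← Finset.sum_add_distrib, ← Finset.sum_sub_distrib]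
  refine Finset.sum_congr rfl fun q _ => ?_
  by_cases hq : q ∈ kernelModes
  · simp only [eigen, hq, if_true, indicator_of_mem, norm_mul, Complex.norm_I, Complex.norm_intCast, mul_pow,
      sq_abs, Complex.norm_ofNat, one_pow]
    rw [sq_eq_of_mem_kernelModes hq]
    ring
  · simp only [eigen, hq, if_false, not_false_eq_true, indicator_of_notMem, norm_mul, Complex.norm_I,
      Complex.norm_intCast, mul_pow, sq_abs, Complex.norm_ofNat, one_pow, norm_zero]
    ring

/-- The Fourier coefficients of the gradient of the action. -/
def gradCoeff (f : ℝ → ℝ → ℝ) (β : ℝ) (u : ℝ × ℝ → ℝ) (q : ℤ × ℤ) : ℂ :=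
  eigen β q * coeff u q.1 q.2 - coeff (fun p => f p.1 (u p)) q.1 q.2

/-- The `L²` gradient of the action on the trigonometric polynomials with frequencies in `T`. -/
def grad (f : ℝ → ℝ → ℝ) (β : ℝ) (T : Finset (ℤ × ℤ)) (u : ℝ × ℝ → ℝ) (p : ℝ × ℝ) : ℝ :=
  (∑ q ∈ T, gradCoeff f β u q * character q.1 q.2 p).re

theorem hasCoeffs_grad (hT : ∀ q ∈ T, -q ∈ T) : HasCoeffs T (gradCoeff f β u) (grad f β T u) := by
  refine hasCoeffs_re hT fun q _ => ?_
  simp only [gradCoeff, map_sub, map_mul, Complex.conj_ofReal, conj_coeff, eigen_neg]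
  rfl

theorem hasDerivAt_integral_primitive (hf : Continuous fun p : ℝ × ℝ => f p.1 p.2) (hu : Continuous u)
    (hφ : Continuous φ) :
    HasDerivAt (fun τ : ℝ => ∫ p in Q, primitive f p.1 (u p + τ * φ p))
      (∫ p in Q, f p.1 (u p) * φ p) 0 := by
  have hF' : Continuous fun z : ℝ × (ℝ × ℝ) => f z.2.1 (u z.2 + z.1 * φ z.2) * φ z.2 := by
    have : Continuous fun z : ℝ × (ℝ × ℝ) => (z.2.1, u z.2 + z.1 * φ z.2) := by fun_prop
    exact (hf.comp this).mul (hφ.comp continuous_snd)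
  obtain ⟨B, hB⟩ := ((isCompact_Icc (a := (-1 : ℝ)) (b := 1)).prod isCompact_Q).exists_bound_of_continuousOn
    hF'.continuousOn
  have hF : ∀ τ : ℝ, Continuous fun p : ℝ × ℝ => primitive f p.1 (u p + τ * φ p) := fun τ =>
    (continuous_primitive hf).comp (by fun_prop : Continuous fun p : ℝ × ℝ => (p.1, u p + τ * φ p))
  have key := hasDerivAt_integral_of_dominated_loc_of_deriv_le (μ := volume.restrict Q) (x₀ := (0 : ℝ))
    (F := fun τ p => primitive f p.1 (u p + τ * φ p))
    (F' := fun τ p => f p.1 (u p + τ * φ p) * φ p) (bound := fun _ => B)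
    (Icc_mem_nhds (by norm_num : (-1 : ℝ) < 0) one_pos)
    (Eventually.of_forall fun τ => (hF τ).aestronglyMeasurable) (hF 0).integrableOn_Q
    (hF'.comp (continuous_const.prodMk continuous_id)).aestronglyMeasurable
    ((ae_restrict_iff' measurableSet_Q).2 (ae_of_all _ fun p hp τ hτ => hB (τ, p) ⟨hτ, hp⟩))
    (integrable_const _)
    (ae_of_all _ fun p τ _ => ?_)
  · simpa using key.2
  · have h1 : HasDerivAt (fun τ : ℝ => u p + τ * φ p) (φ p) τ := by
      simpa using ((hasDerivAt_id τ).mul_const (φ p)).const_add (u p)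
    exact (hasDerivAt_primitive hf p.1 _).comp τ h1

theorem hasDerivAt_action (hf : Continuous fun p : ℝ × ℝ => f p.1 p.2) (hT : ∀ q ∈ T, -q ∈ T)
    (hu : HasCoeffs T a u) (hφ : HasCoeffs T b φ) :
    HasDerivAt (fun τ : ℝ => action f β (u + τ • φ)) (∫ p in Q, grad f β T u p * φ p) 0 := by
  have hfu : Continuous fun p => f p.1 (u p) := hf.comp (continuous_fst.prodMk hu.continuous)
  have h1 : ∀ τ : ℝ, action f β (u + τ • φ) = Real.pi ^ 2 * ∑ q ∈ T, eigen β q *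
      (‖a q‖ ^ 2 + 2 * τ * (a q * (starRingEnd ℂ) (b q)).re + τ ^ 2 * ‖b q‖ ^ 2) -
      ∫ p in Q, primitive f p.1 (u p + τ * φ p) := fun τ => by
    rw [(hu.add (hφ.smul τ)).action_eq hf hT]
    congr 2
    refine Finset.sum_congr rfl fun q _ => ?_
    congr 1
    simp only [Pi.add_apply, ← Complex.normSq_eq_norm_sq, Complex.normSq_apply, Complex.add_re, Complex.add_im,
      Complex.mul_re, Complex.mul_im, Complex.ofReal_re, Complex.ofReal_im, Complex.conj_re, Complex.conj_im]
    ring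
  rw [funext h1]
  have h2 : HasDerivAt (fun τ : ℝ => Real.pi ^ 2 * ∑ q ∈ T, eigen β q *
      (‖a q‖ ^ 2 + 2 * τ * (a q * (starRingEnd ℂ) (b q)).re + τ ^ 2 * ‖b q‖ ^ 2))
      (Real.pi ^ 2 * ∑ q ∈ T, eigen β q * (2 * (a q * (starRingEnd ℂ) (b q)).re)) 0 := by
    refine HasDerivAt.const_mul _ (HasDerivAt.fun_sum fun q _ => HasDerivAt.const_mul _ ?_)
    have h3 := (((hasDerivAt_id (0 : ℝ)).const_mul 2).mul_const (a q * (starRingEnd ℂ) (b q)).re).const_add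
      (‖a q‖ ^ 2)
    have h4 := ((hasDerivAt_id (0 : ℝ)).pow 2).mul_const (‖b q‖ ^ 2)
    exact (h3.add h4).congr_deriv (by simp)
  refine (h2.sub (hasDerivAt_integral_primitive hf hu.continuous hφ.continuous)).congr_deriv ?_
  rw [(hasCoeffs_grad hT).integral_mul_re hφ.continuous.integrableOn_Q]
  have h5 : ∫ p in Q, f p.1 (u p) * φ p = 2 * Real.pi ^ 2 * ∑ q ∈ T,
      (coeff (fun p => f p.1 (u p)) q.1 q.2 * (starRingEnd ℂ) (b q)).re := by
    simp only [mul_comm (f _ _)]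
    rw [hφ.integral_mul_re hfu.integrableOn_Q]
    congr 1
    refine Finset.sum_congr rfl fun q _ => ?_
    simp only [Complex.mul_re, Complex.conj_re, Complex.conj_im]
    ring
  rw [h5, Finset.mul_sum, Finset.mul_sum, Finset.mul_sum, ← Finset.sum_sub_distrib]
  refine Finset.sum_congr rfl fun q hq => ?_
  rw [gradCoeff, hu.coeff_eq, hφ.coeff_eq, if_pos hq, if_pos hq]
  simp only [Complex.mul_re, Complex.conj_re, Complex.conj_im, Complex.sub_re, Complex.sub_im, Complex.ofReal_re,
    Complex.ofReal_im, Complex.mul_im]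
  ring

theorem isCriticalPoint_of_gradCoeff_eq_zero {m : ℕ} (hf : Continuous fun p : ℝ × ℝ => f p.1 p.2)
    (hT : ∀ q ∈ T, -q ∈ T) (hX : Em m ⊔ Nm m = trigPoly T) (hu : u ∈ trigPoly T)
    (h : ∀ q ∈ T, gradCoeff f β u q = 0) : IsCriticalPoint f β m u := by
  refine ⟨hX ▸ hu, fun φ hφ => ?_⟩
  rw [hX] at hφ
  refine (hasDerivAt_action hf hT hu hφ).congr_deriv ?_
  have : grad f β T u = 0 := by
    ext p
    rw [(hasCoeffs_grad hT).re_eq, Finset.sum_eq_zero fun q hq => by rw [h q hq, zero_mul]]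
    rfl
  simp [this]

theorem continuous_action (hf : Continuous fun p : ℝ × ℝ => f p.1 p.2) (hT : ∀ q ∈ T, -q ∈ T) :
    Continuous fun u : trigPoly T => action f β u := by
  have h : (fun u : trigPoly T => action f β u) = fun u : trigPoly T =>
      Real.pi ^ 2 * ∑ q ∈ T, eigen β q * ‖coeff u q.1 q.2‖ ^ 2 - ∫ p in Q, primitive f p.1 (u.1 p) :=
    funext fun u => HasCoeffs.action_eq hf hT u.2
  rw [h]
  refine (continuous_const.mul (continuous_finsetSum _ fun q _ =>
    continuous_const.mul ((continuous_coeff q).norm.pow 2))).sub ?_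
  refine continuous_integral_comp (H := fun p u => primitive f p.1 u) ?_
  exact (continuous_primitive hf).comp ((continuous_fst.comp continuous_fst).prodMk continuous_snd)

theorem continuous_gradCoeff (hf : Continuous fun p : ℝ × ℝ => f p.1 p.2) (q : ℤ × ℤ) :
    Continuous fun u : trigPoly T => gradCoeff f β u q := by
  unfold gradCoeff
  refine (continuous_const.mul (continuous_coeff q)).sub ?_
  unfold coeff
  refine continuous_const.mul (continuous_integral_comp
    (H := fun p u => (f p.1 u : ℂ) * character (-q.1) (-q.2) p) ?_)
  have h1 : Continuous fun z : (ℝ × ℝ) × ℝ => f z.1.1 z.2 :=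
    hf.comp ((continuous_fst.comp continuous_fst).prodMk continuous_snd)
  exact (Complex.continuous_ofReal.comp h1).mul ((continuous_character _ _).comp continuous_fst)

/-- The gradient as a vector field on the space of trigonometric polynomials. -/
def gradField (f : ℝ → ℝ → ℝ) (β : ℝ) (hT : ∀ q ∈ T, -q ∈ T) (u : trigPoly T) : trigPoly T :=
  ⟨grad f β T u, (hasCoeffs_grad hT).mem⟩

theorem continuous_gradField (hf : Continuous fun p : ℝ × ℝ => f p.1 p.2) (hT : ∀ q ∈ T, -q ∈ T) :
    Continuous (gradField f β hT) := by
  refine Continuous.subtype_mk (continuous_pi fun p => ?_) _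
  exact Complex.continuous_re.comp (continuous_finsetSum _ fun q _ =>
    (continuous_gradCoeff hf q).mul continuous_const)

theorem continuous_integral_mul :
    Continuous fun z : trigPoly T × trigPoly T => ∫ p in Q, z.1.1 p * z.2.1 p := by
  have : (fun z : trigPoly T × trigPoly T => ∫ p in Q, z.1.1 p * z.2.1 p) = fun z =>
      2 * Real.pi ^ 2 * ∑ q ∈ T, (coeff z.1 q.1 q.2 * (starRingEnd ℂ) (coeff z.2 q.1 q.2)).re :=
    funext fun z => HasCoeffs.integral_mul_re z.1.2 (HasCoeffs.continuous z.2.2).integrableOn_Q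
  rw [this]
  refine continuous_const.mul (continuous_finsetSum _ fun q _ => Complex.continuous_re.comp ?_)
  exact ((continuous_coeff q).comp continuous_fst).mul
    (Complex.continuous_conj.comp ((continuous_coeff q).comp continuous_snd))

/-! ### Time translations -/

theorem coeff_shift (hu : HasCoeffs T a u) (θ : ℝ) (q : ℤ × ℤ) :
    coeff (shift θ u) q.1 q.2 = coeff u q.1 q.2 * character 0 q.2 (0, θ) := by
  rw [(hu.translate θ).coeff_eq, hu.coeff_eq]
  split_ifs <;> simp

theorem setIntegral_Q_shift {E : Type*} [NormedAddCommGroup E] [NormedSpace ℝ E] {g : ℝ × ℝ → E}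
    (hg : Continuous g) (hper : ∀ x t, g (x, t + 2 * Real.pi) = g (x, t)) (θ : ℝ) :
    ∫ p in Q, g (p.1, p.2 + θ) = ∫ p in Q, g p := by
  rw [setIntegral_Q hg.continuousOn, setIntegral_Q (Continuous.continuousOn (by fun_prop))]
  congr 1
  ext x
  have hp : Function.Periodic (fun t => g (x, t)) (2 * Real.pi) := hper x
  rw [intervalIntegral.integral_comp_add_right (fun t => g (x, t)), zero_add, add_comm (2 * Real.pi) θ,
    hp.intervalIntegral_add_eq θ 0, zero_add]

theorem character_periodic_t (j k : ℤ) (x t : ℝ) :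
    character j k (x, t + 2 * Real.pi) = character j k (x, t) := by
  rw [character_eq_mul, character_eq_mul]
  congr 1
  simp only
  rw [show (k : ℂ) * Complex.I * ((t + 2 * Real.pi : ℝ) : ℂ) =
    k * Complex.I * t + k * (2 * Real.pi * Complex.I) by push_cast; ring, Complex.exp_add,
    Complex.exp_int_mul_two_pi_mul_I, mul_one]

theorem character_periodic_x (j k : ℤ) (x t : ℝ) :
    character j k (x + Real.pi, t) = character j k (x, t) := by
  rw [character_eq_mul, character_eq_mul]
  congr 1
  simp only
  rw [show 2 * (j : ℂ) * Complex.I * ((x + Real.pi : ℝ) : ℂ) =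
    2 * j * Complex.I * x + j * (2 * Real.pi * Complex.I) by push_cast; ring, Complex.exp_add,
    Complex.exp_int_mul_two_pi_mul_I, mul_one]

theorem HasCoeffs.periodic (h : HasCoeffs T a u) : Periodic u := fun x t => by
  simp only [h.re_eq, character_periodic_t, character_periodic_x, and_self]

theorem coeff_shift_of_periodic {g : ℝ × ℝ → ℝ} (hg : Continuous g)
    (hper : ∀ x t, g (x, t + 2 * Real.pi) = g (x, t)) (θ : ℝ) (q : ℤ × ℤ) :
    coeff (shift θ g) q.1 q.2 = coeff g q.1 q.2 * character 0 q.2 (0, θ) := by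
  have h1 := setIntegral_Q_shift (g := fun p => (g p : ℂ) * character (-q.1) (-q.2) p)
    ((Complex.continuous_ofReal.comp hg).mul (continuous_character _ _))
    (fun x t => by rw [hper, character_periodic_t]) θ
  rw [coeff, coeff, ← h1, mul_assoc, ← integral_mul_const]
  congr 2
  ext p
  rw [shift, mul_assoc]
  congr 1
  simp only [character, ← Complex.exp_add]
  congr 1
  push_cast
  ring

theorem gradCoeff_shift (hf : Continuous fun p : ℝ × ℝ => f p.1 p.2) (hu : HasCoeffs T a u) (θ : ℝ) (q : ℤ × ℤ) :
    gradCoeff f β (shift θ u) q = gradCoeff f β u q * character 0 q.2 (0, θ) := by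
  rw [gradCoeff, gradCoeff, coeff_shift hu]
  have hg : Continuous fun p => f p.1 (u p) := hf.comp (continuous_fst.prodMk hu.continuous)
  have : (fun p => f p.1 (shift θ u p)) = shift θ fun p => f p.1 (u p) := rfl
  rw [this, coeff_shift_of_periodic hg fun x t => by simp only [(hu.periodic x t).2]]
  ring

theorem grad_shift (hf : Continuous fun p : ℝ × ℝ => f p.1 p.2) (hT : ∀ q ∈ T, -q ∈ T)
    (hu : HasCoeffs T a u) (θ : ℝ) : grad f β T (shift θ u) = shift θ (grad f β T u) := by
  ext p
  rw [((hasCoeffs_grad hT).translate θ).re_eq, grad]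
  simp only [gradCoeff_shift hf hu]

theorem action_shift (hf : Continuous fun p : ℝ × ℝ => f p.1 p.2) (hT : ∀ q ∈ T, -q ∈ T)
    (hu : HasCoeffs T a u) (θ : ℝ) : action f β (shift θ u) = action f β u := by
  rw [(hu.translate θ).action_eq hf hT, hu.action_eq hf hT]
  congr 1
  · simp [norm_character]
  · exact setIntegral_Q_shift ((continuous_primitive hf).comp (continuous_fst.prodMk hu.continuous))
      (fun x t => by simp only [Function.comp, (hu.periodic x t).2]) θ

variable {T T' : Finset (ℤ × ℤ)} {a b : ℤ × ℤ → ℂ} {u φ ψ : ℝ × ℝ → ℝ} {S S' : ℕ → ℕ → Prop}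
  {f : ℝ → ℝ → ℝ} {β : ℝ} {l m : ℕ}

/-! ### A deformation by one step along the gradient -/

theorem exists_gradient_step {X : Type*} [AddCommGroup X] [Module ℝ X] [TopologicalSpace X]
    [IsTopologicalAddGroup X] [ContinuousSMul ℝ X] {I : X → ℝ} {g : X → X} {ip : X → X → ℝ}
    (hI : Continuous I) (hg : Continuous g) (hip : Continuous fun z : X × X => ip z.1 z.2)
    (hneg : ∀ u v, ip u (-v) = -ip u v)
    (hder : ∀ u φ, HasDerivAt (fun τ : ℝ => I (u + τ • φ)) (ip (g u) φ) 0) {c : ℝ}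
    (hcomp : IsCompact {u | c - 1 ≤ I u}) (hpos : ∀ u, I u = c → 0 < ip (g u) (g u))
    {κ : ℝ} (hκ : 0 < κ) :
    ∃ ρ : ℝ → ℝ, Continuous ρ ∧ (∀ s ≤ c - κ, ρ s = 0) ∧
      ∃ ε > 0, ∀ u, I u ≤ c + ε → I (u - ρ (I u) • g u) ≤ c - ε := by
  have hgg : Continuous fun u => ip (g u) (g u) := hip.comp (hg.prodMk hg)
  obtain ⟨δ, hδ, hmin⟩ := hcomp.exists_forall_le' (f := fun u => max |I u - c| (ip (g u) (g u))) (a := 0)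
    ((hI.sub continuous_const).abs.max hgg).continuousOn (fun u _ => by
      by_cases h : I u = c
      · exact lt_max_of_lt_right (hpos u h)
      · exact lt_max_of_lt_left (abs_pos.2 (sub_ne_zero.2 h)))
  set ε₀ := min (min κ 1) δ / 2 with hε₀
  have hm : 0 < min (min κ 1) δ := lt_min (lt_min hκ one_pos) hδ
  have hε₀pos : 0 < ε₀ := half_pos hm
  have hε₀κ : ε₀ < κ := (half_lt_self hm).trans_le ((min_le_left _ _).trans (min_le_left _ _))
  have hε₀1 : ε₀ < 1 := (half_lt_self hm).trans_le ((min_le_left _ _).trans (min_le_right _ _))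
  have hε₀δ : ε₀ < δ := (half_lt_self hm).trans_le (min_le_right _ _)
  set C₁ := {u | c - 1 ≤ I u} ∩ {u | |I u - c| ≤ ε₀} with hC₁
  have hC₁c : IsCompact C₁ :=
    hcomp.inter_right (isClosed_le (hI.sub continuous_const).abs continuous_const)
  have hCδ : ∀ u ∈ C₁, δ ≤ ip (g u) (g u) := fun u hu => by
    rcases le_max_iff.1 (hmin u hu.1) with h | h
    · exact absurd (h.trans hu.2) (not_le.2 hε₀δ)
    · exact h
  have hψ : Continuous fun z : X × ℝ => ip (g (z.1 - z.2 • g z.1)) (g z.1) := by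
    have h1 : Continuous fun z : X × ℝ => z.1 - z.2 • g z.1 :=
      continuous_fst.sub (continuous_snd.smul (hg.comp continuous_fst))
    exact hip.comp ((hg.comp h1).prodMk (hg.comp continuous_fst))
  obtain ⟨U, W, -, hW, hCU, h0W, hUW⟩ := generalized_tube_lemma hC₁c (isCompact_singleton (x := (0 : ℝ)))
    (isOpen_lt continuous_const hψ : IsOpen {z : X × ℝ | δ / 2 < ip (g (z.1 - z.2 • g z.1)) (g z.1)})
    (fun z hz => by
      obtain ⟨hz1, hz2⟩ := hz
      simp only [mem_singleton_iff] at hz2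
      have := hCδ _ hz1
      simp only [mem_ofPred_eq, hz2, zero_smul, sub_zero]
      linarith)
  obtain ⟨τ₁, hτ₁, hball⟩ := Metric.isOpen_iff.1 hW 0 (h0W rfl)
  set τ₀ := τ₁ / 2 with hτ₀
  have hτ₀pos : 0 < τ₀ := half_pos hτ₁
  have hdec : ∀ u ∈ C₁, ∀ τ ∈ Icc 0 τ₀, I (u - τ • g u) ≤ I u - δ / 2 * τ := by
    intro u hu τ hτ
    have hd : ∀ σ : ℝ, HasDerivAt (fun σ : ℝ => I (u - σ • g u)) (-ip (g (u - σ • g u)) (g u)) σ := fun σ => by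
      have h1 := hder (u - σ • g u) (-g u)
      rw [hneg, show (0 : ℝ) = σ - σ by ring] at h1
      have h2 := HasDerivAt.comp_sub_const σ σ h1
      refine h2.congr_of_eventuallyEq (Eventually.of_forall fun s => ?_)
      simp only
      congr 1
      rw [smul_neg, sub_smul]
      abel
    have key := Convex.image_sub_le_mul_sub_of_deriv_le (convex_Icc (0 : ℝ) τ₀)
      (f := fun σ : ℝ => I (u - σ • g u)) (fun σ _ => (hd σ).continuousAt.continuousWithinAt)
      (fun σ _ => (hd σ).differentiableAt.differentiableWithinAt) (C := -(δ / 2)) (fun σ hσ => by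
        rw [(hd σ).deriv, neg_le_neg_iff]
        rw [interior_Icc] at hσ
        have : (u, σ) ∈ U ×ˢ W := ⟨hCU hu, hball (by
          rw [Metric.mem_ball, Real.dist_eq, sub_zero, abs_of_pos hσ.1]
          exact hσ.2.trans (half_lt_self hτ₁))⟩
        exact (hUW this).le) 0 (left_mem_Icc.2 hτ₀pos.le) τ hτ hτ.1
    simp only [zero_smul, sub_zero] at key
    linarith
  set ρ : ℝ → ℝ := fun s => τ₀ * max 0 (min 1 (2 * (s - (c - ε₀)) / ε₀)) with hρ
  have hρmem : ∀ s, ρ s ∈ Icc 0 τ₀ := fun s =>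
    ⟨mul_nonneg hτ₀pos.le (le_max_left _ _), mul_le_of_le_one_right hτ₀pos.le
      (max_le zero_le_one (min_le_left _ _))⟩
  have hρ0 : ∀ s ≤ c - ε₀, ρ s = 0 := fun s hs => by
    have : 2 * (s - (c - ε₀)) / ε₀ ≤ 0 := div_nonpos_of_nonpos_of_nonneg (by linarith) hε₀pos.le
    simp only [hρ]
    rw [max_eq_left ((min_le_right _ _).trans this), mul_zero]
  have hρ1 : ∀ s, c - ε₀ / 2 ≤ s → ρ s = τ₀ := fun s hs => by
    have : 1 ≤ 2 * (s - (c - ε₀)) / ε₀ := by rw [le_div_iff₀ hε₀pos]; linarith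
    simp only [hρ]
    rw [min_eq_left this, max_eq_right zero_le_one, mul_one]
  refine ⟨ρ, by fun_prop, fun s hs => hρ0 s (by linarith), min (ε₀ / 2) (τ₀ * δ / 4), by positivity,
    fun u hu => ?_⟩
  have he1 := min_le_left (ε₀ / 2) (τ₀ * δ / 4)
  have he2 := min_le_right (ε₀ / 2) (τ₀ * δ / 4)
  rcases le_total (I u) (c - ε₀) with h | h
  · rw [hρ0 _ h, zero_smul, sub_zero]
    linarith
  · have hu1 : u ∈ C₁ := ⟨by simp only [mem_ofPred_eq]; linarith,
      show |I u - c| ≤ ε₀ from abs_le.2 ⟨by linarith, by linarith⟩⟩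
    have h2 := hdec u hu1 _ (hρmem (I u))
    rcases le_total (c - ε₀ / 2) (I u) with h3 | h3
    · rw [hρ1 _ h3] at h2 ⊢
      linarith
    · have := mul_nonneg hδ.le (hρmem (I u)).1
      linarith

/-! ### The Galerkin spaces as spaces of trigonometric polynomials -/

theorem HasCoeffs.restrict (h : HasCoeffs T a u) (hT : T' ⊆ T) (h0 : ∀ q ∈ T, q ∉ T' → a q = 0) :
    HasCoeffs T' a u := fun p => by
  rw [h p]
  exact (Finset.sum_subset hT fun q hq hq' => by rw [h0 q hq hq', zero_mul]).symm

theorem HasCoeffs.eq_of_coeff_eq {v : ℝ × ℝ → ℝ} (hu : HasCoeffs T a u) (hv : HasCoeffs T b v)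
    (h : ∀ q ∈ T, coeff u q.1 q.2 = coeff v q.1 q.2) : u = v := by
  ext p
  rw [hu.self_coeff.re_eq, hv.self_coeff.re_eq]
  congr 1
  exact Finset.sum_congr rfl fun q hq => by rw [h q hq]

/-- The frequencies of `E^m ⊕ N^m`. -/
def galerkinModes (m : ℕ) : Finset (ℤ × ℤ) :=
  modeSet (fun j k => (2 * j + k ≤ m ∧ 2 * j ≠ k) ∨ (2 * j ≤ m ∧ 2 * j = k)) m

theorem mem_galerkinModes (m : ℕ) (q : ℤ × ℤ) : q ∈ galerkinModes m ↔
    (2 * q.1.natAbs + q.2.natAbs ≤ m ∧ 2 * q.1.natAbs ≠ q.2.natAbs) ∨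
      (2 * q.1.natAbs ≤ m ∧ 2 * q.1.natAbs = q.2.natAbs) :=
  mem_modeSet (fun j k h => by omega) q

theorem Em_sup_Nm (m : ℕ) : Em m ⊔ Nm m = trigPoly (galerkinModes m) := by
  rw [Em, Nm, trigSpan_sup]
  exact trigSpan_eq (mem_galerkinModes m)

theorem neg_mem_galerkinModes (m : ℕ) : ∀ q ∈ galerkinModes m, -q ∈ galerkinModes m :=
  neg_mem_of_mem_iff (S := fun j k => (2 * j + k ≤ m ∧ 2 * j ≠ k) ∨ (2 * j ≤ m ∧ 2 * j = k)) (mem_galerkinModes m)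

/-- The frequencies of `V_l`. -/
def linkModes (l m : ℕ) : Finset (ℤ × ℤ) :=
  modeSet (fun j k => ((2 * j ≤ m ∧ 2 * j = k) ∨ (2 * j + k ≤ m ∧ k < 2 * j)) ∨ (2 * j + k ≤ l ∧ 2 * j < k)) (max l m)

theorem mem_linkModes (l m : ℕ) (q : ℤ × ℤ) : q ∈ linkModes l m ↔
    ((2 * q.1.natAbs ≤ m ∧ 2 * q.1.natAbs = q.2.natAbs) ∨
      (2 * q.1.natAbs + q.2.natAbs ≤ m ∧ q.2.natAbs < 2 * q.1.natAbs)) ∨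
      (2 * q.1.natAbs + q.2.natAbs ≤ l ∧ 2 * q.1.natAbs < q.2.natAbs) :=
  mem_modeSet (fun j k h => by omega) q

theorem V_eq (l m : ℕ) : V l m = trigPoly (linkModes l m) := by
  rw [V, Nm, Eminus, Eplus, trigSpan_sup, trigSpan_sup]
  exact trigSpan_eq (mem_linkModes l m)

/-- The frequencies of `N^m ⊕ E^{-m}`. -/
def nonposModes (m : ℕ) : Finset (ℤ × ℤ) :=
  modeSet (fun j k => (2 * j ≤ m ∧ 2 * j = k) ∨ (2 * j + k ≤ m ∧ k < 2 * j)) m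

theorem mem_nonposModes (m : ℕ) (q : ℤ × ℤ) : q ∈ nonposModes m ↔
    ((2 * q.1.natAbs ≤ m ∧ 2 * q.1.natAbs = q.2.natAbs) ∨
      (2 * q.1.natAbs + q.2.natAbs ≤ m ∧ q.2.natAbs < 2 * q.1.natAbs)) :=
  mem_modeSet (fun j k h => by omega) q

theorem Nm_sup_Eminus (m : ℕ) : Nm m ⊔ Eminus m = trigPoly (nonposModes m) := by
  rw [Nm, Eminus, trigSpan_sup]
  exact trigSpan_eq (mem_nonposModes m)

theorem mem_kernelModes_iff (q : ℤ × ℤ) : q ∈ kernelModes ↔ 2 * q.1.natAbs = q.2.natAbs := by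
  rw [kernelModes, mem_ofPred_eq, Int.abs_eq_natAbs, Int.abs_eq_natAbs]
  omega

theorem mem_minusModes_iff (q : ℤ × ℤ) : q ∈ minusModes ↔ q.2.natAbs < 2 * q.1.natAbs := by
  rw [minusModes, mem_ofPred_eq, Int.abs_eq_natAbs, Int.abs_eq_natAbs]
  omega

theorem V_le (hlm : l ≤ m) : V l m ≤ trigPoly (galerkinModes m) := by
  rw [V_eq]
  intro u hu
  refine HasCoeffs.mem (HasCoeffs.mono hu fun q hq => ?_)
  rw [mem_linkModes] at hq
  rw [mem_galerkinModes]
  omega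

/-! ### Maps of the class `G_l` -/

theorem continuousOn_fourierPart (hT : ∀ q ∈ T, -q ∈ T) {M : Set (ℤ × ℤ)} (hM : ∀ q ∈ M, -q ∈ M) :
    ContinuousOn (fourierPart M) (trigPoly T : Set (ℝ × ℝ → ℝ)) := by
  classical
  rw [continuousOn_iff_continuous_domRestrict]
  refine continuous_pi fun p => ?_
  have : (fun u : trigPoly T => fourierPart M u p) = fun u : trigPoly T =>
      (∑ q ∈ T, M.indicator (fun q => coeff u q.1 q.2) q * character q.1 q.2 p).re :=
    funext fun u => (HasCoeffs.modePart u.2 hT hM).re_eq p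
  refine Eq.subst (motive := Continuous) this.symm ?_
  refine Complex.continuous_re.comp (continuous_finsetSum _ fun q _ => Continuous.mul ?_ continuous_const)
  by_cases hq : q ∈ M
  · simp only [indicator_of_mem hq]
    exact continuous_coeff q
  · simp only [indicator_of_notMem hq]
    exact continuous_const

theorem kernelPart_add_minusPart_mem (hu : u ∈ trigPoly (galerkinModes m)) :
    kernelPart u + minusPart u ∈ Nm m ⊔ Eminus m := by
  have h1 := HasCoeffs.modePart hu (neg_mem_galerkinModes m) neg_mem_kernelModes
  have h2 := HasCoeffs.modePart hu (neg_mem_galerkinModes m) neg_mem_minusModes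
  rw [Nm_sup_Eminus]
  refine ((h1.add h2).restrict (T' := nonposModes m) (fun q hq => ?_) fun q hq hq' => ?_).mem
  · rw [mem_nonposModes] at hq
    rw [mem_galerkinModes]
    omega
  · have hk : q ∉ kernelModes := fun h => hq' (by
      rw [mem_kernelModes_iff] at h; rw [mem_nonposModes]; rw [mem_galerkinModes] at hq; omega)
    have hm : q ∉ minusModes := fun h => hq' (by
      rw [mem_minusModes_iff] at h; rw [mem_nonposModes]; rw [mem_galerkinModes] at hq; omega)
    simp [hk, hm]

/-- On the finite dimensional spaces `V_l` the last condition in the definition of `G_l` follows from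
the other ones. -/
theorem IsAdmissible.of_continuousOn (hlm : l ≤ m) {h : (ℝ × ℝ → ℝ) → (ℝ × ℝ → ℝ)}
    (hcont : ContinuousOn h (V l m : Set (ℝ × ℝ → ℝ)))
    (hmaps : ∀ u ∈ V l m, h u ∈ trigPoly (galerkinModes m))
    (hequi : ∀ u ∈ V l m, ∀ θ : ℝ, h (shift θ u) = shift θ (h u))
    (hfix : ∀ u ∈ V l m, (∀ θ : ℝ, shift θ u = u) → h u = u)
    (hself : ∃ r : ℝ, ∀ u ∈ V l m, r ≤ normE u → h u = u) : IsAdmissible l m h := by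
  refine ⟨hcont, fun u hu => by rw [Em_sup_Nm]; exact hmaps u hu, hequi, hfix, hself, 2, fun _ => 1,
    fun _ => 1, fun u => (kernelPart (h u) + minusPart (h u)) - (kernelPart u + minusPart u), by norm_num,
    continuousOn_const, continuousOn_const, ?_, fun u hu => ⟨by norm_num, by norm_num, ?_, ?_⟩⟩
  · have hc : ContinuousOn (fun w => kernelPart w + minusPart w) (trigPoly (galerkinModes m) : Set (ℝ × ℝ → ℝ)) :=
      (continuousOn_fourierPart (neg_mem_galerkinModes m) neg_mem_kernelModes).add
        (continuousOn_fourierPart (neg_mem_galerkinModes m) neg_mem_minusModes)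
    exact (hc.comp hcont hmaps).sub (hc.mono (V_le hlm))
  · exact Submodule.sub_mem _ (kernelPart_add_minusPart_mem (hmaps u hu))
      (kernelPart_add_minusPart_mem (V_le hlm hu))
  · simp only [one_smul]
    abel

theorem isAdmissible_id (hlm : l ≤ m) : IsAdmissible l m fun u => u :=
  .of_continuousOn hlm continuousOn_id (fun _ hu => V_le hlm hu) (fun _ _ _ => rfl) (fun _ _ _ => rfl)
    ⟨0, fun _ _ _ => rfl⟩

/-! ### Functions which do not depend on time -/

theorem character_pi_div {k : ℤ} (hk : k ≠ 0) : character 0 k (0, Real.pi / k) = -1 := by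
  have : (k : ℂ) ≠ 0 := by exact_mod_cast hk
  rw [character_eq_mul, show (k : ℂ) * Complex.I * ((Real.pi / k : ℝ) : ℂ) = Real.pi * Complex.I by
    push_cast; field_simp, Complex.exp_pi_mul_I]
  simp

theorem eq_zero_of_mul_character {z : ℂ} {k : ℤ} (hk : k ≠ 0) (h : ∀ θ : ℝ, z * character 0 k (0, θ) = z) :
    z = 0 := by
  have := h (Real.pi / k)
  rw [character_pi_div hk, mul_neg_one] at this
  exact self_eq_neg.1 this.symm

theorem HasCoeffs.shift_eq_iff (h : HasCoeffs T a u) :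
    (∀ θ : ℝ, shift θ u = u) ↔ ∀ q : ℤ × ℤ, q.2 ≠ 0 → coeff u q.1 q.2 = 0 := by
  constructor
  · intro hu q hq
    refine eq_zero_of_mul_character hq fun θ => ?_
    rw [← coeff_shift h, hu]
  · intro hu θ
    refine (h.translate θ).eq_of_coeff_eq h fun q _ => ?_
    rw [coeff_shift h]
    by_cases hq : q.2 = 0
    · rw [hq, show character 0 0 (0, θ) = 1 from character_zero _, mul_one]
    · rw [hu q hq, zero_mul]

theorem mem_V_of_shift_eq (hu : u ∈ trigPoly (galerkinModes m))
    (h : ∀ q : ℤ × ℤ, q.2 ≠ 0 → coeff u q.1 q.2 = 0) (hlm : l ≤ m) : u ∈ V l m := by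
  rw [V_eq]
  refine (HasCoeffs.restrict hu (fun q hq => ?_) fun q hq hq' => ?_).mem
  · rw [mem_linkModes] at hq
    rw [mem_galerkinModes]
    omega
  · refine h q fun h0 => hq' ?_
    rw [mem_galerkinModes] at hq
    rw [mem_linkModes]
    omega

theorem exists_normE_le (m : ℕ) : ∃ W : ℝ, 0 < W ∧ ∀ u ∈ trigPoly (galerkinModes m),
    normE u ^ 2 ≤ W * ∫ p in Q, u p ^ 2 := by
  have hw : ∀ q, 0 ≤ weightE q := fun q => by
    unfold weightE
    split_ifs <;> positivity
  refine ⟨1 + ∑ q ∈ galerkinModes m, weightE q,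
    add_pos_of_pos_of_nonneg one_pos (Finset.sum_nonneg fun q _ => hw q), fun u hu => ?_⟩
  have hpi : 1 ≤ 2 * Real.pi ^ 2 := by nlinarith [Real.pi_gt_three]
  rw [normE, Real.sq_sqrt (tsum_nonneg fun q => mul_nonneg (hw q) (sq_nonneg _)),
    tsum_eq_sum (s := galerkinModes m) fun q hq => by rw [HasCoeffs.coeff_eq hu, if_neg hq]; simp,
    HasCoeffs.integral_sq hu]
  set A := ∑ q ∈ galerkinModes m, ‖coeff u q.1 q.2‖ ^ 2
  have hA : 0 ≤ A := Finset.sum_nonneg fun _ _ => sq_nonneg _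
  calc ∑ q ∈ galerkinModes m, weightE q * ‖coeff u q.1 q.2‖ ^ 2
      ≤ ∑ q ∈ galerkinModes m, weightE q * A := Finset.sum_le_sum fun q hq =>
        mul_le_mul_of_nonneg_left (Finset.single_le_sum
          (f := fun q : ℤ × ℤ => ‖coeff u q.1 q.2‖ ^ 2) (fun _ _ => sq_nonneg _) hq) (hw q)
    _ = (∑ q ∈ galerkinModes m, weightE q) * A := by rw [Finset.sum_mul]
    _ ≤ (1 + ∑ q ∈ galerkinModes m, weightE q) * (2 * Real.pi ^ 2 * A) := by
        have h0 : 0 ≤ ∑ q ∈ galerkinModes m, weightE q := Finset.sum_nonneg fun q _ => hw q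
        refine mul_le_mul (by linarith) (by nlinarith) hA (by linarith)

/-! ### The minimax level is a critical value -/

theorem isCompact_superlevel (hf : Continuous fun p : ℝ × ℝ => f p.1 p.2) (hT : ∀ q ∈ T, -q ∈ T) {M : ℝ}
    (hM : ∀ u ∈ trigPoly T, action f β u ≤ M - ∫ p in Q, u p ^ 2) (c : ℝ) :
    IsCompact {u : trigPoly T | c ≤ action f β u} := by
  refine isCompact_of_coeff_le (isClosed_le continuous_const (continuous_action hf hT))
    (R := Real.sqrt (M - c)) fun u hu q hq => Real.le_sqrt_of_sq_le ?_
  have h1 := hM u u.2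
  have h2 := Finset.single_le_sum (f := fun q : ℤ × ℤ => ‖coeff u q.1 q.2‖ ^ 2) (fun _ _ => sq_nonneg _) hq
  have h3 := HasCoeffs.integral_sq u.2
  have h4 : c ≤ action f β u := hu
  have hpi : 1 ≤ 2 * Real.pi ^ 2 := by nlinarith [Real.pi_gt_three]
  have h5 : 0 ≤ ∑ q ∈ T, ‖coeff u q.1 q.2‖ ^ 2 := Finset.sum_nonneg fun _ _ => sq_nonneg _
  nlinarith

theorem integral_grad_sq (hT : ∀ q ∈ T, -q ∈ T) :
    ∫ p in Q, grad f β T u p * grad f β T u p = 2 * Real.pi ^ 2 * ∑ q ∈ T, ‖gradCoeff f β u q‖ ^ 2 := by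
  simp only [← pow_two]
  exact (hasCoeffs_grad hT).integral_sq

/-- A maximum of the action over the functions which do not depend on time is a critical point. -/
theorem exists_stationary_max (hf : Continuous fun p : ℝ × ℝ => f p.1 p.2) (hT : ∀ q ∈ T, -q ∈ T) {M : ℝ}
    (hM : ∀ u ∈ trigPoly T, action f β u ≤ M - ∫ p in Q, u p ^ 2) :
    ∃ u₀ ∈ trigPoly T, (∀ q : ℤ × ℤ, q.2 ≠ 0 → coeff u₀ q.1 q.2 = 0) ∧
      (∀ u ∈ trigPoly T, (∀ q : ℤ × ℤ, q.2 ≠ 0 → coeff u q.1 q.2 = 0) → action f β u ≤ action f β u₀) ∧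
      ∀ q ∈ T, gradCoeff f β u₀ q = 0 := by
  set I : trigPoly T → ℝ := fun u => action f β u with hI
  set A : Set (trigPoly T) := {u | I 0 ≤ I u} ∩ {u | ∀ q : ℤ × ℤ, q.2 ≠ 0 → coeff u q.1 q.2 = 0} with hA
  have hAc : IsCompact A := by
    refine (isCompact_superlevel hf hT hM _).inter_right ?_
    simp only [ofPred_forall]
    exact isClosed_iInter fun q => isClosed_iInter fun _ => isClosed_eq (continuous_coeff q) continuous_const
  have h0 : (0 : trigPoly T) ∈ A := ⟨le_refl (I 0), fun q _ => by simp [coeff]⟩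
  obtain ⟨u₀, hu₀, hmax⟩ := hAc.exists_isMaxOn ⟨0, h0⟩ (continuous_action (β := β) hf hT).continuousOn
  have hmaxI : ∀ w : trigPoly T, (∀ q : ℤ × ℤ, q.2 ≠ 0 → coeff w q.1 q.2 = 0) → I w ≤ I u₀ := fun w hw => by
    rcases le_total (I 0) (I w) with h | h
    · exact isMaxOn_iff.1 hmax w ⟨h, hw⟩
    · exact h.trans (isMaxOn_iff.1 hmax 0 h0)
  have hmax' : ∀ u ∈ trigPoly T, (∀ q : ℤ × ℤ, q.2 ≠ 0 → coeff u q.1 q.2 = 0) →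
      action f β u ≤ action f β u₀ := fun u hu hq => hmaxI ⟨u, hu⟩ hq
  refine ⟨u₀, u₀.2, hu₀.2, hmax', ?_⟩
  have hshift := (HasCoeffs.shift_eq_iff u₀.2).2 hu₀.2
  have hg0 : ∀ q : ℤ × ℤ, q.2 ≠ 0 → gradCoeff f β u₀ q = 0 := fun q hq =>
    eq_zero_of_mul_character hq fun θ => by rw [← gradCoeff_shift hf u₀.2, hshift]
  have hd := hasDerivAt_action (β := β) hf hT u₀.2 (hasCoeffs_grad (f := f) (β := β) (u := u₀.1) hT)
  have hloc : IsLocalMax (fun τ : ℝ => action f β (u₀.1 + τ • grad f β T u₀)) 0 := by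
    refine Eventually.of_forall fun τ => ?_
    have hgs := (hasCoeffs_grad (f := f) (β := β) (u := u₀.1) hT).smul τ
    have h := hmax' (u₀.1 + τ • grad f β T u₀) (HasCoeffs.add u₀.2 hgs).mem fun q hq => by
      rw [HasCoeffs.coeff_add u₀.2 hgs, hu₀.2 q hq, hgs.coeff_eq, hg0 q hq]
      simp
    simpa using h
  have hz := hloc.hasDerivAt_eq_zero hd
  rw [integral_grad_sq hT] at hz
  have hz' : ∑ q ∈ T, ‖gradCoeff f β u₀ q‖ ^ 2 = 0 := by
    have := Real.pi_pos
    rcases mul_eq_zero.1 hz with h | h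
    · exact absurd h (by positivity)
    · exact h
  intro q hq
  have := (Finset.sum_eq_zero_iff_of_nonneg fun _ _ => sq_nonneg _).1 hz' q hq
  simpa using this

theorem le_level (hlm : l ≤ m)
    (hu : u ∈ trigPoly (galerkinModes m)) (h : ∀ q : ℤ × ℤ, q.2 ≠ 0 → coeff u q.1 q.2 = 0) :
    ((action f β u : ℝ) : EReal) ≤ level f β l m := by
  refine le_iInf₂ fun g hg => ?_
  have hV := mem_V_of_shift_eq hu h hlm
  have := le_iSup₂ (f := fun u (_ : u ∈ V l m) => ((action f β (g u) : ℝ) : EReal)) u hV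
  simpa [hg.fixed u hV ((HasCoeffs.shift_eq_iff hu).2 h)] using this

theorem level_le (hlm : l ≤ m) {M : ℝ} (hM : ∀ u ∈ V l m, action f β u ≤ M) :
    level f β l m ≤ ((M : ℝ) : EReal) :=
  (iInf₂_le (fun u => u) (isAdmissible_id hlm)).trans
    (iSup₂_le fun u hu => EReal.coe_le_coe_iff.2 (hM u hu))

theorem exists_equivariant_deformation (hf : Continuous fun p : ℝ × ℝ => f p.1 p.2) (hT : ∀ q ∈ T, -q ∈ T)
    {M : ℝ} (hM : ∀ u ∈ trigPoly T, action f β u ≤ M - ∫ p in Q, u p ^ 2) {c₀ c : ℝ} (hlt : c₀ < c)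
    (hno : ∀ u ∈ trigPoly T, action f β u = c → ∃ q ∈ T, gradCoeff f β u q ≠ 0) :
    ∃ η : (ℝ × ℝ → ℝ) → (ℝ × ℝ → ℝ), ContinuousOn η (trigPoly T : Set (ℝ × ℝ → ℝ)) ∧
      (∀ u ∈ trigPoly T, η u ∈ trigPoly T) ∧ (∀ u ∈ trigPoly T, ∀ θ, η (shift θ u) = shift θ (η u)) ∧
      (∀ u, action f β u ≤ c₀ → η u = u) ∧
      ∃ ε > 0, ∀ u ∈ trigPoly T, action f β u ≤ c + ε → action f β (η u) ≤ c - ε := by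
  set I : trigPoly T → ℝ := fun u => action f β u with hI
  set ip : trigPoly T → trigPoly T → ℝ := fun u v => ∫ p in Q, u.1 p * v.1 p with hip
  have hpos : ∀ u : trigPoly T, I u = c → 0 < ip (gradField f β hT u) (gradField f β hT u) := fun u hu => by
    obtain ⟨q, hq, hq0⟩ := hno u u.2 hu
    have h1 : ip (gradField f β hT u) (gradField f β hT u) =
      2 * Real.pi ^ 2 * ∑ q ∈ T, ‖gradCoeff f β u q‖ ^ 2 := integral_grad_sq (u := u.1) hT
    have h2 : 0 < ∑ q ∈ T, ‖gradCoeff f β u q‖ ^ 2 := Finset.sum_pos' (fun _ _ => sq_nonneg _)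
      ⟨q, hq, pow_pos (norm_pos_iff.2 hq0) 2⟩
    exact h1 ▸ mul_pos (mul_pos two_pos (pow_pos Real.pi_pos 2)) h2
  have hneg : ∀ u v : trigPoly T, ip u (-v) = -ip u v := fun u v => by
    simp only [hip]
    rw [← integral_neg]
    exact integral_congr_ae (ae_of_all _ fun p => mul_neg _ _)
  have hder : ∀ u φ : trigPoly T, HasDerivAt (fun τ : ℝ => I (u + τ • φ)) (ip (gradField f β hT u) φ) 0 :=
    fun u φ => hasDerivAt_action hf hT u.2 φ.2
  obtain ⟨ρ, hρ, hρ0, ε, hε, hdef⟩ := exists_gradient_step (I := I) (g := gradField f β hT) (ip := ip)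
    (continuous_action hf hT) (continuous_gradField hf hT) continuous_integral_mul hneg hder
    (isCompact_superlevel hf hT hM (c - 1)) hpos (sub_pos.2 hlt)
  rw [sub_sub_cancel] at hρ0
  refine ⟨fun u => u - ρ (action f β u) • grad f β T u, ?_, fun u hu => ?_, fun u hu θ => ?_, fun u hu => ?_,
    ε, hε, fun u hu h => hdef ⟨u, hu⟩ h⟩
  · rw [continuousOn_iff_continuous_domRestrict]
    exact continuous_subtype_val.sub ((hρ.comp (continuous_action hf hT)).smul
      (continuous_subtype_val.comp (continuous_gradField hf hT)))
  · exact Submodule.sub_mem _ hu (Submodule.smul_mem _ _ (hasCoeffs_grad hT).mem)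
  · simp only
    rw [action_shift hf hT hu, grad_shift hf hT hu]
    rfl
  · simp only
    rw [hρ0 _ hu, zero_smul, sub_zero]

theorem exists_critical_at_level (hf : Continuous fun p : ℝ × ℝ => f p.1 p.2) (hlm : l ≤ m) {M : ℝ}
    (hM : ∀ u ∈ trigPoly (galerkinModes m), action f β u ≤ M - ∫ p in Q, u p ^ 2) :
    ∃ u ∈ trigPoly (galerkinModes m), ((action f β u : ℝ) : EReal) = level f β l m ∧
      ∀ q ∈ galerkinModes m, gradCoeff f β u q = 0 := by
  set T := galerkinModes m with hTdef
  have hT : ∀ q ∈ T, -q ∈ T := neg_mem_galerkinModes m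
  obtain ⟨u₀, hu₀, hfix₀, hmax₀, hcrit₀⟩ := exists_stationary_max hf hT hM
  have hge := le_level (f := f) (β := β) hlm hu₀ hfix₀
  have hle : level f β l m ≤ ((M : ℝ) : EReal) := level_le hlm fun u hu => (hM u (V_le hlm hu)).trans
    (sub_le_self _ (integral_nonneg fun p => sq_nonneg _))
  obtain ⟨c, hc⟩ : ∃ c : ℝ, level f β l m = (c : EReal) := by
    refine ⟨(level f β l m).toReal, (EReal.coe_toReal ?_ ?_).symm⟩
    · exact (hle.trans_lt (EReal.coe_lt_top _)).ne
    · exact ((EReal.bot_lt_coe _).trans_le hge).ne'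
  rw [hc] at hge ⊢
  have hge' : action f β u₀ ≤ c := EReal.coe_le_coe_iff.1 hge
  rcases hge'.eq_or_lt with heq | hlt
  · exact ⟨u₀, hu₀, by rw [heq], hcrit₀⟩
  by_contra! hno
  obtain ⟨η, hηcont, hηmem, hηshift, hηself, ε, hε, hdef⟩ := exists_equivariant_deformation hf hT hM hlt
    fun u hu h => hno u hu (by rw [h])
  obtain ⟨h, hadm, hsup⟩ : ∃ h, ∃ _ : IsAdmissible l m h,
      (⨆ u ∈ V l m, ((action f β (h u) : ℝ) : EReal)) < ((c + ε : ℝ) : EReal) := by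
    have : level f β l m < ((c + ε : ℝ) : EReal) := by
      rw [hc]; exact EReal.coe_lt_coe_iff.2 (by linarith)
    simpa only [level, iInf_lt_iff] using this
  have hmaps : ∀ u ∈ V l m, h u ∈ trigPoly T := fun u hu => by
    rw [hTdef, ← Em_sup_Nm]; exact hadm.mapsTo u hu
  have hbd : ∀ u ∈ V l m, action f β (h u) ≤ c + ε := fun u hu => by
    have := (le_iSup₂ (f := fun u (_ : u ∈ V l m) => ((action f β (h u) : ℝ) : EReal)) u hu).trans hsup.le
    exact EReal.coe_le_coe_iff.1 this
  have hadm' : IsAdmissible l m fun u => η (h u) := by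
    refine .of_continuousOn hlm (hηcont.comp hadm.continuousOn hmaps) (fun u hu => hηmem _ (hmaps u hu))
      (fun u hu θ => ?_) (fun u hu hs => ?_) ?_
    · rw [hadm.equivariant u hu, hηshift _ (hmaps u hu)]
    · rw [hadm.fixed u hu hs]
      exact hηself u (hmax₀ u (V_le hlm hu) ((HasCoeffs.shift_eq_iff (V_le hlm hu)).1 hs))
    · obtain ⟨r, hr⟩ := hadm.eq_self
      obtain ⟨W, hW, hWn⟩ := exists_normE_le m
      set r' := Real.sqrt (W * max 0 (M - action f β u₀)) with hr'
      refine ⟨max r r', fun u hu hn => ?_⟩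
      rw [hr u hu ((le_max_left _ _).trans hn)]
      refine hηself u ((hM u (V_le hlm hu)).trans ?_)
      have h1 : r' ^ 2 ≤ normE u ^ 2 :=
        pow_le_pow_left₀ (Real.sqrt_nonneg _) ((le_max_right _ _).trans hn) 2
      rw [hr', Real.sq_sqrt (mul_nonneg hW.le (le_max_left _ _))] at h1
      have h2 := le_of_mul_le_mul_left (h1.trans (hWn u (V_le hlm hu))) hW
      have h3 := le_max_right 0 (M - action f β u₀)
      linarith
  have hfinal : level f β l m ≤ ((c - ε : ℝ) : EReal) :=
    (iInf₂_le _ hadm').trans (iSup₂_le fun u hu =>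
      EReal.coe_le_coe_iff.2 (hdef (h u) (hmaps u hu) (hbd u hu)))
  rw [hc] at hfinal
  have := EReal.coe_le_coe_iff.1 hfinal
  linarith

variable {T T' : Finset (ℤ × ℤ)} {a b : ℤ × ℤ → ℂ} {u φ ψ : ℝ × ℝ → ℝ}
  {f : ℝ → ℝ → ℝ} {β : ℝ} {l m : ℕ} {s c₁ c₂ C : ℝ}

/-! ### Consequences of the growth condition -/

/-- The growth condition on `f`, for a nonlinearity which is defined and continuous for all `x`. -/
structure HasGrowth (f : ℝ → ℝ → ℝ) (s c₁ c₂ C : ℝ) : Prop where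
  continuous : Continuous fun p : ℝ × ℝ => f p.1 p.2
  one_lt : 1 < s
  pos : 0 < c₁
  ratio : 2 * c₂ / (s + 1) < c₁
  nonneg : 0 ≤ C
  lower : ∀ x u, c₁ * |u| ^ (s + 1) - C * |u| ≤ u * f x u
  upper : ∀ x u, u * f x u ≤ c₂ * |u| ^ (s + 1) + C * |u|

theorem HasGrowth.reflect (h : HasGrowth f s c₁ c₂ C) : HasGrowth (fun x u => -f x (-u)) s c₁ c₂ C where
  continuous := (h.continuous.comp (continuous_fst.prodMk continuous_snd.neg)).neg
  one_lt := h.one_lt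
  pos := h.pos
  ratio := h.ratio
  nonneg := h.nonneg
  lower x u := by have := h.lower x (-u); rw [abs_neg] at this; linarith
  upper x u := by have := h.upper x (-u); rw [abs_neg] at this; linarith

theorem primitive_reflect (f : ℝ → ℝ → ℝ) (x u : ℝ) :
    primitive (fun x u => -f x (-u)) x (-u) = primitive f x u := by
  rw [primitive, primitive, intervalIntegral.integral_neg, intervalIntegral.integral_comp_neg (fun σ => f x σ),
    neg_neg, neg_zero, ← intervalIntegral.integral_symm]

theorem rpow_add_one_div {y : ℝ} (hy : 0 < y) (s : ℝ) : y ^ (s + 1) = y ^ s * y := by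
  rw [Real.rpow_add_one hy.ne']

theorem HasGrowth.le_of_pos (h : HasGrowth f s c₁ c₂ C) (x : ℝ) {y : ℝ} (hy : 0 < y) :
    c₁ * y ^ s - C ≤ f x y ∧ f x y ≤ c₂ * y ^ s + C := by
  have h1 := h.lower x y
  have h2 := h.upper x y
  rw [abs_of_pos hy, rpow_add_one_div hy] at h1 h2
  exact ⟨le_of_mul_le_mul_right (by linarith) hy, le_of_mul_le_mul_right (by linarith) hy⟩

theorem integral_const_mul_rpow_add {s : ℝ} (hs : 1 < s) (c C u : ℝ) :
    ∫ σ in (0 : ℝ)..u, (c * σ ^ s + C) = c / (s + 1) * u ^ (s + 1) + C * u := by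
  rw [intervalIntegral.integral_add, intervalIntegral.integral_const_mul,
    integral_rpow (Or.inl (by linarith)), Real.zero_rpow (by linarith), intervalIntegral.integral_const]
  · simp only [sub_zero, smul_eq_mul]
    ring
  · exact (intervalIntegral.intervalIntegrable_rpow' (by linarith)).const_mul _
  · exact intervalIntegrable_const

theorem HasGrowth.primitive_le_of_nonneg (h : HasGrowth f s c₁ c₂ C) (x : ℝ) {u : ℝ} (hu : 0 ≤ u) :
    c₁ / (s + 1) * u ^ (s + 1) - C * u ≤ primitive f x u ∧
      primitive f x u ≤ c₂ / (s + 1) * u ^ (s + 1) + C * u := by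
  have hfi : IntervalIntegrable (f x) volume 0 u :=
    (h.continuous.comp (continuous_const.prodMk continuous_id)).intervalIntegrable _ _
  have hi : ∀ c C : ℝ, IntervalIntegrable (fun σ : ℝ => c * σ ^ s + C) volume 0 u := fun c C =>
    ((intervalIntegral.intervalIntegrable_rpow' (by linarith [h.one_lt])).const_mul c).add intervalIntegrable_const
  constructor
  · have := intervalIntegral.integral_mono_on_of_le_Ioo hu (hi c₁ (-C)) hfi fun σ hσ => by
      have := (h.le_of_pos x hσ.1).1; linarith
    rw [integral_const_mul_rpow_add h.one_lt] at this
    rw [primitive]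
    linarith
  · have := intervalIntegral.integral_mono_on_of_le_Ioo hu hfi (hi c₂ C) fun σ hσ => (h.le_of_pos x hσ.1).2
    rwa [integral_const_mul_rpow_add h.one_lt] at this

theorem HasGrowth.primitive_bounds (h : HasGrowth f s c₁ c₂ C) (x u : ℝ) :
    c₁ / (s + 1) * |u| ^ (s + 1) - C * |u| ≤ primitive f x u ∧
      primitive f x u ≤ c₂ / (s + 1) * |u| ^ (s + 1) + C * |u| := by
  rcases le_total 0 u with hu | hu
  · rw [abs_of_nonneg hu]
    exact h.primitive_le_of_nonneg x hu
  · rw [abs_of_nonpos hu, ← primitive_reflect]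
    exact h.reflect.primitive_le_of_nonneg x (neg_nonneg.2 hu)

theorem exists_quadratic_le_rpow {s c : ℝ} (hs : 1 < s) (hc : 0 < c) (A B : ℝ) :
    ∃ M : ℝ, 0 ≤ M ∧ ∀ y : ℝ, 0 ≤ y → A * y ^ 2 + B * y ≤ c * y ^ (s + 1) + M := by
  set D := |A| + |B| with hD
  have hD0 : 0 ≤ D := by positivity
  set R := (D / c) ^ (1 / (s - 1)) with hR
  set Y := max 1 R with hY
  have hY1 : 1 ≤ Y := le_max_left _ _
  refine ⟨D * Y ^ 2, by positivity, fun y hy => ?_⟩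
  have hA := mul_le_mul_of_nonneg_right (le_abs_self A) (sq_nonneg y)
  have hB := mul_le_mul_of_nonneg_right (le_abs_self B) hy
  rcases le_total y Y with h | h
  · have h1 : y ^ 2 ≤ Y ^ 2 := pow_le_pow_left₀ hy h 2
    have h2 : y ≤ Y ^ 2 := h.trans (by nlinarith)
    have h3 : 0 ≤ c * y ^ (s + 1) := by positivity
    have h4 := mul_le_mul_of_nonneg_left h1 (abs_nonneg A)
    have h5 := mul_le_mul_of_nonneg_left h2 (abs_nonneg B)
    rw [hD]
    nlinarith
  · have hy1 : 1 ≤ y := hY1.trans h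
    have hy0 : 0 < y := by linarith
    have h1 : D / c ≤ y ^ (s - 1) := by
      have h2 : R ≤ y := (le_max_right _ _).trans h
      have h3 := Real.rpow_le_rpow (by positivity) h2 (by linarith : 0 ≤ s - 1)
      rwa [hR, ← Real.rpow_mul (by positivity), one_div_mul_cancel (by linarith), Real.rpow_one] at h3
    rw [div_le_iff₀ hc] at h1
    have h2 : y ^ (s + 1) = y ^ (s - 1) * y ^ 2 := by
      rw [← Real.rpow_natCast y 2, ← Real.rpow_add hy0]
      congr 1
      push_cast
      ring
    have h3 := mul_le_mul_of_nonneg_right h1 (sq_nonneg y)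
    have h4 : |B| * y ≤ |B| * y ^ 2 := mul_le_mul_of_nonneg_left (by nlinarith) (abs_nonneg B)
    have h5 : 0 ≤ D * Y ^ 2 := by positivity
    rw [h2]
    nlinarith

theorem HasCoeffs.continuous_comp (hf : Continuous fun p : ℝ × ℝ => f p.1 p.2) (h : HasCoeffs T a u) :
    Continuous fun p => f p.1 (u p) := hf.comp (continuous_fst.prodMk h.continuous)

/-- The action is bounded from above on the space of trigonometric polynomials with frequencies in
`T`, uniformly in `T` as long as the symbol is bounded from above on `T`. -/
theorem HasGrowth.exists_action_le (h : HasGrowth f s c₁ c₂ C) (L : ℝ) :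
    ∃ M : ℝ, ∀ (β : ℝ) (T : Finset (ℤ × ℤ)), (∀ q ∈ T, -q ∈ T) → (∀ q ∈ T, eigen β q ≤ L) →
      ∀ u ∈ trigPoly T, action f β u ≤ M - ∫ p in Q, u p ^ 2 := by
  have hs := h.one_lt
  obtain ⟨M, hM0, hM⟩ := exists_quadratic_le_rpow hs (div_pos h.pos (by linarith : 0 < s + 1)) (L / 2 + 1) C
  refine ⟨2 * Real.pi ^ 2 * M, fun β T hT hL u hu => ?_⟩
  have hF : Continuous fun p => primitive f p.1 (u p) :=
    HasCoeffs.continuous_comp (continuous_primitive h.continuous) hu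
  have hu2 : Continuous fun p => u p ^ 2 := (HasCoeffs.continuous hu).pow 2
  have hq : Real.pi ^ 2 * ∑ q ∈ T, eigen β q * ‖coeff u q.1 q.2‖ ^ 2 ≤ ∫ p in Q, L / 2 * u p ^ 2 := by
    rw [integral_const_mul, HasCoeffs.integral_sq hu, Finset.mul_sum, Finset.mul_sum, Finset.mul_sum]
    refine Finset.sum_le_sum fun q hq => ?_
    have := mul_le_mul_of_nonneg_right (hL q hq) (sq_nonneg ‖coeff u q.1 q.2‖)
    have := mul_le_mul_of_nonneg_left this (sq_nonneg Real.pi)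
    linarith
  rw [HasCoeffs.action_eq h.continuous hT hu]
  have i1 : IntegrableOn (fun p => L / 2 * u p ^ 2) Q := (continuous_const.mul hu2).integrableOn_Q
  have key : (∫ p in Q, L / 2 * u p ^ 2) - ∫ p in Q, primitive f p.1 (u p) ≤
      (∫ p in Q, M) - ∫ p in Q, u p ^ 2 := by
    rw [← integral_sub i1 hF.integrableOn_Q, ← integral_sub (integrable_const M) hu2.integrableOn_Q]
    refine setIntegral_mono (i1.sub hF.integrableOn_Q)
      ((integrable_const M : IntegrableOn _ Q volume).sub hu2.integrableOn_Q) fun p => ?_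
    have h1 := hM |u p| (abs_nonneg _)
    have h2 := (h.primitive_bounds p.1 (u p)).1
    rw [sq_abs] at h1
    simp only
    linarith
  rw [integral_const, volume_Q, smul_eq_mul] at key
  linarith

theorem eigen_le_of_mem_linkModes (hβ : 0 < β) {q : ℤ × ℤ} (hq : q ∈ linkModes l m) :
    eigen β q ≤ (l : ℝ) ^ 2 := by
  rw [mem_linkModes] at hq
  rw [eigen]
  split_ifs with hk
  · have : 0 ≤ β * (1 + (q.2 : ℝ) ^ 2) := by positivity
    nlinarith [sq_nonneg (l : ℝ)]
  · have h2 : (q.2 : ℝ) ^ 2 = (q.2.natAbs : ℝ) ^ 2 := by rw [Nat.cast_natAbs, Int.cast_abs, sq_abs]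
    have h1 : (q.1 : ℝ) ^ 2 = (q.1.natAbs : ℝ) ^ 2 := by rw [Nat.cast_natAbs, Int.cast_abs, sq_abs]
    rw [h1, h2]
    have hle : q.2.natAbs ≤ 2 * q.1.natAbs ∨ q.2.natAbs ≤ l := by omega
    rcases hle with hle | hle
    · have : (q.2.natAbs : ℝ) ≤ 2 * q.1.natAbs := by exact_mod_cast hle
      nlinarith [sq_nonneg (l : ℝ), Nat.cast_nonneg (α := ℝ) q.2.natAbs]
    · have : (q.2.natAbs : ℝ) ≤ l := by exact_mod_cast hle
      nlinarith [sq_nonneg (q.1.natAbs : ℝ), Nat.cast_nonneg (α := ℝ) q.2.natAbs]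

theorem galerkinModes_subset (m : ℕ) : galerkinModes m ⊆ linkModes m m := fun q hq => by
  rw [mem_galerkinModes] at hq
  rw [mem_linkModes]
  omega

/-- An `L¹` bound for the nonlinear term at critical points, in terms of the critical value. -/
theorem HasGrowth.exists_integral_abs_le (h : HasGrowth f s c₁ c₂ C) (M : ℝ) :
    ∃ K : ℝ, ∀ (β : ℝ) (T : Finset (ℤ × ℤ)), (∀ q ∈ T, -q ∈ T) → ∀ u ∈ trigPoly T,
      action f β u ≤ M → (∀ q ∈ T, gradCoeff f β u q = 0) → ∫ p in Q, |f p.1 (u p)| ≤ K := by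
  have hs := h.one_lt
  set κ := c₁ / 2 - c₂ / (s + 1) with hκ
  have hκ0 : 0 < κ := by
    have := h.ratio
    rw [mul_div_assoc] at this
    linarith
  have hc₂ : 0 ≤ c₂ := by
    by_contra! hneg
    have h1 := (h.lower 0 1).trans (h.upper 0 1)
    have hp := h.pos
    have hn := h.nonneg
    obtain ⟨N, hN0, hN⟩ := exists_quadratic_le_rpow (c := c₁) hs h.pos 0 (2 * C + 1)
    have h2 := (h.lower 0 (N + 1)).trans (h.upper 0 (N + 1))
    have h3 := hN (N + 1) (by linarith)
    rw [abs_of_nonneg (by linarith : 0 ≤ N + 1)] at h2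
    have h4 : 0 ≤ (N + 1) ^ (s + 1) := by positivity
    nlinarith
  obtain ⟨M', hM0, hM'⟩ := exists_quadratic_le_rpow hs (half_pos hκ0) 0 (3 / 2 * C)
  obtain ⟨B, hB⟩ := ((isCompact_Icc (a := (0 : ℝ)) (b := Real.pi)).prod
    (isCompact_Icc (a := (-1 : ℝ)) (b := 1))).exists_bound_of_continuousOn h.continuous.continuousOn
  have hB0 : 0 ≤ B := (norm_nonneg _).trans (hB (0, 0) ⟨⟨le_rfl, Real.pi_pos.le⟩, by norm_num⟩)
  have hpt : ∀ x ∈ Icc 0 Real.pi, ∀ y : ℝ,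
      |f x y| ≤ 2 * c₂ / κ * (1 / 2 * (y * f x y) - primitive f x y + M') + (C + B) := fun x hx y => by
    have hF := (h.primitive_bounds x y).2
    have hl := h.lower x y
    have h1 := hM' |y| (abs_nonneg y)
    have h2 : κ / 2 * |y| ^ (s + 1) ≤ 1 / 2 * (y * f x y) - primitive f x y + M' := by
      have : κ * |y| ^ (s + 1) = c₁ * |y| ^ (s + 1) / 2 - c₂ / (s + 1) * |y| ^ (s + 1) := by rw [hκ]; ring
      linarith
    have h3 : c₂ * |y| ^ (s + 1) ≤ 2 * c₂ / κ * (1 / 2 * (y * f x y) - primitive f x y + M') := by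
      refine le_trans (le_of_eq ?_) (mul_le_mul_of_nonneg_left h2 (by positivity))
      field_simp
    refine le_trans ?_ (add_le_add_left h3 _)
    rcases le_total |y| 1 with hy | hy
    · have h4 := hB (x, y) ⟨hx, abs_le.1 hy⟩
      have h5 : 0 ≤ c₂ * |y| ^ (s + 1) := by positivity
      rw [Real.norm_eq_abs] at h4
      simp only at h4
      linarith [h.nonneg]
    · have hy0 : 0 < |y| := by linarith
      have hu := h.upper x y
      have h5 : |y * f x y| ≤ c₂ * |y| ^ (s + 1) + C * |y| := by
        refine abs_le.2 ⟨?_, hu⟩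
        have : 0 ≤ (c₂ + c₁) * |y| ^ (s + 1) := by have := h.pos; positivity
        linarith
      rw [abs_mul] at h5
      have h6 : |f x y| * 1 ≤ |f x y| * |y| := mul_le_mul_of_nonneg_left hy (abs_nonneg _)
      have h7 : |f x y| ≤ c₂ * |y| ^ s + C := by
        refine le_of_mul_le_mul_left ?_ hy0
        rw [rpow_add_one_div hy0] at h5
        linarith
      have h8 : |y| ^ s ≤ |y| ^ (s + 1) := Real.rpow_le_rpow_of_exponent_le hy (by linarith)
      have := mul_le_mul_of_nonneg_left h8 hc₂
      linarith
  refine ⟨2 * c₂ / κ * (M + 2 * Real.pi ^ 2 * M') + 2 * Real.pi ^ 2 * (C + B), fun β T hT u hu hM hcrit => ?_⟩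
  have hfc : Continuous fun p => f p.1 (u p) := HasCoeffs.continuous_comp h.continuous hu
  have hFc : Continuous fun p => primitive f p.1 (u p) :=
    HasCoeffs.continuous_comp (continuous_primitive h.continuous) hu
  have huf : Continuous fun p => 1 / 2 * (u p * f p.1 (u p)) :=
    continuous_const.mul ((HasCoeffs.continuous hu).mul hfc)
  have hact : action f β u = (∫ p in Q, 1 / 2 * (u p * f p.1 (u p))) - ∫ p in Q, primitive f p.1 (u p) := by
    rw [HasCoeffs.action_eq h.continuous hT hu, integral_const_mul, HasCoeffs.integral_mul_re hu hfc.integrableOn_Q,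
      Finset.mul_sum, Finset.mul_sum, Finset.mul_sum]
    congr 1
    refine Finset.sum_congr rfl fun q hq => ?_
    have h1 : coeff (fun p => f p.1 (u p)) q.1 q.2 = eigen β q * coeff u q.1 q.2 :=
      (sub_eq_zero.1 (hcrit q hq)).symm
    rw [h1, map_mul, Complex.conj_ofReal, mul_left_comm (coeff u q.1 q.2), Complex.mul_conj, ← Complex.ofReal_mul,
      Complex.ofReal_re, Complex.normSq_eq_norm_sq]
    ring
  have hmono : ∫ p in Q, |f p.1 (u p)| ≤ ∫ p in Q, (2 * c₂ / κ *
      (1 / 2 * (u p * f p.1 (u p)) - primitive f p.1 (u p) + M') + (C + B)) := by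
    refine setIntegral_mono_on hfc.abs.integrableOn_Q (Continuous.integrableOn_Q ?_) measurableSet_Q
      fun p hp => hpt p.1 hp.1 (u p)
    exact (continuous_const.mul ((huf.sub hFc).add continuous_const)).add continuous_const
  refine hmono.trans ?_
  have i1 : IntegrableOn (fun p => 1 / 2 * (u p * f p.1 (u p)) - primitive f p.1 (u p)) Q :=
    (huf.sub hFc).integrableOn_Q
  have i2 : IntegrableOn (fun p => 1 / 2 * (u p * f p.1 (u p)) - primitive f p.1 (u p) + M') Q :=
    i1.add (integrable_const M')
  have i3 : IntegrableOn (fun p => 2 * c₂ / κ *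
      (1 / 2 * (u p * f p.1 (u p)) - primitive f p.1 (u p) + M')) Q := i2.const_mul _
  rw [integral_add i3 (integrable_const _), integral_const_mul, integral_add i1 (integrable_const _),
    integral_sub huf.integrableOn_Q hFc.integrableOn_Q, ← hact, integral_const, integral_const, volume_Q,
    smul_eq_mul, smul_eq_mul]
  gcongr

variable {T T' : Finset (ℤ × ℤ)} {a b : ℤ × ℤ → ℂ} {u φ ψ : ℝ × ℝ → ℝ}
  {f : ℝ → ℝ → ℝ} {β : ℝ} {l m : ℕ} {s c₁ c₂ C : ℝ}

/-! ### Bounded partial sums of a sawtooth series -/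

/-- The partial sums of `∑ sin (n ξ) / n`. -/
def sineSum (N : ℕ) (ξ : ℝ) : ℝ := ∑ n ∈ Finset.range N, Real.sin ((n + 1) * ξ) / (n + 1)

theorem abs_sineSum_le_mul (N : ℕ) {ξ : ℝ} (hξ : 0 ≤ ξ) : |sineSum N ξ| ≤ N * ξ := by
  refine (Finset.abs_sum_le_sum_abs _ _).trans ?_
  have : ∀ n ∈ Finset.range N, |Real.sin ((n + 1) * ξ) / (n + 1)| ≤ ξ := fun n _ => by
    have hn : (0 : ℝ) < n + 1 := by positivity
    rw [abs_div, abs_of_pos hn, div_le_iff₀ hn]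
    refine Real.abs_sin_le_abs.trans ?_
    rw [abs_of_nonneg (by positivity), mul_comm]
  simpa using Finset.sum_le_card_nsmul _ _ _ this

theorem abs_sineSum_sub_le {M N : ℕ} (hM : 1 ≤ M) (hMN : M ≤ N) (ξ : ℝ) :
    |2 * Real.sin (ξ / 2) * (sineSum N ξ - sineSum M ξ)| ≤ 2 / M := by
  have key : |2 * Real.sin (ξ / 2) * (sineSum N ξ - sineSum M ξ) + Real.cos ((N + 1 / 2) * ξ) / N -
      Real.cos ((M + 1 / 2) * ξ) / M| ≤ 1 / M - 1 / N := by
    induction N, hMN using Nat.le_induction with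
    | base => simp
    | succ N hMN ih =>
      have hN : (0 : ℝ) < N := by exact_mod_cast (by omega : 0 < N)
      have h1 : sineSum (N + 1) ξ = sineSum N ξ + Real.sin ((N + 1) * ξ) / (N + 1) :=
        Finset.sum_range_succ _ _
      have h2 : 2 * Real.sin (ξ / 2) * Real.sin ((N + 1) * ξ) =
          Real.cos ((N + 1 / 2) * ξ) - Real.cos ((N + 1 + 1 / 2) * ξ) := by
        rw [show ((N : ℝ) + 1 / 2) * ξ = (N + 1) * ξ - ξ / 2 by ring,
          show ((N : ℝ) + 1 + 1 / 2) * ξ = (N + 1) * ξ + ξ / 2 by ring, Real.cos_sub, Real.cos_add]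
        ring
      have h3 : 2 * Real.sin (ξ / 2) * (sineSum (N + 1) ξ - sineSum M ξ) +
          Real.cos (((N + 1 : ℕ) + 1 / 2) * ξ) / (N + 1 : ℕ) - Real.cos ((M + 1 / 2) * ξ) / M =
          (2 * Real.sin (ξ / 2) * (sineSum N ξ - sineSum M ξ) + Real.cos ((N + 1 / 2) * ξ) / N -
            Real.cos ((M + 1 / 2) * ξ) / M) - Real.cos ((N + 1 / 2) * ξ) * (1 / N - 1 / (N + 1)) := by
        rw [h1]
        push_cast
        have h4 : 2 * Real.sin (ξ / 2) * (sineSum N ξ + Real.sin ((N + 1) * ξ) / (N + 1) - sineSum M ξ) =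
            2 * Real.sin (ξ / 2) * (sineSum N ξ - sineSum M ξ) +
              (2 * Real.sin (ξ / 2) * Real.sin ((N + 1) * ξ)) / (N + 1) := by ring
        rw [h4, h2]
        ring
      have h5 : (0 : ℝ) ≤ 1 / N - 1 / (N + 1) := by
        rw [sub_nonneg]
        exact one_div_le_one_div_of_le hN (by linarith)
      have h6 : |Real.cos ((N + 1 / 2) * ξ) * (1 / N - 1 / (N + 1))| ≤ 1 / N - 1 / (N + 1) := by
        rw [abs_mul, abs_of_nonneg h5]
        exact mul_le_of_le_one_left h5 (Real.abs_cos_le_one _)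
      rw [h3]
      refine (abs_sub _ _).trans ?_
      push_cast
      linarith
  have hM0 : (0 : ℝ) < M := by exact_mod_cast hM
  have hN0 : (0 : ℝ) < N := by exact_mod_cast hM.trans hMN
  have hb : ∀ K : ℕ, 0 < (K : ℝ) → |Real.cos ((K + 1 / 2) * ξ) / K| ≤ 1 / K := fun K hK => by
    rw [abs_div, abs_of_pos hK]
    gcongr
    exact Real.abs_cos_le_one _
  have h1 := abs_le.1 (hb M hM0)
  have h2 := abs_le.1 (hb N hN0)
  have h3 := abs_le.1 key
  have h4 : (2 : ℝ) / M = 1 / M + 1 / M := by ring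
  rw [abs_le, h4]
  constructor <;> linarith [h1.1, h1.2, h2.1, h2.2, h3.1, h3.2]

theorem abs_sineSum_le_of_pos (N : ℕ) {ξ : ℝ} (hξ : 0 < ξ) (hξπ : ξ ≤ Real.pi) :
    |sineSum N ξ| ≤ 1 + 2 * Real.pi := by
  set M := ⌈1 / ξ⌉₊ with hM
  have hM1 : 1 ≤ M := Nat.one_le_ceil_iff.2 (by positivity)
  have hMl : 1 / ξ ≤ M := Nat.le_ceil _
  have hMu : (M : ℝ) < 1 / ξ + 1 := Nat.ceil_lt_add_one (by positivity)
  have hMξ : M * ξ ≤ 1 + Real.pi := by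
    have := mul_le_mul_of_nonneg_right hMu.le hξ.le
    rw [add_mul, one_div_mul_cancel hξ.ne'] at this
    linarith
  have h1ξ : 1 ≤ M * ξ := by rwa [div_le_iff₀ hξ] at hMl
  have hpi := Real.pi_pos
  rcases le_total N M with h | h
  · have h1 := abs_sineSum_le_mul N hξ.le
    have h2 : (N : ℝ) * ξ ≤ M * ξ := by gcongr
    linarith
  · have h1 := abs_sineSum_le_mul M hξ.le
    have h2 := abs_sineSum_sub_le hM1 h ξ
    have hs : ξ / Real.pi ≤ Real.sin (ξ / 2) := by
      have := Real.mul_le_sin (x := ξ / 2) (by linarith) (by linarith)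
      refine le_trans (le_of_eq ?_) this
      field_simp
    have hs0 : 0 < ξ / Real.pi := by positivity
    have h3 : |sineSum N ξ - sineSum M ξ| ≤ Real.pi := by
      rw [abs_mul, abs_of_pos (by linarith : 0 < 2 * Real.sin (ξ / 2))] at h2
      have hM0 : (0 : ℝ) < M := by exact_mod_cast hM1
      have h4 : 2 * (ξ / Real.pi) * |sineSum N ξ - sineSum M ξ| ≤ 2 / M :=
        (mul_le_mul_of_nonneg_right (by linarith) (abs_nonneg _)).trans h2
      rw [le_div_iff₀ hM0] at h4
      have h5 : 2 * (ξ / Real.pi) * |sineSum N ξ - sineSum M ξ| * M =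
        2 / Real.pi * (M * ξ) * |sineSum N ξ - sineSum M ξ| := by ring
      rw [h5] at h4
      have h6 : 2 / Real.pi * 1 * |sineSum N ξ - sineSum M ξ| ≤ 2 :=
        (mul_le_mul_of_nonneg_right (mul_le_mul_of_nonneg_left h1ξ (by positivity)) (abs_nonneg _)).trans h4
      rw [mul_one, div_mul_eq_mul_div, div_le_iff₀ hpi] at h6
      linarith
    have h4 : sineSum N ξ = sineSum M ξ + (sineSum N ξ - sineSum M ξ) := by ring
    rw [h4]
    refine (abs_add_le _ _).trans ?_
    linarith

theorem sineSum_neg (N : ℕ) (ξ : ℝ) : sineSum N (-ξ) = -sineSum N ξ := by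
  simp only [sineSum, mul_neg, Real.sin_neg, neg_div, Finset.sum_neg_distrib]

theorem sineSum_sub_int_mul (N : ℕ) (ξ : ℝ) (k : ℤ) : sineSum N (ξ - k * (2 * Real.pi)) = sineSum N ξ := by
  refine Finset.sum_congr rfl fun n _ => ?_
  rw [show ((n : ℝ) + 1) * (ξ - k * (2 * Real.pi)) = (n + 1) * ξ - ((n + 1) * k : ℤ) * (2 * Real.pi) by
    push_cast; ring, Real.sin_sub_int_mul_two_pi]

theorem abs_sineSum_le (N : ℕ) (ξ : ℝ) : |sineSum N ξ| ≤ 1 + 2 * Real.pi := by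
  have hpi := Real.pi_pos
  rw [← sineSum_sub_int_mul N ξ (round (ξ / (2 * Real.pi)))]
  set ζ := ξ - round (ξ / (2 * Real.pi)) * (2 * Real.pi) with hζ
  have hb : |ζ| ≤ Real.pi := by
    have h1 := abs_sub_round (ξ / (2 * Real.pi))
    have h2 : ζ = (ξ / (2 * Real.pi) - round (ξ / (2 * Real.pi))) * (2 * Real.pi) := by
      rw [hζ]; field_simp
    rw [h2, abs_mul, abs_of_pos (by positivity : 0 < 2 * Real.pi)]
    nlinarith
  rcases lt_trichotomy ζ 0 with h | h | h
  · have := abs_sineSum_le_of_pos N (neg_pos.2 h) (by rwa [abs_of_neg h] at hb)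
    rwa [sineSum_neg, abs_neg] at this
  · rw [h]
    simp only [sineSum, mul_zero, Real.sin_zero, zero_div, Finset.sum_const_zero, abs_zero]
    positivity
  · exact abs_sineSum_le_of_pos N h (by rwa [abs_of_pos h] at hb)

/-- The partial sums of `∑ e ^ (i n ξ) / n` over the nonzero integers. -/
def expSum (m : ℕ) (ξ : ℝ) : ℂ :=
  ∑ n ∈ Finset.Icc (-m : ℤ) m, (n : ℂ)⁻¹ * Complex.exp (Complex.I * ((n * ξ : ℝ) : ℂ))

theorem expSum_eq (m : ℕ) (ξ : ℝ) : expSum m ξ = 2 * Complex.I * sineSum m ξ := by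
  induction m with
  | zero => simp [expSum, sineSum]
  | succ m ih =>
    have h1 : Finset.Icc (-(m + 1 : ℕ) : ℤ) (m + 1 : ℕ) =
        insert (m + 1 : ℤ) (insert (-(m + 1) : ℤ) (Finset.Icc (-m : ℤ) m)) := by
      ext n
      simp only [Finset.mem_insert, Finset.mem_Icc]
      omega
    have h2 : sineSum (m + 1) ξ = sineSum m ξ + Real.sin ((m + 1) * ξ) / (m + 1) :=
      Finset.sum_range_succ _ _
    rw [expSum, h1, Finset.sum_insert (by simp; omega), Finset.sum_insert (by simp), ← expSum, ih, h2]
    have hm : (m : ℂ) + 1 ≠ 0 := by exact_mod_cast m.succ_ne_zero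
    push_cast
    rw [Complex.sin, show -(((m : ℂ) + 1) * ξ) * Complex.I = Complex.I * ((-1 + -(m : ℂ)) * ξ) by ring,
      show ((m : ℂ) + 1) * ξ * Complex.I = Complex.I * ((m + 1) * ξ) by ring]
    have hI : Complex.I * Complex.I = -1 := Complex.I_mul_I
    rw [show -1 + -(m : ℂ) = -(m + 1) by ring, inv_neg]
    generalize Complex.exp (Complex.I * (((m : ℂ) + 1) * ξ)) = A
    generalize Complex.exp (Complex.I * (-((m : ℂ) + 1) * ξ)) = B
    field_simp
    linear_combination (A - B) * hI

theorem norm_expSum_le (m : ℕ) (ξ : ℝ) : ‖expSum m ξ‖ ≤ 2 * (1 + 2 * Real.pi) := by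
  rw [expSum_eq, norm_mul, norm_mul, Complex.norm_I, Complex.norm_ofNat, mul_one, Complex.norm_real,
    Real.norm_eq_abs]
  gcongr
  exact abs_sineSum_le m ξ

/-! ### The kernel of the inverse of the d'Alembertian -/

theorem sum_exp_range_four (n : ℤ) :
    ∑ r ∈ Finset.range 4, Complex.exp (Complex.I * ((n * (r * (Real.pi / 2)) : ℝ) : ℂ)) = if 4 ∣ n then 4 else 0 := by
  set z := Complex.exp (Complex.I * ((n * (Real.pi / 2) : ℝ) : ℂ)) with hz
  have h1 : ∀ r ∈ Finset.range 4, Complex.exp (Complex.I * ((n * (r * (Real.pi / 2)) : ℝ) : ℂ)) = z ^ r :=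
    fun r _ => by
      rw [hz, ← Complex.exp_nat_mul]
      congr 1
      push_cast
      ring
  rw [Finset.sum_congr rfl h1]
  have h4 : z ^ 4 = 1 := by
    rw [hz, ← Complex.exp_nat_mul, Complex.exp_eq_one_iff]
    exact ⟨n, by push_cast; ring⟩
  have hz1 : z = 1 ↔ 4 ∣ n := by
    rw [hz, Complex.exp_eq_one_iff]
    constructor
    · rintro ⟨k, hk⟩
      refine ⟨k, ?_⟩
      have hI : Complex.I * (Real.pi / 2) ≠ 0 := mul_ne_zero Complex.I_ne_zero (by
        exact_mod_cast (by positivity : Real.pi / 2 ≠ 0))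
      have : (n : ℂ) * (Complex.I * (Real.pi / 2)) = (4 * k) * (Complex.I * (Real.pi / 2)) := by
        push_cast at hk
        linear_combination hk
      exact_mod_cast mul_right_cancel₀ hI this
    · rintro ⟨k, rfl⟩
      exact ⟨k, by push_cast; ring⟩
  split_ifs with h
  · rw [hz1.2 h]
    norm_num
  · have hne : z - 1 ≠ 0 := sub_ne_zero.2 fun h' => h (hz1.1 h')
    have := mul_geom_sum z 4
    rw [h4, sub_self] at this
    exact (mul_eq_zero.1 this).resolve_left hne

theorem eigen_of_notMem {q : ℤ × ℤ} (hq : q ∉ kernelModes) :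
    eigen β q = ((q.2 - 2 * q.1 : ℤ) : ℝ) * ((q.2 + 2 * q.1 : ℤ) : ℝ) := by
  rw [eigen, if_neg hq]
  push_cast
  ring

theorem eigen_of_mem {q : ℤ × ℤ} (hq : q ∈ kernelModes) : eigen β q = -(β * (1 + (q.2 : ℝ) ^ 2)) := by
  rw [eigen, if_pos hq]

open Classical in
/-- The kernel of the inverse of the d'Alembertian on `E^m`. -/
def waveKernel (m : ℕ) (p : ℝ × ℝ) : ℂ :=
  ∑ q ∈ galerkinModes m with q ∉ kernelModes, (((q.2 : ℝ) ^ 2 - 4 * (q.1 : ℝ) ^ 2 : ℝ) : ℂ)⁻¹ * character q.1 q.2 p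

theorem waveKernel_eq (m : ℕ) (p : ℝ × ℝ) : waveKernel m p =
    1 / 4 * ∑ r ∈ Finset.range 4, expSum m ((p.2 - p.1) / 2 - r * (Real.pi / 2)) *
      expSum m ((p.2 + p.1) / 2 + r * (Real.pi / 2)) := by
  classical
  set ξ := (p.2 - p.1) / 2 with hξ
  set η := (p.2 + p.1) / 2 with hη
  set B := Finset.Icc (-m : ℤ) m ×ˢ Finset.Icc (-m : ℤ) m with hB
  set G : ℤ × ℤ → ℂ := fun c => (c.1 : ℂ)⁻¹ * (c.2 : ℂ)⁻¹ *
    Complex.exp (Complex.I * ((c.1 * ξ + c.2 * η : ℝ) : ℂ)) with hG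
  have h1 : ∀ r : ℕ, expSum m (ξ - r * (Real.pi / 2)) * expSum m (η + r * (Real.pi / 2)) =
      ∑ c ∈ B, G c * Complex.exp (Complex.I * (((c.2 - c.1 : ℤ) * (r * (Real.pi / 2)) : ℝ) : ℂ)) := fun r => by
    rw [expSum, expSum, Finset.sum_mul_sum, hB, Finset.sum_product]
    refine Finset.sum_congr rfl fun x _ => Finset.sum_congr rfl fun y _ => ?_
    simp only [hG]
    rw [mul_mul_mul_comm, mul_assoc _ (Complex.exp _), ← Complex.exp_add, ← Complex.exp_add]
    congr 2
    push_cast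
    ring
  simp only [h1]
  rw [Finset.sum_comm]
  simp only [← Finset.mul_sum, sum_exp_range_four]
  rw [Finset.mul_sum, waveKernel]
  have h2 : ∀ c ∈ B, 1 / 4 * (G c * if (4 : ℤ) ∣ c.2 - c.1 then (4 : ℂ) else 0) =
      if (4 : ℤ) ∣ c.2 - c.1 ∧ c.1 ≠ 0 ∧ c.2 ≠ 0 then G c else 0 := fun c _ => by
    by_cases hd : (4 : ℤ) ∣ c.2 - c.1
    · by_cases h1 : c.1 = 0
      · simp [h1, hG]
      · by_cases h2 : c.2 = 0
        · simp [h2, hG]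
        · rw [if_pos hd, if_pos ⟨hd, h1, h2⟩]; ring
    · simp [hd]
  rw [Finset.sum_congr rfl h2, ← Finset.sum_filter]
  refine Finset.sum_nbij' (fun q => (q.2 - 2 * q.1, q.2 + 2 * q.1)) (fun c => ((c.2 - c.1) / 4, (c.1 + c.2) / 2))
    ?_ ?_ ?_ ?_ ?_
  · rintro q hq
    simp only [Finset.mem_filter, mem_galerkinModes, mem_kernelModes_iff, hB, Finset.mem_product,
      Finset.mem_Icc] at hq ⊢
    omega
  · rintro c hc
    simp only [Finset.mem_filter, mem_galerkinModes, mem_kernelModes_iff, hB, Finset.mem_product,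
      Finset.mem_Icc] at hc ⊢
    omega
  · rintro q _
    ext <;> simp only <;> omega
  · rintro c hc
    simp only [Finset.mem_filter] at hc
    ext <;> simp only <;> omega
  · rintro q _
    simp only [hG]
    rw [character, ← mul_inv]
    congr 2
    · push_cast
      ring
    · congr 2
      rw [hξ, hη]
      push_cast
      ring

theorem exists_norm_waveKernel_le : ∃ D : ℝ, ∀ m p, ‖waveKernel m p‖ ≤ D := by
  refine ⟨1 / 4 * ∑ r ∈ Finset.range 4, (2 * (1 + 2 * Real.pi)) * (2 * (1 + 2 * Real.pi)), fun m p => ?_⟩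
  rw [waveKernel_eq, norm_mul]
  refine mul_le_mul (by norm_num) ((norm_sum_le _ _).trans (Finset.sum_le_sum fun r _ => ?_)) (norm_nonneg _)
    (by norm_num)
  rw [norm_mul]
  exact mul_le_mul (norm_expSum_le _ _) (norm_expSum_le _ _) (norm_nonneg _) (by positivity)

/-! ### Summability of the inverse symbol -/

theorem one_le_abs_eigen {q : ℤ × ℤ} (hq : q ∉ kernelModes) : 1 ≤ |eigen β q| := by
  rw [eigen_of_notMem hq, ← Int.cast_mul, ← Int.cast_abs]
  have h : (q.2 - 2 * q.1) * (q.2 + 2 * q.1) ≠ 0 := by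
    rw [mem_kernelModes_iff] at hq
    exact mul_ne_zero (by omega) (by omega)
  exact_mod_cast Int.one_le_abs h

theorem summable_eigen_rpow {r : ℝ} (hr : 1 < r) :
    Summable (kernelModesᶜ.indicator fun q : ℤ × ℤ => |eigen β q| ^ (-r)) := by
  have h1 : Summable fun n : ℤ => |(n : ℝ)| ^ (-r) := Real.summable_abs_int_rpow hr
  have h2 : Summable fun c : ℤ × ℤ => |(c.1 : ℝ)| ^ (-r) * |(c.2 : ℝ)| ^ (-r) :=
    h1.mul_of_nonneg h1 (fun _ => by positivity) (fun _ => by positivity)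
  have hinj : Function.Injective fun q : ℤ × ℤ => (q.2 - 2 * q.1, q.2 + 2 * q.1) := fun q q' h => by
    simp only [Prod.mk.injEq] at h
    ext <;> omega
  refine (h2.comp_injective hinj).of_nonneg_of_le (fun q => indicator_nonneg (fun _ _ => by positivity) q)
    fun q => ?_
  by_cases hq : q ∈ kernelModes
  · rw [indicator_of_notMem (by simpa using hq)]
    exact mul_nonneg (by positivity) (by positivity)
  · rw [indicator_of_mem (by simpa using hq), eigen_of_notMem hq, abs_mul,
      Real.mul_rpow (abs_nonneg _) (abs_nonneg _)]
    rfl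

theorem summable_eigen_inv_kernel (β : ℝ) :
    Summable (kernelModes.indicator fun q : ℤ × ℤ => |eigen β q|⁻¹) := by
  have h0 : Summable fun j : ℤ => |β|⁻¹ * (1 + (j : ℝ) ^ 2)⁻¹ := by
    refine Summable.mul_left _ ?_
    have h1 : Summable fun n : ℤ => |(n : ℝ)| ^ (-(2 : ℝ)) := Real.summable_abs_int_rpow (by norm_num)
    have h2 : Summable fun n : ℤ => |(n : ℝ)| ^ (-(2 : ℝ)) + (if n = 0 then 1 else 0 : ℝ) :=
      h1.add (summable_of_hasFiniteSupport ((finite_singleton (0 : ℤ)).subset fun n hn => by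
        by_contra h; simp at h; simp [h] at hn))
    refine h2.of_nonneg_of_le (fun n => by positivity) fun n => ?_
    by_cases hn : n = 0
    · simp [hn]
    · rw [if_neg hn, add_zero, Real.rpow_neg (abs_nonneg _), Real.rpow_two, sq_abs]
      have : (0 : ℝ) < (n : ℝ) ^ 2 := by positivity
      exact inv_anti₀ this (by linarith)
  have hval : ∀ (j : ℤ) (ε : ℤ), ε = 1 ∨ ε = -1 →
      |eigen β (j, ε * (2 * j))|⁻¹ ≤ |β|⁻¹ * (1 + (j : ℝ) ^ 2)⁻¹ := fun j ε hε => by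
    have hk : (j, ε * (2 * j)) ∈ kernelModes := by
      rw [mem_kernelModes_iff]
      rcases hε with rfl | rfl <;> simp only <;> omega
    rw [eigen_of_mem hk, abs_neg, abs_mul, mul_inv]
    have he : ((ε * (2 * j) : ℤ) : ℝ) ^ 2 = 4 * (j : ℝ) ^ 2 := by
      rcases hε with rfl | rfl <;> push_cast <;> ring
    simp only [he]
    rw [abs_of_pos (by positivity : (0 : ℝ) < 1 + 4 * (j : ℝ) ^ 2)]
    gcongr
    nlinarith [sq_nonneg (j : ℝ)]
  have hrange : ∀ ε : ℤ, ε = 1 ∨ ε = -1 →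
      Summable ((range fun j : ℤ => (j, ε * (2 * j))).indicator fun q : ℤ × ℤ => |eigen β q|⁻¹) := fun ε hε => by
    have hinj : Function.Injective fun j : ℤ => (j, ε * (2 * j)) := fun j j' h => by
      simp only [Prod.mk.injEq] at h
      exact h.1
    refine (hinj.summable_iff fun q hq => indicator_of_notMem hq _).1 ?_
    refine h0.of_nonneg_of_le (fun j => ?_) fun j => ?_
    · exact indicator_nonneg (f := fun q : ℤ × ℤ => |eigen β q|⁻¹) (fun _ _ => by positivity) _
    · simp only [Function.comp]
      rw [indicator_of_mem (mem_range_self j)]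
      exact hval j ε hε
  refine ((hrange 1 (Or.inl rfl)).add (hrange (-1) (Or.inr rfl))).of_nonneg_of_le
    (fun q => indicator_nonneg (fun _ _ => by positivity) q) fun q => ?_
  have n1 : 0 ≤ (range fun j : ℤ => (j, (1 : ℤ) * (2 * j))).indicator (fun q : ℤ × ℤ => |eigen β q|⁻¹) q :=
    indicator_nonneg (fun _ _ => by positivity) q
  have n2 : 0 ≤ (range fun j : ℤ => (j, (-1 : ℤ) * (2 * j))).indicator (fun q : ℤ × ℤ => |eigen β q|⁻¹) q :=
    indicator_nonneg (fun _ _ => by positivity) q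
  by_cases hq : q ∈ kernelModes
  · rw [indicator_of_mem hq]
    have hq' := hq
    rw [mem_kernelModes_iff] at hq'
    have hor : q.2 = 1 * (2 * q.1) ∨ q.2 = -1 * (2 * q.1) := by omega
    rcases hor with h | h
    · rw [indicator_of_mem (show q ∈ range fun j : ℤ => (j, (1 : ℤ) * (2 * j)) from ⟨q.1, Prod.ext rfl h.symm⟩)]
      linarith
    · rw [indicator_of_mem (show q ∈ range fun j : ℤ => (j, (-1 : ℤ) * (2 * j)) from ⟨q.1, Prod.ext rfl h.symm⟩)]
      linarith
  · rw [indicator_of_notMem hq]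
    linarith

theorem summable_eigen_inv_sq (hβ : 0 < β) : Summable fun q : ℤ × ℤ => |eigen β q|⁻¹ ^ 2 := by
  refine ((summable_eigen_rpow (β := β) (r := 2) (by norm_num)).add
    ((summable_eigen_inv_kernel β).mul_left β⁻¹)).of_nonneg_of_le (fun q => by positivity) fun q => ?_
  by_cases hq : q ∈ kernelModes
  · rw [indicator_of_notMem (by simpa using hq), indicator_of_mem hq, zero_add, pow_two]
    gcongr
    rw [eigen_of_mem hq, abs_neg, abs_of_pos (by positivity)]
    nlinarith [sq_nonneg (q.2 : ℝ)]
  · rw [indicator_of_mem (by simpa using hq), indicator_of_notMem hq, mul_zero, add_zero,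
      Real.rpow_neg (abs_nonneg _), Real.rpow_two, inv_pow]

/-! ### The sup bound for critical points -/

theorem character_sub (j k : ℤ) (p p' : ℝ × ℝ) :
    character j k (p - p') = character j k p * character (-j) (-k) p' := by
  simp only [character, ← Complex.exp_add, Prod.fst_sub, Prod.snd_sub]
  congr 1
  push_cast
  ring

theorem eigen_ne_zero (hβ : 0 < β) (q : ℤ × ℤ) : eigen β q ≠ 0 := by
  by_cases hq : q ∈ kernelModes
  · rw [eigen_of_mem hq]
    have : 0 < β * (1 + (q.2 : ℝ) ^ 2) := by positivity
    linarith
  · intro h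
    have := one_le_abs_eigen (β := β) hq
    rw [h, abs_zero] at this
    linarith

/-- The component of a trigonometric polynomial in the range of the d'Alembertian. -/
def rangePart (u : ℝ × ℝ → ℝ) : ℝ × ℝ → ℝ := fourierPart kernelModesᶜ u

theorem neg_mem_compl_kernelModes : ∀ q ∈ kernelModesᶜ, -q ∈ kernelModesᶜ := fun q hq h =>
  hq (by simpa using neg_mem_kernelModes _ h)

theorem HasCoeffs.kernelPart_add_rangePart (h : HasCoeffs T a u) (hT : ∀ q ∈ T, -q ∈ T) :
    kernelPart u + rangePart u = u := by
  ext p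
  have h1 := (h.modePart hT neg_mem_kernelModes).add (h.modePart hT neg_mem_compl_kernelModes) p
  rw [indicator_self_add_compl, ← h p] at h1
  exact_mod_cast h1

theorem coeff_eq_div_eigen (hβ : 0 < β) {q : ℤ × ℤ} (h : gradCoeff f β u q = 0) :
    coeff u q.1 q.2 = (eigen β q : ℂ)⁻¹ * coeff (fun p => f p.1 (u p)) q.1 q.2 := by
  have h1 : (eigen β q : ℂ) ≠ 0 := by exact_mod_cast eigen_ne_zero hβ q
  rw [← sub_eq_zero.1 h, inv_mul_cancel_left₀ h1]

theorem exists_abs_rangePart_le : ∃ D : ℝ, 0 ≤ D ∧ ∀ (f : ℝ → ℝ → ℝ) (β : ℝ) (m : ℕ) (u : ℝ × ℝ → ℝ),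
    (Continuous fun p : ℝ × ℝ => f p.1 p.2) → 0 < β →
    u ∈ trigPoly (galerkinModes m) → (∀ q ∈ galerkinModes m, gradCoeff f β u q = 0) →
    ∀ p, |rangePart u p| ≤ D * ∫ p in Q, |f p.1 (u p)| := by
  classical
  obtain ⟨D, hD⟩ := exists_norm_waveKernel_le
  have hD0 : 0 ≤ D := (norm_nonneg _).trans (hD 0 0)
  refine ⟨1 / (2 * Real.pi ^ 2) * D, by positivity, fun f β m u hf hβ hu hcrit p => ?_⟩
  have hfc : Continuous fun p => f p.1 (u p) := HasCoeffs.continuous_comp hf hu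
  have h1 := HasCoeffs.modePart hu (neg_mem_galerkinModes m) neg_mem_compl_kernelModes p
  have h2 : ((rangePart u p : ℝ) : ℂ) = ((1 / (2 * Real.pi ^ 2) : ℝ) : ℂ) *
      ∫ p' in Q, (f p'.1 (u p') : ℂ) * waveKernel m (p - p') := by
    rw [show rangePart u p = fourierPart kernelModesᶜ u p from rfl, h1]
    have h3 : ∀ p' : ℝ × ℝ, (f p'.1 (u p') : ℂ) * waveKernel m (p - p') =
        ∑ q ∈ galerkinModes m with q ∉ kernelModes, ((eigen β q : ℂ)⁻¹ * character q.1 q.2 p) *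
          ((f p'.1 (u p') : ℂ) * character (-q.1) (-q.2) p') := fun p' => by
      rw [waveKernel, Finset.mul_sum]
      refine Finset.sum_congr rfl fun q hq => ?_
      rw [character_sub, eigen, if_neg (Finset.mem_filter.1 hq).2]
      ring
    simp only [h3]
    rw [integral_finsetSum _ fun q _ => (integrable_mul_character hfc.integrableOn_Q _ _).const_mul _,
      Finset.mul_sum, Finset.sum_filter]
    refine Finset.sum_congr rfl fun q hq => ?_
    by_cases hk : q ∈ kernelModes
    · simp [hk]
    · rw [indicator_of_mem (by simpa using hk), if_pos hk, integral_const_mul, coeff_eq_div_eigen hβ (hcrit q hq),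
        coeff]
      ring
  rw [← Real.norm_eq_abs, ← Complex.norm_real, h2, norm_mul, Complex.norm_real,
    Real.norm_of_nonneg (by positivity), mul_assoc]
  gcongr
  refine (norm_integral_le_integral_norm _).trans ?_
  rw [← integral_const_mul]
  refine integral_mono_of_nonneg (ae_of_all _ fun _ => norm_nonneg _)
    (hfc.abs.integrableOn_Q.const_mul D) (ae_of_all _ fun p' => ?_)
  simp only [norm_mul, Complex.norm_real, Real.norm_eq_abs]
  rw [mul_comm]
  exact mul_le_mul_of_nonneg_right (hD _ _) (abs_nonneg _)

theorem exists_abs_kernelPart_le (hβ : 0 < β) : ∃ D : ℝ, 0 ≤ D ∧ ∀ (f : ℝ → ℝ → ℝ) (m : ℕ) (u : ℝ × ℝ → ℝ),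
    u ∈ trigPoly (galerkinModes m) → (∀ q ∈ galerkinModes m, gradCoeff f β u q = 0) →
    ∀ p, |kernelPart u p| ≤ D * ∫ p in Q, |f p.1 (u p)| := by
  classical
  have hs := summable_eigen_inv_kernel β
  have hnn : ∀ q, 0 ≤ kernelModes.indicator (fun q : ℤ × ℤ => |eigen β q|⁻¹) q :=
    fun q => indicator_nonneg (fun _ _ => by positivity) q
  refine ⟨(∑' q, kernelModes.indicator (fun q : ℤ × ℤ => |eigen β q|⁻¹) q) * (1 / (2 * Real.pi ^ 2)),
    mul_nonneg (tsum_nonneg hnn) (by positivity), fun f m u hu hcrit p => ?_⟩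
  have h1 := HasCoeffs.modePart hu (neg_mem_galerkinModes m) neg_mem_kernelModes p
  set K := 1 / (2 * Real.pi ^ 2) * ∫ p in Q, |f p.1 (u p)| with hK
  have hK0 : 0 ≤ K := mul_nonneg (by positivity) (integral_nonneg fun _ => abs_nonneg _)
  rw [← Real.norm_eq_abs, ← Complex.norm_real, show kernelPart u p = fourierPart kernelModes u p from rfl, h1,
    mul_assoc]
  refine (norm_sum_le _ _).trans ?_
  refine le_trans (Finset.sum_le_sum (g := fun q => kernelModes.indicator (fun q : ℤ × ℤ => |eigen β q|⁻¹) q * K)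
    fun q hq => ?_) ?_
  · rw [norm_mul, norm_character, mul_one]
    by_cases hk : q ∈ kernelModes
    · rw [indicator_of_mem hk, indicator_of_mem hk, coeff_eq_div_eigen hβ (hcrit q hq), norm_mul, norm_inv,
        Complex.norm_real, Real.norm_eq_abs]
      gcongr
      exact norm_coeff_le _ _ _
    · simp [hk]
  · rw [← Finset.sum_mul]
    exact mul_le_mul_of_nonneg_right (hs.sum_le_tsum _ fun q _ => hnn q) hK0

variable {T T' : Finset (ℤ × ℤ)} {a b c : ℤ × ℤ → ℂ} {u φ ψ : ℝ × ℝ → ℝ}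
  {f : ℝ → ℝ → ℝ} {β : ℝ} {l m : ℕ} {s c₁ c₂ C : ℝ}

/-! ### Compactness of the coefficients -/

theorem exists_tendsto_subseq {d : ℕ → ℤ × ℤ → ℂ} {R : ℝ} (hd : ∀ n q, ‖d n q‖ ≤ R) :
    ∃ (c : ℤ × ℤ → ℂ) (σ : ℕ → ℕ), StrictMono σ ∧ ∀ q, Tendsto (fun n => d (σ n) q) atTop (𝓝 (c q)) := by
  have hK : IsCompact (univ.pi fun _ : ℤ × ℤ => Metric.closedBall (0 : ℂ) R) :=
    isCompact_univ_pi fun _ => isCompact_closedBall _ _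
  obtain ⟨c, -, σ, hσ, hc⟩ := hK.tendsto_subseq (x := d) fun n q _ => by simpa using hd n q
  exact ⟨c, σ, hσ, fun q => tendsto_pi_nhds.1 hc q⟩

theorem eventually_sum_mul_norm_le {ι : Type*} {w : ι → ℝ} (hw0 : ∀ q, 0 ≤ w q)
    (hw : Summable fun q => w q ^ 2) {e : ℕ → ι → ℂ} {R : ℝ}
    (he : ∀ (n : ℕ) (S : Finset ι), ∑ q ∈ S, ‖e n q‖ ^ 2 ≤ R)
    (he0 : ∀ q, Tendsto (fun n => e n q) atTop (𝓝 0)) {ε : ℝ} (hε : 0 < ε) :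
    ∀ᶠ n in atTop, ∀ S : Finset ι, ∑ q ∈ S, w q * ‖e n q‖ ≤ ε := by
  classical
  have hR : 0 ≤ R := by simpa using he 0 ∅
  set δ := ε / (2 * (R + 1)) with hδ
  have hδ0 : 0 < δ := by positivity
  have hδR : δ * R ≤ ε / 2 := by
    rw [hδ, div_mul_eq_mul_div, div_le_div_iff₀ (by positivity) two_pos]
    nlinarith
  obtain ⟨S₀, hS₀⟩ := summable_iff_vanishing_norm.1 hw (δ * (ε / 2)) (by positivity)
  have hlim : Tendsto (fun n => ∑ q ∈ S₀, w q * ‖e n q‖) atTop (𝓝 0) := by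
    have := tendsto_finsetSum S₀ fun q _ => (he0 q).norm.const_mul (w q)
    simpa using this
  filter_upwards [hlim.eventually (gt_mem_nhds (half_pos hε))] with n hn S
  have h1 : ∑ q ∈ S, w q * ‖e n q‖ ≤ ∑ q ∈ S₀, w q * ‖e n q‖ + ∑ q ∈ S \ S₀, w q * ‖e n q‖ := by
    rw [← Finset.sum_union Finset.disjoint_sdiff, Finset.union_sdiff_self_eq_union]
    exact Finset.sum_le_sum_of_subset_of_nonneg Finset.subset_union_right
      fun q _ _ => mul_nonneg (hw0 q) (norm_nonneg _)
  have h2 : ∑ q ∈ S \ S₀, w q * ‖e n q‖ ≤ ∑ q ∈ S \ S₀, (w q ^ 2 / δ + δ * ‖e n q‖ ^ 2) / 2 := by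
    refine Finset.sum_le_sum fun q _ => ?_
    rw [le_div_iff₀ two_pos]
    have h3 : 0 ≤ (w q - δ * ‖e n q‖) ^ 2 / δ := by positivity
    have h4 : (w q - δ * ‖e n q‖) ^ 2 / δ = w q ^ 2 / δ + δ * ‖e n q‖ ^ 2 - w q * ‖e n q‖ * 2 := by
      field_simp
      ring
    linarith
  have h3 : ∑ q ∈ S \ S₀, (w q ^ 2 / δ + δ * ‖e n q‖ ^ 2) / 2 =
      ((∑ q ∈ S \ S₀, w q ^ 2) / δ + δ * ∑ q ∈ S \ S₀, ‖e n q‖ ^ 2) / 2 := by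
    rw [← Finset.sum_div, Finset.sum_add_distrib, ← Finset.sum_div, ← Finset.mul_sum]
  have h4 : (∑ q ∈ S \ S₀, w q ^ 2) / δ ≤ ε / 2 := by
    rw [div_le_iff₀ hδ0, mul_comm]
    have := (hS₀ (S \ S₀) Finset.sdiff_disjoint).le
    rwa [Real.norm_of_nonneg (Finset.sum_nonneg fun q _ => sq_nonneg _)] at this
  have h5 := mul_le_mul_of_nonneg_left (he n (S \ S₀)) hδ0.le
  linarith

theorem Summable.mul_norm {ι : Type*} {w : ι → ℝ} {c : ι → ℂ} (hw0 : ∀ q, 0 ≤ w q)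
    (hw : Summable fun q => w q ^ 2) (hc : Summable fun q => ‖c q‖ ^ 2) :
    Summable fun q => w q * ‖c q‖ :=
  (hw.add hc).of_nonneg_of_le (fun q => mul_nonneg (hw0 q) (norm_nonneg _)) fun q => by
    nlinarith [sq_nonneg (w q - ‖c q‖), sq_nonneg (w q), sq_nonneg ‖c q‖]

/-! ### Absolutely convergent Fourier series -/

/-- The real part of the Fourier series with coefficients `a`. -/
def series (a : ℤ × ℤ → ℂ) (p : ℝ × ℝ) : ℝ := (∑' q : ℤ × ℤ, a q * character q.1 q.2 p).re

theorem summable_series (ha : Summable fun q => ‖a q‖) (p : ℝ × ℝ) :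
    Summable fun q : ℤ × ℤ => a q * character q.1 q.2 p := by
  refine Summable.of_norm ?_
  simpa only [norm_mul, norm_character, mul_one] using ha

theorem abs_series_sub_le (ha : Summable fun q => ‖a q‖) (hb : Summable fun q => ‖b q‖) {ε : ℝ}
    (h : ∀ S : Finset (ℤ × ℤ), ∑ q ∈ S, ‖a q - b q‖ ≤ ε) (p : ℝ × ℝ) : |series a p - series b p| ≤ ε := by
  have hε : 0 ≤ ε := by simpa using h ∅
  rw [series, series, ← Complex.sub_re, ← (summable_series ha p).tsum_sub (summable_series hb p)]
  refine (Complex.abs_re_le_norm _).trans ?_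
  have hs : Summable fun q => ‖a q - b q‖ := summable_of_sum_le (fun q => norm_nonneg _) h
  have hn : ∀ q : ℤ × ℤ, ‖a q * character q.1 q.2 p - b q * character q.1 q.2 p‖ = ‖a q - b q‖ := fun q => by
    rw [← sub_mul, norm_mul, norm_character, mul_one]
  refine (norm_tsum_le_tsum_norm (by simpa only [hn] using hs)).trans ?_
  simp only [hn]
  exact hs.tsum_le_of_sum_le h

theorem fourierPart_eq_series (M : Set (ℤ × ℤ)) (u : ℝ × ℝ → ℝ) :
    fourierPart M u = series (M.indicator fun q => coeff u q.1 q.2) := by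
  ext p
  rw [fourierPart, series]
  congr 1
  refine tsum_congr fun q => ?_
  by_cases hq : q ∈ M <;> simp [hq]

theorem tendsto_setIntegral_Q {E : Type*} [NormedAddCommGroup E] [NormedSpace ℝ E] {g : ℕ → ℝ × ℝ → E}
    {g' : ℝ × ℝ → E} {B : ℝ} (hg : ∀ n, Continuous (g n)) (hB : ∀ n, ∀ p ∈ Q, ‖g n p‖ ≤ B)
    (h : ∀ p ∈ Q, Tendsto (fun n => g n p) atTop (𝓝 (g' p))) :
    Tendsto (fun n => ∫ p in Q, g n p) atTop (𝓝 (∫ p in Q, g' p)) :=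
  tendsto_integral_of_dominated_convergence (fun _ => B) (fun n => (hg n).aestronglyMeasurable)
    (integrable_const _) (fun n => (ae_restrict_iff' measurableSet_Q).2 (ae_of_all _ (hB n)))
    ((ae_restrict_iff' measurableSet_Q).2 (ae_of_all _ h))

theorem tendsto_coeff {g : ℕ → ℝ × ℝ → ℝ} {g' : ℝ × ℝ → ℝ} {B : ℝ} (hg : ∀ n, Continuous (g n))
    (hB : ∀ n, ∀ p ∈ Q, |g n p| ≤ B) (h : ∀ p ∈ Q, Tendsto (fun n => g n p) atTop (𝓝 (g' p))) (j k : ℤ) :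
    Tendsto (fun n => coeff (g n) j k) atTop (𝓝 (coeff g' j k)) := by
  refine Tendsto.const_mul _ (tendsto_setIntegral_Q (B := B) (fun n => ?_) (fun n p hp => ?_) fun p hp => ?_)
  · exact (Complex.continuous_ofReal.comp (hg n)).mul (continuous_character _ _)
  · rw [norm_mul, norm_character, mul_one, Complex.norm_real]
    exact hB n p hp
  · exact ((Complex.continuous_ofReal.tendsto _).comp (h p hp)).mul_const _

/-! ### Hölder continuity -/

theorem norm_exp_sub_exp_le (x y : ℝ) {γ : ℝ} (h0 : 0 < γ) (h1 : γ ≤ 1) :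
    ‖Complex.exp (Complex.I * x) - Complex.exp (Complex.I * y)‖ ≤ 2 * |x - y| ^ γ := by
  have hl : ‖Complex.exp (Complex.I * x) - Complex.exp (Complex.I * y)‖ ≤ |x - y| := by
    have h2 : Complex.exp (Complex.I * x) - Complex.exp (Complex.I * y) =
        Complex.exp (Complex.I * y) * (Complex.exp (Complex.I * ((x - y : ℝ) : ℂ)) - 1) := by
      rw [mul_sub, ← Complex.exp_add, mul_one]
      congr 2
      push_cast
      ring
    rw [h2, norm_mul, mul_comm Complex.I (y : ℂ), Complex.norm_exp_ofReal_mul_I, one_mul]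
    exact Real.norm_exp_I_mul_ofReal_sub_one_le
  rcases le_total |x - y| 1 with h | h
  · refine hl.trans ?_
    have h3 : |x - y| ≤ |x - y| ^ γ := by
      rcases (abs_nonneg (x - y)).eq_or_lt with h4 | h4
      · rw [← h4, Real.zero_rpow h0.ne']
      · simpa using Real.rpow_le_rpow_of_exponent_ge h4 h h1
    linarith [abs_nonneg (x - y)]
  · have h3 : 1 ≤ |x - y| ^ γ := Real.one_le_rpow h h0.le
    refine (norm_sub_le _ _).trans ?_
    rw [mul_comm Complex.I, mul_comm Complex.I, Complex.norm_exp_ofReal_mul_I, Complex.norm_exp_ofReal_mul_I]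
    linarith

theorem norm_character_sub_le {q : ℤ × ℤ} (hq : q ∉ kernelModes) (p p' : ℝ × ℝ) {γ : ℝ} (h0 : 0 < γ) (h1 : γ ≤ 1) :
    ‖character q.1 q.2 p - character q.1 q.2 p'‖ ≤ 2 * |eigen β q| ^ γ * dist p p' ^ γ := by
  rw [character, character]
  refine (norm_exp_sub_exp_le _ _ h0 h1).trans ?_
  rw [mul_assoc 2 (|eigen β q| ^ γ), ← Real.mul_rpow (abs_nonneg _) dist_nonneg]
  gcongr
  have h2 : |p.1 - p'.1| ≤ dist p p' := by rw [← Real.dist_eq]; exact le_max_left _ _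
  have h3 : |p.2 - p'.2| ≤ dist p p' := by rw [← Real.dist_eq]; exact le_max_right _ _
  have h4 : |(2 * (q.1 : ℝ))| + |(q.2 : ℝ)| ≤ |eigen β q| := by
    rw [eigen_of_notMem hq, abs_mul (((q.2 - 2 * q.1 : ℤ) : ℝ))]
    rw [mem_kernelModes_iff] at hq
    set x := q.2 - 2 * q.1 with hx
    set y := q.2 + 2 * q.1 with hy
    have hx1 : (1 : ℝ) ≤ |(x : ℝ)| := by exact_mod_cast Int.one_le_abs (by omega : x ≠ 0)
    have hy1 : (1 : ℝ) ≤ |(y : ℝ)| := by exact_mod_cast Int.one_le_abs (by omega : y ≠ 0)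
    have hj : (2 * (q.1 : ℝ)) = ((y : ℝ) - x) / 2 := by rw [hx, hy]; push_cast; ring
    have hk : (q.2 : ℝ) = ((y : ℝ) + x) / 2 := by rw [hx, hy]; push_cast; ring
    have hle : |(2 * (q.1 : ℝ))| + |(q.2 : ℝ)| ≤ max |(x : ℝ)| |(y : ℝ)| := by
      rw [hj, hk]
      rcases abs_cases ((x : ℝ)) with ⟨e1, _⟩ | ⟨e1, _⟩ <;> rcases abs_cases ((y : ℝ)) with ⟨e2, _⟩ | ⟨e2, _⟩ <;>
        rcases abs_cases (((y : ℝ) - x) / 2) with ⟨e3, _⟩ | ⟨e3, _⟩ <;>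
        rcases abs_cases (((y : ℝ) + x) / 2) with ⟨e4, _⟩ | ⟨e4, _⟩ <;>
        rw [e1, e2, e3, e4, le_max_iff] <;>
        first
          | (left; linarith)
          | (right; linarith)
    exact hle.trans (max_le (le_mul_of_one_le_right (abs_nonneg _) hy1) (le_mul_of_one_le_left (abs_nonneg _) hx1))
  calc |2 * (q.1 : ℝ) * p.1 + q.2 * p.2 - (2 * q.1 * p'.1 + q.2 * p'.2)|
      = |2 * (q.1 : ℝ) * (p.1 - p'.1) + q.2 * (p.2 - p'.2)| := by congr 1; ring
    _ ≤ |2 * (q.1 : ℝ)| * |p.1 - p'.1| + |(q.2 : ℝ)| * |p.2 - p'.2| := by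
        rw [← abs_mul, ← abs_mul]; exact abs_add_le _ _
    _ ≤ |2 * (q.1 : ℝ)| * dist p p' + |(q.2 : ℝ)| * dist p p' := by gcongr
    _ = (|2 * (q.1 : ℝ)| + |(q.2 : ℝ)|) * dist p p' := by ring
    _ ≤ |eigen β q| * dist p p' := by gcongr

theorem summable_eigen_inv_mul (hβ : 0 < β) (hc : Summable fun q => ‖c q‖ ^ 2) :
    Summable fun q : ℤ × ℤ => ‖(eigen β q : ℂ)⁻¹ * c q‖ := by
  simpa only [norm_mul, norm_inv, Complex.norm_real, Real.norm_eq_abs] using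
    Summable.mul_norm (fun q => inv_nonneg.2 (abs_nonneg (eigen β q))) (summable_eigen_inv_sq hβ) hc

theorem summable_indicator_norm (M : Set (ℤ × ℤ)) (ha : Summable fun q => ‖a q‖) :
    Summable fun q => ‖M.indicator a q‖ :=
  ha.of_nonneg_of_le (fun _ => norm_nonneg _) fun _ => norm_indicator_le_norm_self _ _

theorem exists_holderWith (hβ : 0 < β) (hc : Summable fun q => ‖c q‖ ^ 2) {γ : NNReal} (h0 : 0 < γ) (h1 : γ < 1 / 2) :
    ∃ K : NNReal, HolderWith K γ (series (kernelModesᶜ.indicator fun q => (eigen β q : ℂ)⁻¹ * c q)) := by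
  have h0' : (0 : ℝ) < γ := h0
  have h1' : (γ : ℝ) < 1 / 2 := by exact_mod_cast h1
  set A : ℤ × ℤ → ℂ := kernelModesᶜ.indicator fun q => (eigen β q : ℂ)⁻¹ * c q with hA
  have hAs : Summable fun q => ‖A q‖ := summable_indicator_norm _ (summable_eigen_inv_mul hβ hc)
  set W : ℤ × ℤ → ℝ := fun q => ‖c q‖ ^ 2 + kernelModesᶜ.indicator (fun q : ℤ × ℤ => |eigen β q| ^ (-(2 - 2 * (γ : ℝ)))) q
    with hW
  have hWs : Summable W := hc.add (summable_eigen_rpow (by linarith))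
  have hW0 : ∀ q, 0 ≤ W q := fun q => add_nonneg (sq_nonneg _) (indicator_nonneg (fun _ _ => by positivity) q)
  have key : ∀ p p', |series A p - series A p'| ≤ (∑' q, W q) * dist p p' ^ (γ : ℝ) := fun p p' => by
    rw [series, series, ← Complex.sub_re, ← (summable_series hAs p).tsum_sub (summable_series hAs p')]
    refine (Complex.abs_re_le_norm _).trans ?_
    have hle : ∀ q : ℤ × ℤ, ‖A q * character q.1 q.2 p - A q * character q.1 q.2 p'‖ ≤ W q * dist p p' ^ (γ : ℝ) :=
      fun q => by
        by_cases hq : q ∈ kernelModes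
        · have : A q = 0 := indicator_of_notMem (by simpa using hq) _
          rw [this, zero_mul, zero_mul, sub_zero, norm_zero]
          exact mul_nonneg (hW0 q) (by positivity)
        · have hq' : q ∈ kernelModesᶜ := hq
          have hpos : 0 < |eigen β q| := one_pos.trans_le (one_le_abs_eigen hq)
          rw [← mul_sub, norm_mul]
          refine (mul_le_mul_of_nonneg_left (norm_character_sub_le (β := β) hq p p' h0' (by linarith)) (norm_nonneg _)).trans ?_
          rw [← mul_assoc]
          refine mul_le_mul_of_nonneg_right ?_ (by positivity)
          simp only [hA, hW, indicator_of_mem hq', norm_mul, norm_inv, Complex.norm_real, Real.norm_eq_abs]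
          have e1 : |eigen β q|⁻¹ * ‖c q‖ * (2 * |eigen β q| ^ (γ : ℝ)) =
              2 * ‖c q‖ * |eigen β q| ^ ((γ : ℝ) - 1) := by
            rw [Real.rpow_sub_one hpos.ne']
            ring
          have e2 : |eigen β q| ^ (-(2 - 2 * (γ : ℝ))) = (|eigen β q| ^ ((γ : ℝ) - 1)) ^ 2 := by
            rw [← Real.rpow_natCast, ← Real.rpow_mul hpos.le]
            congr 1
            push_cast
            ring
          rw [e1, e2]
          exact two_mul_le_add_sq _ _
    have hs := hWs.mul_right (dist p p' ^ (γ : ℝ))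
    rw [← tsum_mul_right]
    exact tsum_of_norm_bounded hs.hasSum hle
  refine ⟨Real.toNNReal (∑' q, W q), fun p p' => ?_⟩
  rw [edist_dist, edist_dist, ENNReal.ofReal_rpow_of_nonneg dist_nonneg h0'.le]
  change _ ≤ ENNReal.ofReal (∑' q, W q) * _
  rw [← ENNReal.ofReal_mul (tsum_nonneg hW0)]
  exact ENNReal.ofReal_le_ofReal (by rw [Real.dist_eq]; exact key p p')

/-! ### The Galerkin limit -/

/-- The part with frequencies in `M` of the solution of the linear equation with Fourier
coefficients `c` of the right-hand side. -/
def solPart (M : Set (ℤ × ℤ)) (β : ℝ) (c : ℤ × ℤ → ℂ) : ℝ × ℝ → ℝ :=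
  series (M.indicator fun q => (eigen β q : ℂ)⁻¹ * c q)

theorem Periodic.of_tendsto {g : ℕ → ℝ × ℝ → ℝ} {g' : ℝ × ℝ → ℝ} (hg : ∀ n, Periodic (g n))
    (h : ∀ p, Tendsto (fun n => g n p) atTop (𝓝 (g' p))) : Periodic g' := fun x t => by
  constructor
  · refine tendsto_nhds_unique (h _) ?_
    simpa only [(hg _ x t).1] using h (x, t)
  · refine tendsto_nhds_unique (h _) ?_
    simpa only [(hg _ x t).2] using h (x, t)

theorem exists_galerkin_limit (hf : Continuous fun p : ℝ × ℝ => f p.1 p.2) (hβ : 0 < β)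
    {U : ℕ → ℝ × ℝ → ℝ} (hU : ∀ n, U n ∈ trigPoly (galerkinModes (l + n)))
    (hcrit : ∀ n, ∀ q ∈ galerkinModes (l + n), gradCoeff f β (U n) q = 0) {B : ℝ}
    (hv : ∀ n p, |kernelPart (U n) p| ≤ B) (hw : ∀ n p, |rangePart (U n) p| ≤ B) :
    ∃ (c : ℤ × ℤ → ℂ) (σ : ℕ → ℕ) (v w : ℝ × ℝ → ℝ), StrictMono σ ∧ (Summable fun q => ‖c q‖ ^ 2) ∧
      v = solPart kernelModes β c ∧ w = solPart kernelModesᶜ β c ∧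
      TendstoUniformly (fun n => kernelPart (U (σ n))) v atTop ∧
      TendstoUniformly (fun n => rangePart (U (σ n))) w atTop ∧
      Continuous v ∧ Continuous w ∧ Periodic v ∧ Periodic w ∧
      (∀ q : ℤ × ℤ, coeff v q.1 q.2 = kernelModes.indicator (fun q => (eigen β q : ℂ)⁻¹ * c q) q) ∧
      (∀ q : ℤ × ℤ, coeff w q.1 q.2 = kernelModesᶜ.indicator (fun q => (eigen β q : ℂ)⁻¹ * c q) q) ∧
      ∀ q : ℤ × ℤ, c q = coeff (fun p => f p.1 (v p + w p)) q.1 q.2 := by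
  classical
  have hUs : ∀ n, kernelPart (U n) + rangePart (U n) = U n := fun n =>
    HasCoeffs.kernelPart_add_rangePart (hU n) (neg_mem_galerkinModes _)
  have hUB : ∀ n p, U n p ∈ Icc (-(2 * B)) (2 * B) := fun n p => by
    have h1 := abs_le.1 (hv n p)
    have h2 := abs_le.1 (hw n p)
    have h3 := congrFun (hUs n) p
    rw [Pi.add_apply] at h3
    rw [mem_Icc]
    constructor <;> linarith [h1.1, h1.2, h2.1, h2.2]
  obtain ⟨A, hA⟩ := ((isCompact_Icc (a := (0 : ℝ)) (b := Real.pi)).prod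
    (isCompact_Icc (a := -(2 * B)) (b := 2 * B))).exists_bound_of_continuousOn hf.continuousOn
  have hfA : ∀ n, ∀ p ∈ Q, |f p.1 (U n p)| ≤ A := fun n p hp => hA (p.1, U n p) ⟨hp.1, hUB n p⟩
  have hfc : ∀ n, Continuous fun p => f p.1 (U n p) := fun n => HasCoeffs.continuous_comp hf (hU n)
  have hbes : ∀ n (S : Finset (ℤ × ℤ)), ∑ q ∈ S, ‖coeff (fun p => f p.1 (U n p)) q.1 q.2‖ ^ 2 ≤ A ^ 2 :=
    fun n S => by
      refine (bessel (hfc n).continuousOn S).trans ?_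
      have h1 : ∫ p in Q, f p.1 (U n p) ^ 2 ≤ ∫ _ in Q, A ^ 2 := by
        refine setIntegral_mono_on ((hfc n).pow 2).integrableOn_Q (integrable_const _) measurableSet_Q fun p hp => ?_
        rw [← sq_abs]
        exact pow_le_pow_left₀ (abs_nonneg _) (hfA n p hp) 2
      rw [integral_const, volume_Q, smul_eq_mul] at h1
      have hpi := Real.pi_pos
      rw [one_div, ← div_eq_inv_mul, div_le_iff₀ (by positivity)]
      linarith
  set d : ℕ → ℤ × ℤ → ℂ := fun n q =>
    if q ∈ galerkinModes (l + n) then coeff (fun p => f p.1 (U n p)) q.1 q.2 else 0 with hd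
  have hdle : ∀ n q, ‖d n q‖ ≤ ‖coeff (fun p => f p.1 (U n p)) q.1 q.2‖ := fun n q => by
    simp only [hd]
    split_ifs
    · exact le_rfl
    · simp
  have hdS : ∀ n (S : Finset (ℤ × ℤ)), ∑ q ∈ S, ‖d n q‖ ^ 2 ≤ A ^ 2 := fun n S =>
    (Finset.sum_le_sum fun q _ => pow_le_pow_left₀ (norm_nonneg _) (hdle n q) 2).trans (hbes n S)
  have hd1 : ∀ n q, ‖d n q‖ ≤ |A| := fun n q => by
    have := hdS n {q}
    rw [Finset.sum_singleton] at this
    exact abs_le_of_sq_le_sq' (by rwa [sq_abs]) (abs_nonneg _) |>.2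
  have hcoef : ∀ n (q : ℤ × ℤ), coeff (U n) q.1 q.2 = (eigen β q : ℂ)⁻¹ * d n q := fun n q => by
    by_cases hq : q ∈ galerkinModes (l + n)
    · simp only [hd, if_pos hq]
      exact coeff_eq_div_eigen hβ (hcrit n q hq)
    · simp only [hd, if_neg hq, mul_zero]
      rw [HasCoeffs.coeff_eq (hU n), if_neg hq]
  obtain ⟨c, σ, hσ, hc⟩ := exists_tendsto_subseq hd1
  have hcS : ∀ S : Finset (ℤ × ℤ), ∑ q ∈ S, ‖c q‖ ^ 2 ≤ A ^ 2 := fun S =>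
    le_of_tendsto' (tendsto_finsetSum S fun q _ => (hc q).norm.pow 2) fun n => hdS (σ n) S
  have hcsum : Summable fun q => ‖c q‖ ^ 2 := summable_of_sum_le (fun _ => sq_nonneg _) hcS
  have hdsum : ∀ n, Summable fun q => ‖d n q‖ ^ 2 := fun n => summable_of_sum_le (fun _ => sq_nonneg _) (hdS n)
  have hunif : ∀ M : Set (ℤ × ℤ), TendstoUniformly (fun n => fourierPart M (U (σ n))) (solPart M β c) atTop := by
    intro M
    rw [Metric.tendstoUniformly_iff]
    intro ε hε
    have he : ∀ (n : ℕ) (S : Finset (ℤ × ℤ)), ∑ q ∈ S, ‖c q - d (σ n) q‖ ^ 2 ≤ 4 * A ^ 2 := fun n S => by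
      have h1 : ∑ q ∈ S, ‖c q - d (σ n) q‖ ^ 2 ≤ ∑ q ∈ S, (2 * ‖c q‖ ^ 2 + 2 * ‖d (σ n) q‖ ^ 2) := by
        refine Finset.sum_le_sum fun q _ => ?_
        have h2 := pow_le_pow_left₀ (norm_nonneg _) (norm_sub_le (c q) (d (σ n) q)) 2
        nlinarith [sq_nonneg (‖c q‖ - ‖d (σ n) q‖)]
      rw [Finset.sum_add_distrib, ← Finset.mul_sum, ← Finset.mul_sum] at h1
      linarith [hcS S, hdS (σ n) S]
    have he0 : ∀ q, Tendsto (fun n => c q - d (σ n) q) atTop (𝓝 0) := fun q => by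
      simpa using (hc q).const_sub (c q)
    filter_upwards [eventually_sum_mul_norm_le (fun q => inv_nonneg.2 (abs_nonneg (eigen β q)))
      (summable_eigen_inv_sq hβ) he he0 (half_pos hε)] with n hn p
    rw [Real.dist_eq, fourierPart_eq_series]
    refine lt_of_le_of_lt (abs_series_sub_le (summable_indicator_norm M (summable_eigen_inv_mul hβ hcsum)) ?_
      (fun S => ?_) p) (half_lt_self hε)
    · simp only [hcoef]
      exact summable_indicator_norm M (summable_eigen_inv_mul hβ (hdsum (σ n)))
    · refine le_trans (Finset.sum_le_sum fun q _ => ?_) (hn S)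
      by_cases hq : q ∈ M
      · rw [indicator_of_mem hq, indicator_of_mem hq, hcoef, ← mul_sub, norm_mul, norm_inv, Complex.norm_real,
          Real.norm_eq_abs]
      · rw [indicator_of_notMem hq, indicator_of_notMem hq, sub_zero, norm_zero]
        positivity
  have hcontM : ∀ M : Set (ℤ × ℤ), (∀ q ∈ M, -q ∈ M) → ∀ n, HasCoeffs (galerkinModes (l + n))
      (M.indicator fun q => coeff (U n) q.1 q.2) (fourierPart M (U n)) := fun M hM n =>
    HasCoeffs.modePart (hU n) (neg_mem_galerkinModes _) hM
  have hcoefM : ∀ M : Set (ℤ × ℤ), (∀ q ∈ M, -q ∈ M) → (∀ n p, |fourierPart M (U n) p| ≤ B) → ∀ q : ℤ × ℤ,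
      coeff (solPart M β c) q.1 q.2 = M.indicator (fun q => (eigen β q : ℂ)⁻¹ * c q) q := by
    intro M hM hMB q
    have h1 := tendsto_coeff (g := fun n => fourierPart M (U (σ n))) (fun n => (hcontM M hM (σ n)).continuous)
      (fun n p _ => hMB (σ n) p) (fun p _ => (hunif M).tendsto_at p) q.1 q.2
    refine tendsto_nhds_unique h1 ?_
    have h2 : ∀ n, coeff (fourierPart M (U n)) q.1 q.2 = M.indicator (fun q => (eigen β q : ℂ)⁻¹ * d n q) q :=
      fun n => by
        rw [(hcontM M hM n).coeff_eq]
        by_cases hq : q ∈ M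
        · rw [indicator_of_mem hq, indicator_of_mem hq, hcoef]
          split_ifs with h
          · rfl
          · simp [hd, h]
        · rw [indicator_of_notMem hq, indicator_of_notMem hq, ite_self]
    simp only [h2]
    by_cases hq : q ∈ M
    · simp only [indicator_of_mem hq]
      exact (hc q).const_mul _
    · simp only [indicator_of_notMem hq]
      exact tendsto_const_nhds
  have huv := hunif kernelModes
  have huw := hunif kernelModesᶜ
  refine ⟨c, σ, solPart kernelModes β c, solPart kernelModesᶜ β c, hσ, hcsum, rfl, rfl, huv, huw, ?_, ?_, ?_, ?_,
    hcoefM _ neg_mem_kernelModes hv, hcoefM _ neg_mem_compl_kernelModes hw, fun q => ?_⟩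
  · exact huv.continuous (Frequently.of_forall fun n => (hcontM _ neg_mem_kernelModes _).continuous)
  · exact huw.continuous (Frequently.of_forall fun n => (hcontM _ neg_mem_compl_kernelModes _).continuous)
  · exact Periodic.of_tendsto (fun n => (hcontM _ neg_mem_kernelModes (σ n)).periodic) huv.tendsto_at
  · exact Periodic.of_tendsto (fun n => (hcontM _ neg_mem_compl_kernelModes (σ n)).periodic) huw.tendsto_at
  · have hlim : ∀ p, Tendsto (fun n => U (σ n) p) atTop
        (𝓝 (solPart kernelModes β c p + solPart kernelModesᶜ β c p)) := fun p => by
      have h1 := (huv.tendsto_at p).add (huw.tendsto_at p)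
      refine h1.congr fun n => ?_
      exact congrFun (hUs (σ n)) p
    have h1 := tendsto_coeff (g := fun n p => f p.1 (U (σ n) p)) (fun n => hfc (σ n)) (fun n => hfA (σ n))
      (fun p _ => ((hf.comp (continuous_const.prodMk continuous_id)).tendsto _).comp (hlim p)) q.1 q.2
    refine tendsto_nhds_unique ((hc q).congr' ?_) h1
    have h2 : ∀ᶠ n in atTop, q ∈ galerkinModes (l + σ n) := by
      filter_upwards [eventually_ge_atTop (2 * q.1.natAbs + q.2.natAbs)] with n hn
      have : n ≤ σ n := hσ.le_apply
      rw [mem_galerkinModes]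
      omega
    filter_upwards [h2] with n hn
    simp only [hd, if_pos hn]

variable {T T' : Finset (ℤ × ℤ)} {a b c : ℤ × ℤ → ℂ} {u φ ψ : ℝ × ℝ → ℝ}
  {f : ℝ → ℝ → ℝ} {β : ℝ} {l m : ℕ} {s c₁ c₂ C : ℝ}

/-! ### Uniqueness of Fourier coefficients -/

theorem Periodic.add_int (hu : Periodic u) (x t : ℝ) (m n : ℤ) :
    u (x + m * Real.pi, t + n * (2 * Real.pi)) = u (x, t) := by
  have h1 : Function.Periodic (fun y => u (y, t + n * (2 * Real.pi))) Real.pi := fun y => (hu y _).1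
  have h2 : Function.Periodic (fun s => u (x, s)) (2 * Real.pi) := fun s => (hu x s).2
  exact ((h1.int_mul m) x).trans ((h2.int_mul n) t)

theorem Periodic.exists_mem_Q (hu : Periodic u) (p : ℝ × ℝ) : ∃ p' ∈ Q, u p' = u p := by
  obtain ⟨m, hm, -⟩ := existsUnique_add_zsmul_mem_Ico Real.pi_pos p.1 0
  obtain ⟨n, hn, -⟩ := existsUnique_add_zsmul_mem_Ico Real.two_pi_pos p.2 0
  rw [zsmul_eq_mul, zero_add] at hm hn
  exact ⟨_, ⟨Ico_subset_Icc_self hm, Ico_subset_Icc_self hn⟩, hu.add_int p.1 p.2 m n⟩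

theorem exists_trigonometric_approx (hc : Continuous u) (hu : Periodic u) {ε : ℝ} (hε : 0 < ε) :
    ∃ P ∈ Submodule.span ℂ (range fun q : ℤ × ℤ => character q.1 q.2), ∀ p, ‖(u p : ℂ) - P p‖ < ε := by
  set π' : (Fin 2 → ℝ) → UnitAddTorus (Fin 2) := Pi.map fun _ => ((↑) : ℝ → UnitAddCircle) with hπ
  have hq : IsOpenQuotientMap π' := IsOpenQuotientMap.piMap fun _ => QuotientAddGroup.isOpenQuotientMap_mk
  set g : (Fin 2 → ℝ) → ℂ := fun y => (u (Real.pi * y 0, 2 * Real.pi * y 1) : ℂ) with hg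
  have hgc : Continuous g := by fun_prop
  have hgπ : ∀ y y', π' y = π' y' → g y = g y' := fun y y' h => by
    have h1 : ∀ i, ∃ n : ℤ, y i + n = y' i := fun i => by
      have h2 : ((y i : ℝ) : UnitAddCircle) = (y' i : ℝ) := congrFun h i
      have h3 : ((y' i - y i : ℝ) : UnitAddCircle) = 0 := by rw [AddCircle.coe_sub, h2, sub_self]
      obtain ⟨n, hn⟩ := (AddCircle.coe_eq_zero_iff (1 : ℝ)).1 h3
      rw [zsmul_eq_mul, mul_one] at hn
      exact ⟨n, by linarith⟩
    obtain ⟨m, hm⟩ := h1 0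
    obtain ⟨n, hn⟩ := h1 1
    simp only [hg]
    rw [← hm, ← hn, ← hu.add_int _ _ m n]
    congr 3 <;> ring
  set G : UnitAddTorus (Fin 2) → ℂ := fun z => g (Function.surjInv hq.surjective z) with hG
  have hGπ : ∀ y, G (π' y) = g y := fun y => hgπ _ _ (Function.surjInv_eq hq.surjective _)
  have hGc : Continuous G := by
    rw [hq.isQuotientMap.continuous_iff]
    exact hgc.congr fun y => (hGπ y).symm
  have hmem : (⟨G, hGc⟩ : C(UnitAddTorus (Fin 2), ℂ)) ∈
      (Submodule.span ℂ (range (UnitAddTorus.mFourier (d := Fin 2)))).topologicalClosure := by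
    rw [UnitAddTorus.span_mFourier_closure_eq_top]
    trivial
  obtain ⟨P, hP, hd⟩ := Metric.mem_closure_iff.1 hmem ε hε
  set ρ : ℝ × ℝ → (Fin 2 → ℝ) := fun p => ![p.1 / Real.pi, p.2 / (2 * Real.pi)] with hρ
  have hpi := Real.pi_pos
  refine ⟨fun p => P (π' (ρ p)), ?_, fun p => ?_⟩
  · clear hd
    induction hP using Submodule.span_induction with
    | mem x hx =>
      obtain ⟨n, rfl⟩ := hx
      refine Submodule.subset_span ⟨(n 0, n 1), ?_⟩
      ext p
      simp only [UnitAddTorus.mFourier, ContinuousMap.coe_mk, Fin.prod_univ_two, hπ, hρ, Pi.map_apply,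
        fourier_coe_apply, Matrix.cons_val_zero, Matrix.cons_val_one]
      rw [character, ← Complex.exp_add]
      congr 1
      push_cast
      field_simp
    | zero => exact Submodule.zero_mem _
    | add x y _ _ hx hy => exact Submodule.add_mem _ hx hy
    | smul c x _ hx => exact Submodule.smul_mem _ c hx
  · have h1 := (ContinuousMap.dist_lt_iff hε).1 hd (π' (ρ p))
    rw [ContinuousMap.coe_mk, hGπ, dist_eq_norm] at h1
    have h2 : g (ρ p) = (u p : ℂ) := by
      simp only [hg, hρ, Matrix.cons_val_zero, Matrix.cons_val_one]
      congr 2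
      ext <;> dsimp only <;> field_simp
    rwa [h2] at h1

theorem eq_zero_of_coeff_eq_zero (hc : Continuous u) (hu : Periodic u) (h : ∀ q : ℤ × ℤ, coeff u q.1 q.2 = 0) :
    u = 0 := by
  have horth : ∀ P ∈ Submodule.span ℂ (range fun q : ℤ × ℤ => character q.1 q.2),
      Continuous P ∧ ∫ p in Q, (u p : ℂ) * P p = 0 := fun P hP => by
    induction hP using Submodule.span_induction with
    | mem x hx =>
      obtain ⟨q, rfl⟩ := hx
      refine ⟨continuous_character _ _, ?_⟩
      have h1 := h (-q)
      rw [integral_mul_character]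
      simp only [Prod.fst_neg, Prod.snd_neg] at h1
      rw [h1, mul_zero]
    | zero => exact ⟨continuous_zero, by simp⟩
    | add x y _ _ hx hy =>
      refine ⟨hx.1.add hy.1, ?_⟩
      simp only [Pi.add_apply, mul_add]
      rw [integral_add, hx.2, hy.2, add_zero]
      · exact ((Complex.continuous_ofReal.comp hc).mul hx.1).integrableOn_Q
      · exact ((Complex.continuous_ofReal.comp hc).mul hy.1).integrableOn_Q
    | smul c x _ hx =>
      refine ⟨hx.1.const_smul c, ?_⟩
      simp only [Pi.smul_apply, smul_eq_mul, mul_left_comm _ c]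
      rw [integral_const_mul, hx.2, mul_zero]
  have hle : ∀ ε > 0, ∫ p in Q, u p ^ 2 ≤ ε * ∫ p in Q, |u p| := fun ε hε => by
    obtain ⟨P, hP, hPε⟩ := exists_trigonometric_approx hc hu hε
    obtain ⟨hPc, hP0⟩ := horth P hP
    have h1 : ((∫ p in Q, u p ^ 2 : ℝ) : ℂ) = ∫ p in Q, (u p : ℂ) * ((u p : ℂ) - P p) := by
      have h2 : ∫ p in Q, (u p : ℂ) * ((u p : ℂ) - P p) = (∫ p in Q, (u p : ℂ) * u p) - ∫ p in Q, (u p : ℂ) * P p := by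
        simp only [mul_sub]
        refine integral_sub ?_ ?_
        · exact ((Complex.continuous_ofReal.comp hc).mul (Complex.continuous_ofReal.comp hc)).integrableOn_Q
        · exact ((Complex.continuous_ofReal.comp hc).mul hPc).integrableOn_Q
      rw [h2, hP0, sub_zero, ← integral_complex_ofReal]
      simp only [pow_two, Complex.ofReal_mul]
    have h3 := congrArg norm h1
    rw [Complex.norm_real] at h3
    refine (le_abs_self _).trans (h3.le.trans ((norm_integral_le_integral_norm _).trans ?_))
    rw [← integral_const_mul]
    refine setIntegral_mono ?_ ?_ fun p => ?_
    · exact ((Complex.continuous_ofReal.comp hc).mul ((Complex.continuous_ofReal.comp hc).sub hPc)).norm.integrableOn_Q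
    · exact (continuous_const.mul hc.abs).integrableOn_Q
    · rw [norm_mul, mul_comm, Complex.norm_real]
      exact mul_le_mul_of_nonneg_right (hPε p).le (abs_nonneg _)
  have h0 : ∫ p in Q, u p ^ 2 = 0 := by
    refine le_antisymm ?_ (integral_nonneg fun p => sq_nonneg _)
    have hlim : Tendsto (fun ε : ℝ => ε * ∫ p in Q, |u p|) (𝓝[>] 0) (𝓝 (0 * ∫ p in Q, |u p|)) :=
      ((continuous_id.mul continuous_const).tendsto 0).mono_left nhdsWithin_le_nhds
    rw [zero_mul] at hlim
    exact ge_of_tendsto hlim (eventually_mem_nhdsWithin.mono hle)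
  have hae : (fun p => u p) =ᵐ[volume.restrict Q] fun _ => (0 : ℝ) := by
    have := (integral_eq_zero_iff_of_nonneg (fun p => sq_nonneg (u p)) (hc.pow 2).integrableOn_Q).1 h0
    filter_upwards [this] with p hp
    exact pow_eq_zero_iff two_ne_zero |>.1 hp
  have hQ : Q ⊆ closure (interior Q) := by
    rw [Q, interior_prod_eq, closure_prod_eq, interior_Icc, interior_Icc, closure_Ioo Real.pi_pos.ne,
      closure_Ioo Real.two_pi_pos.ne]
  have heq := Measure.eqOn_of_ae_eq hae hc.continuousOn continuousOn_const hQ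
  ext p
  obtain ⟨p', hp', h1⟩ := hu.exists_mem_Q p
  rw [← h1]
  exact heq hp'

theorem coeff_sub (hu : IntegrableOn u Q) (hψ : IntegrableOn ψ Q) (j k : ℤ) :
    coeff (u - ψ) j k = coeff u j k - coeff ψ j k := by
  simp only [coeff, Pi.sub_apply, Complex.ofReal_sub, sub_mul]
  rw [integral_sub (integrable_mul_character hu _ _) (integrable_mul_character hψ _ _), mul_sub]

theorem coeff_add (hu : IntegrableOn u Q) (hψ : IntegrableOn ψ Q) (j k : ℤ) :
    coeff (u + ψ) j k = coeff u j k + coeff ψ j k := by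
  simp only [coeff, Pi.add_apply, Complex.ofReal_add, add_mul]
  rw [integral_add (integrable_mul_character hu _ _) (integrable_mul_character hψ _ _), mul_add]

theorem coeff_smul (r : ℝ) (u : ℝ × ℝ → ℝ) (j k : ℤ) : coeff (r • u) j k = r * coeff u j k := by
  simp only [coeff, Pi.smul_apply, smul_eq_mul, Complex.ofReal_mul, mul_assoc]
  rw [integral_const_mul]
  ring

theorem Periodic.eq_of_coeff_eq (hc : Continuous u) (hu : Periodic u) (hc' : Continuous ψ) (hψ : Periodic ψ)
    (h : ∀ q : ℤ × ℤ, coeff u q.1 q.2 = coeff ψ q.1 q.2) : u = ψ := by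
  refine sub_eq_zero.1 (eq_zero_of_coeff_eq_zero (hc.sub hc') (fun x t => ?_) fun q => ?_)
  · simp only [Pi.sub_apply, hu x t, hψ x t, and_self]
  · rw [coeff_sub hc.integrableOn_Q hc'.integrableOn_Q, h, sub_self]

/-! ### Fourier coefficients of derivatives -/

theorem integral_deriv_mul_exp {g g' : ℝ → ℝ} (hg : ∀ y, HasDerivAt g (g' y) y) (hg' : Continuous g') {L : ℝ}
    (hper : g L = g 0) {c : ℂ} (hc : Complex.exp (c * L) = 1) :
    ∫ y in (0 : ℝ)..L, (g' y : ℂ) * Complex.exp (c * y) = -c * ∫ y in (0 : ℝ)..L, (g y : ℂ) * Complex.exp (c * y) := by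
  have hgc : Continuous g := continuous_iff_continuousAt.2 fun y => (hg y).continuousAt
  have h1 : ∀ y : ℝ, HasDerivAt (fun y : ℝ => Complex.exp (c * y)) (Complex.exp (c * y) * (c * 1)) y := fun y =>
    (((hasDerivAt_id y).ofReal_comp).const_mul c).cexp
  have h2 := intervalIntegral.integral_mul_deriv_eq_deriv_mul (a := 0) (b := L)
    (fun y _ => (hg y).ofReal_comp) (fun y _ => h1 y)
    ((Complex.continuous_ofReal.comp hg').intervalIntegrable _ _)
    (Continuous.intervalIntegrable (by fun_prop) _ _)
  rw [hper, hc, Complex.ofReal_zero, mul_zero, Complex.exp_zero, sub_self, zero_sub] at h2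
  rw [← neg_eq_iff_eq_neg.2 h2, ← intervalIntegral.integral_const_mul, ← intervalIntegral.integral_neg]
  refine intervalIntegral.integral_congr fun y _ => ?_
  ring

theorem coeff_deriv_t (hψ : Continuous ψ) (hper : Periodic ψ) {ψ' : ℝ × ℝ → ℝ} (hψ' : Continuous ψ')
    (hd : ∀ p, HasDerivAt (fun s => ψ (p.1, s)) (ψ' p) p.2) (j k : ℤ) :
    coeff ψ' j k = k * Complex.I * coeff ψ j k := by
  rw [coeff, coeff, setIntegral_Q (E := ℂ), setIntegral_Q (E := ℂ), mul_left_comm]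
  · congr 1
    rw [← intervalIntegral.integral_const_mul]
    refine intervalIntegral.integral_congr fun x _ => ?_
    simp only [character_eq_mul, mul_left_comm _ (Complex.exp (2 * _ * Complex.I * _))]
    rw [intervalIntegral.integral_const_mul, intervalIntegral.integral_const_mul,
      integral_deriv_mul_exp (g := fun y => ψ (x, y)) (fun y => hd (x, y)) (by fun_prop) (by simpa using (hper x 0).2)]
    · push_cast
      ring
    · rw [Complex.exp_eq_one_iff]
      exact ⟨-k, by push_cast; ring⟩
  · exact ((Complex.continuous_ofReal.comp hψ).mul (continuous_character _ _)).continuousOn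
  · exact ((Complex.continuous_ofReal.comp hψ').mul (continuous_character _ _)).continuousOn

theorem coeff_deriv_x (hψ : Continuous ψ) (hper : Periodic ψ) {ψ' : ℝ × ℝ → ℝ} (hψ' : Continuous ψ')
    (hd : ∀ p, HasDerivAt (fun y => ψ (y, p.2)) (ψ' p) p.1) (j k : ℤ) :
    coeff ψ' j k = 2 * j * Complex.I * coeff ψ j k := by
  rw [coeff, coeff, setIntegral_Q_symm (E := ℂ), setIntegral_Q_symm (E := ℂ), mul_left_comm]
  · congr 1
    rw [← intervalIntegral.integral_const_mul]
    refine intervalIntegral.integral_congr fun t _ => ?_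
    simp only [character_eq_mul, mul_comm (Complex.exp (2 * _ * Complex.I * _)),
      mul_left_comm _ (Complex.exp (_ * Complex.I * (t : ℂ)))]
    rw [intervalIntegral.integral_const_mul, intervalIntegral.integral_const_mul,
      integral_deriv_mul_exp (g := fun y => ψ (y, t)) (fun y => hd (y, t)) (by fun_prop) (by simpa using (hper 0 t).1)]
    · push_cast
      ring
    · rw [Complex.exp_eq_one_iff]
      exact ⟨-j, by push_cast; ring⟩
  · exact ((Complex.continuous_ofReal.comp hψ).mul (continuous_character _ _)).continuousOn
  · exact ((Complex.continuous_ofReal.comp hψ').mul (continuous_character _ _)).continuousOn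

theorem hasDerivAt_fst {n : WithTop ℕ∞} (hψ : ContDiff ℝ n ψ) (hn : n ≠ 0) (p : ℝ × ℝ) :
    HasDerivAt (fun y => ψ (y, p.2)) (fderiv ℝ ψ p (1, 0)) p.1 :=
  ((hψ.differentiable hn p).hasFDerivAt).comp_hasDerivAt p.1 ((hasDerivAt_id p.1).prodMk (hasDerivAt_const p.1 p.2))

theorem hasDerivAt_snd {n : WithTop ℕ∞} (hψ : ContDiff ℝ n ψ) (hn : n ≠ 0) (p : ℝ × ℝ) :
    HasDerivAt (fun s => ψ (p.1, s)) (fderiv ℝ ψ p (0, 1)) p.2 :=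
  ((hψ.differentiable hn p).hasFDerivAt).comp_hasDerivAt p.2 ((hasDerivAt_const p.2 p.1).prodMk (hasDerivAt_id p.2))

theorem dx_eq {n : WithTop ℕ∞} (hψ : ContDiff ℝ n ψ) (hn : n ≠ 0) : dx ψ = fun p => fderiv ℝ ψ p (1, 0) :=
  funext fun p => (hasDerivAt_fst hψ hn p).deriv

theorem dt_eq {n : WithTop ℕ∞} (hψ : ContDiff ℝ n ψ) (hn : n ≠ 0) : dt ψ = fun p => fderiv ℝ ψ p (0, 1) :=
  funext fun p => (hasDerivAt_snd hψ hn p).deriv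

theorem contDiff_dx {n : WithTop ℕ∞} (hψ : ContDiff ℝ (n + 1) ψ) : ContDiff ℝ n (dx ψ) := by
  rw [dx_eq hψ (by simp)]
  exact (hψ.fderiv_right le_rfl).clm_apply contDiff_const

theorem contDiff_dt {n : WithTop ℕ∞} (hψ : ContDiff ℝ (n + 1) ψ) : ContDiff ℝ n (dt ψ) := by
  rw [dt_eq hψ (by simp)]
  exact (hψ.fderiv_right le_rfl).clm_apply contDiff_const

theorem Periodic.dx (hψ : Periodic ψ) : Periodic (dx ψ) := fun x t => by
  constructor
  · simp only [PeriodicWave.dx]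
    rw [← deriv_comp_add_const]
    simp only [hψ _ t]
  · simp only [PeriodicWave.dx, hψ _ t]

theorem Periodic.dt (hψ : Periodic ψ) : Periodic (dt ψ) := fun x t => by
  constructor
  · simp only [PeriodicWave.dt, hψ x _]
  · simp only [PeriodicWave.dt]
    rw [← deriv_comp_add_const]
    simp only [hψ x _]

theorem coeff_dx (hψ : ContDiff ℝ 1 ψ) (hper : Periodic ψ) (j k : ℤ) :
    coeff (dx ψ) j k = 2 * j * Complex.I * coeff ψ j k :=
  coeff_deriv_x hψ.continuous hper (contDiff_dx (n := 0) (by simpa using hψ)).continuous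
    (fun p => by rw [dx_eq hψ one_ne_zero]; exact hasDerivAt_fst hψ one_ne_zero p) j k

theorem coeff_dt (hψ : ContDiff ℝ 1 ψ) (hper : Periodic ψ) (j k : ℤ) :
    coeff (dt ψ) j k = k * Complex.I * coeff ψ j k :=
  coeff_deriv_t hψ.continuous hper (contDiff_dt (n := 0) (by simpa using hψ)).continuous
    (fun p => by rw [dt_eq hψ one_ne_zero]; exact hasDerivAt_snd hψ one_ne_zero p) j k

theorem contDiff_one_dx (hψ : ContDiff ℝ 2 ψ) : ContDiff ℝ 1 (dx ψ) := contDiff_dx (by simpa [one_add_one_eq_two] using hψ)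

theorem contDiff_one_dt (hψ : ContDiff ℝ 2 ψ) : ContDiff ℝ 1 (dt ψ) := contDiff_dt (by simpa [one_add_one_eq_two] using hψ)

theorem continuous_dx (hψ : ContDiff ℝ 1 ψ) : Continuous (dx ψ) :=
  (contDiff_dx (n := 0) (by simpa using hψ)).continuous

theorem continuous_dt (hψ : ContDiff ℝ 1 ψ) : Continuous (dt ψ) :=
  (contDiff_dt (n := 0) (by simpa using hψ)).continuous

theorem coeff_dx_dx (hψ : ContDiff ℝ 2 ψ) (hper : Periodic ψ) (j k : ℤ) :
    coeff (dx (dx ψ)) j k = -(4 * j ^ 2) * coeff ψ j k := by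
  rw [coeff_dx (contDiff_one_dx hψ) hper.dx, coeff_dx (hψ.of_le one_le_two) hper]
  linear_combination 4 * (j : ℂ) ^ 2 * coeff ψ j k * Complex.I_sq

theorem coeff_dt_dt (hψ : ContDiff ℝ 2 ψ) (hper : Periodic ψ) (j k : ℤ) :
    coeff (dt (dt ψ)) j k = -(k ^ 2) * coeff ψ j k := by
  rw [coeff_dt (contDiff_one_dt hψ) hper.dt, coeff_dt (hψ.of_le one_le_two) hper]
  linear_combination (k : ℂ) ^ 2 * coeff ψ j k * Complex.I_sq

/-! ### Pairing with absolutely convergent Fourier series -/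

theorem hasSum_integral_mul (ha : Summable fun q => ‖a q‖) {g : ℝ × ℝ → ℂ} (hg : Continuous g) :
    HasSum (fun q : ℤ × ℤ => a q * ∫ p in Q, g p * character q.1 q.2 p)
      (∫ p in Q, (∑' q : ℤ × ℤ, a q * character q.1 q.2 p) * g p) := by
  have h1 : HasSum (fun q : ℤ × ℤ => ∫ p in Q, a q * character q.1 q.2 p * g p)
      (∫ p in Q, ∑' q : ℤ × ℤ, a q * character q.1 q.2 p * g p) := by
    refine hasSum_integral_of_summable_integral_norm (fun q => ?_) ?_
    · exact ((continuous_const.mul (continuous_character _ _)).mul hg).integrableOn_Q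
    · have h2 : ∀ q : ℤ × ℤ, ∫ p in Q, ‖a q * character q.1 q.2 p * g p‖ = ‖a q‖ * ∫ p in Q, ‖g p‖ :=
        fun q => by
          simp only [norm_mul, norm_character, mul_one]
          rw [integral_const_mul]
      simp only [h2]
      exact ha.mul_right _
  have h2 : ∀ q : ℤ × ℤ, ∫ p in Q, a q * character q.1 q.2 p * g p = a q * ∫ p in Q, g p * character q.1 q.2 p :=
    fun q => by simp only [mul_assoc, integral_const_mul, mul_comm (character _ _ _)]
  simp only [tsum_mul_right] at h1
  simpa only [h2] using h1

theorem continuous_tsum_character (ha : Summable fun q => ‖a q‖) :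
    Continuous fun p : ℝ × ℝ => ∑' q : ℤ × ℤ, a q * character q.1 q.2 p :=
  continuous_tsum (fun q => continuous_const.mul (continuous_character _ _)) ha fun q p => by
    rw [norm_mul, norm_character, mul_one]

theorem continuous_series (ha : Summable fun q => ‖a q‖) : Continuous (series a) :=
  Complex.continuous_re.comp (continuous_tsum_character ha)

theorem hasSum_integral_series_mul (ha : Summable fun q => ‖a q‖) (hψ : Continuous ψ) :
    HasSum (fun q : ℤ × ℤ => 2 * Real.pi ^ 2 * (a q * (starRingEnd ℂ) (coeff ψ q.1 q.2)).re)
      (∫ p in Q, series a p * ψ p) := by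
  have h3 := Complex.hasSum_re (hasSum_integral_mul ha (Complex.continuous_ofReal.comp hψ))
  have h4 : (∫ p in Q, (∑' q : ℤ × ℤ, a q * character q.1 q.2 p) * (ψ p : ℂ)).re = ∫ p in Q, series a p * ψ p := by
    have h6 := integral_re (𝕜 := ℂ)
      ((continuous_tsum_character ha).mul (Complex.continuous_ofReal.comp hψ)).integrableOn_Q
    refine h6.symm.trans (setIntegral_congr_fun measurableSet_Q fun p _ => ?_)
    exact Complex.re_mul_ofReal _ _
  simp only [Function.comp_apply] at h3
  rw [h4] at h3
  convert h3 using 2 with q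
  rw [integral_mul_character, conj_coeff, mul_left_comm, Complex.re_ofReal_mul]

theorem ofReal_series (hneg : ∀ q, a (-q) = (starRingEnd ℂ) (a q)) (p : ℝ × ℝ) :
    (series a p : ℂ) = ∑' q : ℤ × ℤ, a q * character q.1 q.2 p := by
  refine Complex.conj_eq_iff_re.1 ?_
  rw [Complex.conj_tsum, ← (Equiv.neg (ℤ × ℤ)).tsum_eq]
  refine tsum_congr fun q => ?_
  rw [Equiv.neg_apply, hneg, map_mul, Complex.conj_conj, conj_character, Prod.fst_neg, Prod.snd_neg, neg_neg, neg_neg]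

theorem coeff_series (ha : Summable fun q => ‖a q‖) (hneg : ∀ q, a (-q) = (starRingEnd ℂ) (a q)) (q : ℤ × ℤ) :
    coeff (series a) q.1 q.2 = a q := by
  have hc : ((2 * Real.pi ^ 2 : ℝ) : ℂ) ≠ 0 := by
    exact_mod_cast (by positivity : (2 * Real.pi ^ 2 : ℝ) ≠ 0)
  have h1 := hasSum_integral_mul ha (continuous_character (-q.1) (-q.2))
  have h2 : ∀ q' : ℤ × ℤ, a q' * ∫ p in Q, character (-q.1) (-q.2) p * character q'.1 q'.2 p =
      if q' = q then a q * ((2 * Real.pi ^ 2 : ℝ) : ℂ) else 0 := fun q' => by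
    simp only [character_mul, integral_character]
    by_cases h : q' = q
    · subst h
      simp
    · rw [if_neg h, if_neg, mul_zero]
      rintro ⟨h3, h4⟩
      exact h (Prod.ext (by omega) (by omega))
  simp only [h2] at h1
  have h3 := h1.unique (hasSum_ite_eq q _)
  rw [coeff]
  simp only [ofReal_series hneg, h3]
  rw [mul_left_comm, ← Complex.ofReal_mul, one_div_mul_cancel (by positivity), Complex.ofReal_one, mul_one]

theorem summable_coeff_of_contDiff (hφ : ContDiff ℝ 2 φ) (hper : Periodic φ) :
    Summable fun q : ℤ × ℤ => ‖coeff φ q.1 q.2‖ := by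
  have hc1 := continuous_dx (contDiff_one_dx hφ)
  have hc2 := continuous_dt (contDiff_one_dt hφ)
  set g : ℝ × ℝ → ℝ := φ - dt (dt φ) - dx (dx φ) with hg
  have hgc : Continuous g := (hφ.continuous.sub hc2).sub hc1
  have hgq : ∀ q : ℤ × ℤ, coeff g q.1 q.2 = ((1 + q.2 ^ 2 + 4 * q.1 ^ 2 : ℝ) : ℂ) * coeff φ q.1 q.2 := fun q => by
    rw [hg, coeff_sub (hφ.continuous.sub hc2).integrableOn_Q hc1.integrableOn_Q,
      coeff_sub hφ.continuous.integrableOn_Q hc2.integrableOn_Q, coeff_dx_dx hφ hper, coeff_dt_dt hφ hper]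
    push_cast
    ring
  have hs : Summable fun q : ℤ × ℤ => ‖coeff g q.1 q.2‖ ^ 2 :=
    summable_of_sum_le (fun _ => sq_nonneg _) (bessel hgc.continuousOn)
  refine (summable_eigen_inv_mul (β := 1) one_pos hs).of_nonneg_of_le (fun _ => norm_nonneg _) fun q => ?_
  have hpos : (0 : ℝ) < 1 + q.2 ^ 2 + 4 * q.1 ^ 2 := by positivity
  have hne := abs_pos.2 (eigen_ne_zero (β := 1) one_pos q)
  rw [hgq, norm_mul, norm_mul, norm_inv, Complex.norm_real, Complex.norm_real, Real.norm_eq_abs, Real.norm_eq_abs,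
    abs_of_pos hpos, ← mul_assoc]
  refine le_mul_of_one_le_left (norm_nonneg _) ?_
  rw [← div_eq_inv_mul, one_le_div hne]
  by_cases hq : q ∈ kernelModes
  · rw [eigen_of_mem hq, abs_le]
    constructor <;> nlinarith [sq_nonneg (q.2 : ℝ), sq_nonneg (q.1 : ℝ)]
  · rw [eigen, if_neg hq, abs_le]
    constructor <;> nlinarith [sq_nonneg (q.2 : ℝ), sq_nonneg (q.1 : ℝ)]

theorem eq_series_of_contDiff (hφ : ContDiff ℝ 2 φ) (hper : Periodic φ) :
    φ = series fun q => coeff φ q.1 q.2 := by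
  have hs := summable_coeff_of_contDiff hφ hper
  refine hper.eq_of_coeff_eq hφ.continuous (continuous_series hs) ?_ fun q =>
    (coeff_series hs (fun q => (conj_coeff φ q.1 q.2).symm) q).symm
  intro x t
  simp only [series, character_periodic_x, character_periodic_t, and_self]

/-! ### The equation in the sense of distributions -/

theorem isDistribSolution_solPart (hβ : 0 < β) (hc : Summable fun q => ‖c q‖ ^ 2) {v w : ℝ × ℝ → ℝ}
    (hv : v = solPart kernelModes β c) (hw : w = solPart kernelModesᶜ β c)
    (hg : Continuous fun p => f p.1 (v p + w p))
    (hcq : ∀ q : ℤ × ℤ, c q = coeff (fun p => f p.1 (v p + w p)) q.1 q.2) : IsDistribSolution f β v w := by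
  intro φ hφ hper
  have hφ2 : ContDiff ℝ 2 φ := contDiff_infty.1 hφ 2
  have hs : ∀ M : Set (ℤ × ℤ), Summable fun q => ‖M.indicator (fun q => (eigen β q : ℂ)⁻¹ * c q) q‖ := fun M =>
    summable_indicator_norm M (summable_eigen_inv_mul hβ hc)
  have hvc : Continuous v := hv ▸ continuous_series (hs _)
  have hwc : Continuous w := hw ▸ continuous_series (hs _)
  have hxx := continuous_dx (contDiff_one_dx hφ2)
  have htt := continuous_dt (contDiff_one_dt hφ2)
  have hbox : Continuous (box φ) := htt.sub hxx
  have hboxq : ∀ q : ℤ × ℤ, coeff (box φ) q.1 q.2 = ((4 * q.1 ^ 2 - q.2 ^ 2 : ℝ) : ℂ) * coeff φ q.1 q.2 := fun q => by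
    change coeff (dt (dt φ) - dx (dx φ)) q.1 q.2 = _
    rw [coeff_sub htt.integrableOn_Q hxx.integrableOn_Q, coeff_dx_dx hφ2 hper, coeff_dt_dt hφ2 hper]
    push_cast
    ring
  have S1 := hasSum_integral_series_mul (hs kernelModes) hbox
  have S2 := hasSum_integral_series_mul (hs kernelModesᶜ) hbox
  have S3 := hasSum_integral_series_mul (hs kernelModes) htt
  have S4 := hasSum_integral_series_mul (hs kernelModes) hφ.continuous
  have S5 := hasSum_integral_series_mul (summable_coeff_of_contDiff hφ2 hper) hg
  rw [← eq_series_of_contDiff hφ2 hper] at S5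
  change HasSum _ (∫ p in Q, solPart kernelModes β c p * _) at S1 S3 S4
  change HasSum _ (∫ p in Q, solPart kernelModesᶜ β c p * _) at S2
  rw [← hv] at S1 S3 S4
  rw [← hw] at S2
  have hL : ∫ p in Q, (v p + w p) * box φ p = (∫ p in Q, v p * box φ p) + ∫ p in Q, w p * box φ p := by
    simp only [add_mul]
    exact integral_add (hvc.mul hbox).integrableOn_Q (hwc.mul hbox).integrableOn_Q
  have hR : ∫ p in Q, (β * v p * dt (dt φ) p - f p.1 (v p + w p) * φ p - β * v p * φ p) =
      β * (∫ p in Q, v p * dt (dt φ) p) - (∫ p in Q, φ p * f p.1 (v p + w p)) - β * ∫ p in Q, v p * φ p := by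
    rw [integral_sub, integral_sub, ← integral_const_mul, ← integral_const_mul]
    · simp only [mul_assoc, mul_comm (φ _)]
    · exact ((continuous_const.mul hvc).mul htt).integrableOn_Q
    · exact (hg.mul hφ.continuous).integrableOn_Q
    · exact (((continuous_const.mul hvc).mul htt).sub (hg.mul hφ.continuous)).integrableOn_Q
    · exact ((continuous_const.mul hvc).mul hφ.continuous).integrableOn_Q
  rw [hL, hR]
  refine (S1.add S2).unique ?_
  have key : ∀ q : ℤ × ℤ,
      β * (2 * Real.pi ^ 2 * (kernelModes.indicator (fun q => (eigen β q : ℂ)⁻¹ * c q) q *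
        (starRingEnd ℂ) (coeff (dt (dt φ)) q.1 q.2)).re) -
      2 * Real.pi ^ 2 * (coeff φ q.1 q.2 * (starRingEnd ℂ) (coeff (fun p => f p.1 (v p + w p)) q.1 q.2)).re -
      β * (2 * Real.pi ^ 2 * (kernelModes.indicator (fun q => (eigen β q : ℂ)⁻¹ * c q) q *
        (starRingEnd ℂ) (coeff φ q.1 q.2)).re) =
      2 * Real.pi ^ 2 * (kernelModes.indicator (fun q => (eigen β q : ℂ)⁻¹ * c q) q *
        (starRingEnd ℂ) (coeff (box φ) q.1 q.2)).re +
      2 * Real.pi ^ 2 * (kernelModesᶜ.indicator (fun q => (eigen β q : ℂ)⁻¹ * c q) q *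
        (starRingEnd ℂ) (coeff (box φ) q.1 q.2)).re := fun q => by
    rw [hboxq, coeff_dt_dt hφ2 hper, ← hcq]
    set d := coeff φ q.1 q.2 with hd
    have he : eigen β q ≠ 0 := eigen_ne_zero hβ q
    have h1 : (d * (starRingEnd ℂ) (c q)).re =
        eigen β q * ((eigen β q : ℂ)⁻¹ * c q * (starRingEnd ℂ) d).re := by
      rw [← Complex.re_ofReal_mul, ← mul_assoc, mul_inv_cancel_left₀ (by exact_mod_cast he), ← Complex.conj_re, map_mul,
        Complex.conj_conj, mul_comm]
    have h2 : ∀ (z : ℂ) (r : ℝ), (z * (starRingEnd ℂ) ((r : ℂ) * d)).re = r * (z * (starRingEnd ℂ) d).re :=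
      fun z r => by
        rw [← Complex.re_ofReal_mul, map_mul, Complex.conj_ofReal, mul_left_comm]
    have h3 : -((q.2 : ℂ) ^ 2) = ((-(q.2 ^ 2) : ℝ) : ℂ) := by push_cast; ring
    rw [h1, h3, h2, h2, h2]
    by_cases hq : q ∈ kernelModes
    · have h5 : (q.2 : ℝ) ^ 2 = 4 * q.1 ^ 2 := sq_eq_of_mem_kernelModes hq
      rw [indicator_of_mem hq, indicator_of_notMem (by simpa using hq), eigen_of_mem hq, h5]
      simp only [zero_mul, Complex.zero_re]
      ring
    · rw [indicator_of_notMem hq, indicator_of_mem (by simpa using hq), eigen, if_neg hq]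
      simp only [zero_mul, Complex.zero_re]
      ring
  have S6 := ((S3.mul_left β).sub S5).sub (S4.mul_left β)
  simp only [key] at S6
  exact S6

variable {T T' : Finset (ℤ × ℤ)} {a b c : ℤ × ℤ → ℂ} {u φ ψ : ℝ × ℝ → ℝ}
  {f : ℝ → ℝ → ℝ} {β : ℝ} {l m : ℕ} {s c₁ c₂ C : ℝ}

/-! ### Periodic solutions of linear ordinary differential equations -/

theorem exists_periodic_hasDerivAt {b : ℝ → ℝ} (hb : Continuous b) {L : ℝ} (hL : 0 < L) (hper : Function.Periodic b L)
    {r : ℝ} (hr : r ≠ 0) :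
    ∃ y : ℝ → ℝ, Function.Periodic y L ∧ ∀ τ, HasDerivAt y (r * y τ + b τ) τ := by
  set I : ℝ → ℝ := fun τ => ∫ σ in (0 : ℝ)..τ, Real.exp (-r * σ) * b σ with hI
  have hc : Continuous fun σ => Real.exp (-r * σ) * b σ := by fun_prop
  have hId : ∀ τ, HasDerivAt I (Real.exp (-r * τ) * b τ) τ := fun τ =>
    intervalIntegral.integral_hasDerivAt_right (hc.intervalIntegrable _ _)
      (hc.stronglyMeasurableAtFilter _ _) hc.continuousAt
  have hexp : ∀ τ, Real.exp (r * τ) * Real.exp (-r * τ) = 1 := fun τ => by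
    rw [← Real.exp_add, neg_mul, add_neg_cancel, Real.exp_zero]
  have hne : 1 - Real.exp (r * L) ≠ 0 := by
    rw [sub_ne_zero, ne_comm, Ne, Real.exp_eq_one_iff]
    exact mul_ne_zero hr hL.ne'
  set K := Real.exp (r * L) * I L / (1 - Real.exp (r * L)) with hK
  have hKe : Real.exp (r * L) * (K + I L) = K := by
    rw [hK]
    field_simp
    ring
  refine ⟨fun τ => Real.exp (r * τ) * (K + I τ), fun τ => ?_, fun τ => ?_⟩
  · have h1 : I (τ + L) = I L + Real.exp (-r * L) * I τ := by
      simp only [hI]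
      rw [← intervalIntegral.integral_add_adjacent_intervals (hc.intervalIntegrable 0 L) (hc.intervalIntegrable L (τ + L)),
        ← intervalIntegral.integral_const_mul]
      congr 1
      have h2 := intervalIntegral.integral_comp_add_right (a := 0) (b := τ) (fun σ => Real.exp (-r * σ) * b σ) L
      rw [zero_add] at h2
      rw [← h2]
      refine intervalIntegral.integral_congr fun σ _ => ?_
      simp only [hper σ, mul_add, Real.exp_add]
      ring
    simp only [h1, mul_add r, Real.exp_add]
    calc Real.exp (r * τ) * Real.exp (r * L) * (K + (I L + Real.exp (-r * L) * I τ))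
        = Real.exp (r * τ) * (Real.exp (r * L) * (K + I L) + Real.exp (r * L) * Real.exp (-r * L) * I τ) := by ring
      _ = _ := by rw [hKe, hexp, one_mul]
  · have h1 : HasDerivAt (fun τ => Real.exp (r * τ)) (Real.exp (r * τ) * (r * 1)) τ :=
      ((hasDerivAt_id τ).const_mul r).exp
    refine (h1.mul ((hId τ).const_add K)).congr_deriv ?_
    rw [← mul_assoc (Real.exp (r * τ)) (Real.exp (-r * τ)), hexp]
    ring

theorem exists_periodic_solution {b : ℝ → ℝ} (hb : Continuous b) {L : ℝ} (hL : 0 < L) (hper : Function.Periodic b L) :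
    ∃ y y' : ℝ → ℝ, Function.Periodic y L ∧ (∀ τ, HasDerivAt y (y' τ) τ) ∧ ∀ τ, HasDerivAt y' (y τ + b τ) τ := by
  obtain ⟨z, hzp, hz⟩ := exists_periodic_hasDerivAt hb hL hper one_ne_zero
  have hzc : Continuous z := continuous_iff_continuousAt.2 fun τ => (hz τ).continuousAt
  obtain ⟨y, hyp, hy⟩ := exists_periodic_hasDerivAt hzc hL hzp (neg_ne_zero.2 one_ne_zero)
  refine ⟨y, fun τ => -1 * y τ + z τ, hyp, hy, fun τ => ?_⟩
  refine (((hy τ).const_mul (-1)).add (hz τ)).congr_deriv ?_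
  ring

theorem contDiff_two_of_hasDerivAt {y y' y'' : ℝ → ℝ} (h : ∀ τ, HasDerivAt y (y' τ) τ)
    (h' : ∀ τ, HasDerivAt y' (y'' τ) τ) (hc : Continuous y'') : ContDiff ℝ 2 y := by
  have e1 : deriv y = y' := funext fun τ => (h τ).deriv
  have e2 : deriv y' = y'' := funext fun τ => (h' τ).deriv
  rw [← one_add_one_eq_two, contDiff_succ_iff_deriv]
  refine ⟨fun τ => (h τ).differentiableAt, by simp, ?_⟩
  rw [e1, contDiff_one_iff_deriv, e2]
  exact ⟨fun τ => (h' τ).differentiableAt, hc⟩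

/-! ### Travelling waves -/

theorem coeff_const (r : ℝ) (j k : ℤ) : coeff (fun _ => r) j k = if j = 0 ∧ k = 0 then (r : ℂ) else 0 := by
  rw [coeff, integral_const_mul, integral_character]
  simp only [neg_eq_zero]
  split_ifs
  · rw [mul_left_comm, ← Complex.ofReal_mul, one_div_mul_cancel (by positivity), Complex.ofReal_one, mul_one]
  · simp

theorem coeff_travelling {b : ℝ → ℝ} (hb : Continuous b) (hper : Function.Periodic b Real.pi) (ε j k : ℤ) :
    coeff (fun p => b (p.2 + ε * p.1)) j k = if 2 * j = ε * k then
      ((1 / (2 * Real.pi) : ℝ) : ℂ) * ∫ τ in (0 : ℝ)..(2 * Real.pi), (b τ : ℂ) * Complex.exp (-(k * Complex.I) * τ)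
      else 0 := by
  set G : ℝ → ℂ := fun τ => (b τ : ℂ) * Complex.exp (-(k * Complex.I) * τ) with hG
  set J := ∫ τ in (0 : ℝ)..(2 * Real.pi), G τ with hJ
  have hper2 : Function.Periodic b (2 * Real.pi) := by simpa using hper.nat_mul 2
  have hGp : Function.Periodic G (2 * Real.pi) := fun τ => by
    simp only [hG]
    rw [hper2]
    congr 1
    rw [Complex.exp_eq_exp_iff_exists_int]
    exact ⟨-k, by push_cast; ring⟩
  have hGs : ∀ r, ∫ τ in (0 : ℝ)..(2 * Real.pi), G (τ + r) = J := fun r => by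
    rw [intervalIntegral.integral_comp_add_right, zero_add, add_comm (2 * Real.pi) r,
      hGp.intervalIntegral_add_eq r 0, zero_add]
  have h1 : ∀ x : ℝ, ∫ t in (0 : ℝ)..(2 * Real.pi), (b (t + ε * x) : ℂ) * character (-j) (-k) (x, t) =
      Complex.exp (((ε * k - 2 * j : ℤ) * Complex.I) * x) * J := fun x => by
    rw [← hGs (ε * x), ← intervalIntegral.integral_const_mul]
    refine intervalIntegral.integral_congr fun t _ => ?_
    simp only [hG]
    rw [character_eq_mul, ← Complex.exp_add, mul_left_comm, ← Complex.exp_add]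
    congr 2
    push_cast
    ring
  have h2 : coeff (fun p => b (p.2 + ε * p.1)) j k = ((1 / (2 * Real.pi ^ 2) : ℝ) : ℂ) *
      ((∫ x in (0 : ℝ)..Real.pi, Complex.exp (((ε * k - 2 * j : ℤ) * Complex.I) * x)) * J) := by
    rw [coeff, setIntegral_Q, ← intervalIntegral.integral_mul_const]
    · simp only [h1]
    · exact ((Complex.continuous_ofReal.comp (hb.comp (by fun_prop))).mul (continuous_character _ _)).continuousOn
  rw [h2]
  split_ifs with h
  · have h3 : ε * k - 2 * j = 0 := by omega
    have hpi : (Real.pi : ℂ) ≠ 0 := by exact_mod_cast Real.pi_pos.ne'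
    simp only [h3, Int.cast_zero, zero_mul, Complex.exp_zero, intervalIntegral.integral_const, sub_zero]
    rw [Complex.real_smul]
    push_cast
    field_simp
  · rcases Int.even_or_odd k with hk | hk
    · obtain ⟨n, hn⟩ : ∃ n, ε * k - 2 * j = 2 * n := by
        obtain ⟨i, rfl⟩ := hk
        exact ⟨ε * i - j, by ring⟩
      rw [integral_exp_int (n := n), zero_mul, mul_zero]
      · rintro rfl
        omega
      · rw [hn]
        push_cast
        ring
    · have h3 : ∀ τ, G (τ + Real.pi) = -G τ := fun τ => by
        simp only [hG, hper τ]
        have h4 : Complex.exp (-(k * Complex.I) * Real.pi) = -1 := by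
          obtain ⟨i, rfl⟩ := hk
          rw [← Complex.exp_pi_mul_I, Complex.exp_eq_exp_iff_exists_int]
          exact ⟨-i - 1, by push_cast; ring⟩
        rw [Complex.ofReal_add, mul_add, Complex.exp_add, h4]
        ring
      have h5 : J = -J := by
        conv_lhs => rw [← hGs Real.pi]
        simp only [h3, intervalIntegral.integral_neg, hJ]
      rw [self_eq_neg.1 h5, mul_zero, mul_zero]

/-- The profile of the projection of `g` to the functions of `t + ε x`. -/
def waveAverage (g : ℝ × ℝ → ℝ) (ε : ℤ) (τ : ℝ) : ℝ :=
  1 / (2 * Real.pi) * ∫ s in (0 : ℝ)..Real.pi, (g (s, τ - ε * s) + g (s, τ - ε * s + Real.pi))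

variable {g : ℝ × ℝ → ℝ} {ε : ℤ}

theorem continuous_waveAverage (hg : Continuous g) (ε : ℤ) : Continuous (waveAverage g ε) :=
  continuous_const.mul (intervalIntegral.continuous_parametric_intervalIntegral_of_continuous' (by fun_prop) _ _)

theorem periodic_waveAverage (hgt : ∀ x t, g (x, t + 2 * Real.pi) = g (x, t)) (ε : ℤ) :
    Function.Periodic (waveAverage g ε) Real.pi := fun τ => by
  rw [waveAverage, waveAverage]
  congr 1
  refine intervalIntegral.integral_congr fun s _ => ?_
  rw [add_sub_right_comm, add_assoc _ Real.pi, ← two_mul, hgt, add_comm]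

theorem integral_waveAverage (hg : Continuous g) (hgt : ∀ x t, g (x, t + 2 * Real.pi) = g (x, t)) {j k : ℤ}
    (hε : ε = 1 ∨ ε = -1) (h : 2 * j = ε * k) :
    ((1 / (2 * Real.pi) : ℝ) : ℂ) * ∫ τ in (0 : ℝ)..(2 * Real.pi),
      (waveAverage g ε τ : ℂ) * Complex.exp (-(k * Complex.I) * τ) = coeff g j k := by
  set H : ℝ × ℝ → ℂ := fun p =>
    ((g (p.1, p.2 - ε * p.1) : ℂ) + g (p.1, p.2 - ε * p.1 + Real.pi)) * Complex.exp (-(k * Complex.I) * p.2) with hH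
  have hHc : Continuous H := by fun_prop
  have h1 : ∀ τ : ℝ, (waveAverage g ε τ : ℂ) * Complex.exp (-(k * Complex.I) * τ) =
      ((1 / (2 * Real.pi) : ℝ) : ℂ) * ∫ s in (0 : ℝ)..Real.pi, H (s, τ) := fun τ => by
    simp only [hH, waveAverage]
    rw [intervalIntegral.integral_mul_const, Complex.ofReal_mul, ← intervalIntegral.integral_ofReal, mul_assoc]
    simp only [Complex.ofReal_add]
  simp only [h1]
  rw [intervalIntegral.integral_const_mul, ← setIntegral_Q_symm hHc.continuousOn, setIntegral_Q hHc.continuousOn]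
  have h2 : ∀ x : ℝ, ∫ t in (0 : ℝ)..(2 * Real.pi), H (x, t) =
      2 * ∫ t in (0 : ℝ)..(2 * Real.pi), (g (x, t) : ℂ) * character (-j) (-k) (x, t) := fun x => by
    set G : ℝ → ℂ := fun t => (g (x, t) : ℂ) * character (-j) (-k) (x, t) with hG
    have hGc : Continuous G := by
      have := continuous_character (-j) (-k)
      fun_prop
    have hGp : Function.Periodic G (2 * Real.pi) := fun t => by
      simp only [hG, hgt, character_periodic_t]
    have hGs : ∀ r, ∫ τ in (0 : ℝ)..(2 * Real.pi), G (τ + r) = ∫ τ in (0 : ℝ)..(2 * Real.pi), G τ := fun r => by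
      rw [intervalIntegral.integral_comp_add_right, zero_add, add_comm (2 * Real.pi) r,
        hGp.intervalIntegral_add_eq r 0, zero_add]
    have h3 : ∀ t, H (x, t) = G (t + -(ε * x)) + G (t + (-(ε * x) + Real.pi)) := fun t => by
      simp only [hH, hG, character_eq_mul, ← Complex.exp_add]
      have hj : (2 * j : ℂ) = ε * k := by exact_mod_cast h
      have hεε : (ε : ℂ) * ε = 1 := by rcases hε with rfl | rfl <;> norm_num
      have e1 : Complex.exp (2 * ((-j : ℤ) : ℂ) * Complex.I * x + ((-k : ℤ) : ℂ) * Complex.I * ((t + -(ε * x) : ℝ) : ℂ)) =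
          Complex.exp (-(k * Complex.I) * t) := by
        congr 1
        push_cast
        linear_combination (-Complex.I * x) * hj
      have e2 : Complex.exp (2 * ((-j : ℤ) : ℂ) * Complex.I * x +
          ((-k : ℤ) : ℂ) * Complex.I * ((t + (-(ε * x) + Real.pi) : ℝ) : ℂ)) = Complex.exp (-(k * Complex.I) * t) := by
        rw [Complex.exp_eq_exp_iff_exists_int]
        refine ⟨-(ε * j), ?_⟩
        push_cast
        linear_combination (-Complex.I * x + ε * Real.pi * Complex.I) * hj + (k * Real.pi * Complex.I) * hεε
      rw [e1, e2, add_mul]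
      simp only [sub_eq_add_neg, add_assoc]
    simp only [h3]
    have hi : ∀ r, IntervalIntegrable (fun t => G (t + r)) volume 0 (2 * Real.pi) := fun r =>
      (hGc.comp (continuous_add_const r)).intervalIntegrable _ _
    rw [intervalIntegral.integral_add (hi _) (hi _), hGs, hGs]
    exact (two_mul _).symm
  simp only [h2]
  rw [intervalIntegral.integral_const_mul, coeff, setIntegral_Q, ← mul_assoc, ← mul_assoc]
  · congr 1
    push_cast
    ring
  · exact ((Complex.continuous_ofReal.comp hg).mul (continuous_character _ _)).continuousOn

theorem coeff_waveAverage (hg : Continuous g) (hgt : ∀ x t, g (x, t + 2 * Real.pi) = g (x, t))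
    (hε : ε = 1 ∨ ε = -1) (j k : ℤ) :
    coeff (fun p => waveAverage g ε (p.2 + ε * p.1)) j k = if 2 * j = ε * k then coeff g j k else 0 := by
  rw [coeff_travelling (continuous_waveAverage hg ε) (periodic_waveAverage hgt ε)]
  split_ifs with h
  · exact integral_waveAverage hg hgt hε h
  · rfl

theorem exists_contDiff_kernel_solution (hg : Continuous g) (hgt : ∀ x t, g (x, t + 2 * Real.pi) = g (x, t)) :
    ∃ V : ℝ × ℝ → ℝ, ContDiff ℝ 2 V ∧ Periodic V ∧ ∀ q : ℤ × ℤ,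
      coeff V q.1 q.2 = kernelModes.indicator (fun q => -((1 + (q.2 : ℂ) ^ 2)⁻¹ * coeff g q.1 q.2)) q := by
  set μ := (coeff g 0 0).re with hμ
  have hμc : (μ : ℂ) = coeff g 0 0 := Complex.conj_eq_iff_re.1 (by rw [conj_coeff, neg_zero])
  have hb := continuous_waveAverage hg 1
  have hb' := (continuous_waveAverage hg (-1)).sub (continuous_const (y := μ))
  have hbp := periodic_waveAverage hgt 1
  have hbp' : Function.Periodic (fun τ => waveAverage g (-1) τ - μ) Real.pi := fun τ => by
    simp only [periodic_waveAverage hgt (-1) τ]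
  obtain ⟨y, y', hyp, hy, hy'⟩ := exists_periodic_solution hb Real.pi_pos hbp
  obtain ⟨z, z', hzp, hz, hz'⟩ := exists_periodic_solution hb' Real.pi_pos hbp'
  have hcy : Continuous y := continuous_iff_continuousAt.2 fun τ => (hy τ).continuousAt
  have hcz : Continuous z := continuous_iff_continuousAt.2 fun τ => (hz τ).continuousAt
  have hy2 : ContDiff ℝ 2 y := contDiff_two_of_hasDerivAt hy hy' (hcy.add hb)
  have hz2 : ContDiff ℝ 2 z := contDiff_two_of_hasDerivAt hz hz' (hcz.add hb')
  set V : ℝ × ℝ → ℝ := fun p => y (p.2 + p.1) + z (p.2 - p.1) with hV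
  have hV2 : ContDiff ℝ 2 V := (hy2.comp (contDiff_snd.add contDiff_fst)).add (hz2.comp (contDiff_snd.sub contDiff_fst))
  have hy2p : Function.Periodic y (2 * Real.pi) := by simpa using hyp.nat_mul 2
  have hz2p : Function.Periodic z (2 * Real.pi) := by simpa using hzp.nat_mul 2
  have hVp : Periodic V := fun x t => by
    constructor
    · simp only [hV]
      rw [← add_assoc, hyp, ← sub_sub, hzp.sub_eq]
    · simp only [hV]
      rw [add_right_comm, hy2p, add_sub_right_comm, hz2p]
  set h₁ : ℝ × ℝ → ℝ := fun p => waveAverage g 1 (p.2 + (1 : ℤ) * p.1) with hh₁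
  set h₂ : ℝ × ℝ → ℝ := fun p => waveAverage g (-1) (p.2 + (-1 : ℤ) * p.1) with hh₂
  have hc₁ : Continuous h₁ := hb.comp (by fun_prop)
  have hc₂ : Continuous h₂ := (continuous_waveAverage hg (-1)).comp (by fun_prop)
  have hdt : dt (dt V) = V + (h₁ + h₂ - fun _ => μ) := by
    have h1 : dt V = fun p => y' (p.2 + p.1) + z' (p.2 - p.1) := funext fun p =>
      (((hy _).comp_add_const p.2 p.1).add ((hz _).comp_sub_const p.2 p.1)).deriv
    rw [h1]
    ext p
    refine ((((hy' _).comp_add_const p.2 p.1).add ((hz' _).comp_sub_const p.2 p.1)).deriv).trans ?_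
    simp only [hV, hh₁, hh₂, Pi.add_apply, Pi.sub_apply, Int.cast_one, Int.cast_neg, one_mul, neg_mul, ← sub_eq_add_neg]
    ring
  refine ⟨V, hV2, hVp, fun q => ?_⟩
  have h1 := coeff_dt_dt hV2 hVp q.1 q.2
  rw [hdt, coeff_add hV2.continuous.integrableOn_Q ((hc₁.add hc₂).sub continuous_const).integrableOn_Q,
    coeff_sub (hc₁.add hc₂).integrableOn_Q continuous_const.integrableOn_Q,
    coeff_add hc₁.integrableOn_Q hc₂.integrableOn_Q, coeff_waveAverage hg hgt (Or.inl rfl),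
    coeff_waveAverage hg hgt (Or.inr rfl), coeff_const, hμc] at h1
  have hne : (1 + (q.2 : ℂ) ^ 2) ≠ 0 := by
    exact_mod_cast (by positivity : (1 + (q.2 : ℝ) ^ 2) ≠ 0)
  have h2 : (if 2 * q.1 = 1 * q.2 then coeff g q.1 q.2 else 0) + (if 2 * q.1 = -1 * q.2 then coeff g q.1 q.2 else 0) -
      (if q.1 = 0 ∧ q.2 = 0 then coeff g 0 0 else 0) = kernelModes.indicator (fun q => coeff g q.1 q.2) q := by
    by_cases hq : q ∈ kernelModes
    · rw [indicator_of_mem hq]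
      rw [mem_kernelModes_iff] at hq
      by_cases h0 : q.1 = 0 ∧ q.2 = 0
      · rw [if_pos (by omega), if_pos (by omega), if_pos h0, h0.1, h0.2]
        ring
      · rw [if_neg h0]
        rcases (by omega : 2 * q.1 = q.2 ∧ 2 * q.1 ≠ -q.2 ∨ 2 * q.1 ≠ q.2 ∧ 2 * q.1 = -q.2) with h | h
        · rw [if_pos (by omega), if_neg (by omega)]
          ring
        · rw [if_neg (by omega), if_pos (by omega)]
          ring
    · rw [indicator_of_notMem hq]
      rw [mem_kernelModes_iff] at hq
      rw [if_neg (by omega), if_neg (by omega), if_neg (by omega)]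
      ring
  rw [h2] at h1
  by_cases hq : q ∈ kernelModes
  · rw [indicator_of_mem hq] at h1 ⊢
    rw [← mul_neg, eq_inv_mul_iff_mul_eq₀ hne]
    linear_combination h1
  · rw [indicator_of_notMem hq] at h1 ⊢
    have h3 : (1 + (q.2 : ℂ) ^ 2) * coeff V q.1 q.2 = 0 := by linear_combination h1
    exact (mul_eq_zero.1 h3).resolve_left hne

theorem contDiff_of_coeff_eq (hβ : 0 < β) (hg : Continuous g) (hgt : ∀ x t, g (x, t + 2 * Real.pi) = g (x, t))
    {v : ℝ × ℝ → ℝ} (hv : Continuous v) (hper : Periodic v)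
    (h : ∀ q : ℤ × ℤ, coeff v q.1 q.2 = kernelModes.indicator (fun q => (eigen β q : ℂ)⁻¹ * coeff g q.1 q.2) q) :
    ContDiff ℝ 2 v := by
  obtain ⟨V, hV, hVp, hVq⟩ := exists_contDiff_kernel_solution hg hgt
  have hp : Periodic (β⁻¹ • V) := fun x t => by
    simp only [Pi.smul_apply, hVp x t, and_self]
  have : v = β⁻¹ • V := by
    refine hper.eq_of_coeff_eq hv (continuous_const.smul hV.continuous) hp fun q => ?_
    rw [coeff_smul, hVq, h]
    by_cases hq : q ∈ kernelModes
    · have hb : (β : ℂ) ≠ 0 := by exact_mod_cast hβ.ne'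
      rw [indicator_of_mem hq, indicator_of_mem hq, eigen_of_mem hq]
      push_cast
      rw [inv_neg, mul_inv]
      ring
    · rw [indicator_of_notMem hq, indicator_of_notMem hq, mul_zero]
  rw [this]
  exact contDiff_const.smul hV

variable {T T' : Finset (ℤ × ℤ)} {a b c : ℤ × ℤ → ℂ} {u φ ψ : ℝ × ℝ → ℝ}
  {f : ℝ → ℝ → ℝ} {β : ℝ} {l m : ℕ} {s c₁ c₂ C : ℝ}

/-! ### Membership in the energy space -/

theorem weightE_nonneg (q : ℤ × ℤ) : 0 ≤ weightE q := by
  rw [weightE]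
  split_ifs <;> positivity

theorem weightE_le (hβ : 0 < β) (q : ℤ × ℤ) : weightE q ≤ (Real.pi ^ 2 / 2 + (β ^ 2)⁻¹) * eigen β q ^ 2 := by
  have hb : 0 < (β ^ 2)⁻¹ := by positivity
  rw [weightE, add_mul]
  by_cases hq : q ∈ kernelModes
  · rw [if_neg (not_not.2 hq), eigen_of_mem hq, neg_sq, mul_pow, inv_mul_cancel_left₀ (by positivity)]
    have h1 := sq_eq_of_mem_kernelModes hq
    have h2 : 0 ≤ Real.pi ^ 2 / 2 * (β ^ 2 * (1 + (q.2 : ℝ) ^ 2) ^ 2) := by positivity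
    split_ifs <;> nlinarith [sq_nonneg (q.2 : ℝ), sq_nonneg ((q.2 : ℝ) ^ 2)]
  · have h1 := one_le_abs_eigen (β := β) hq
    have h2 : |(q.2 : ℝ) ^ 2 - 4 * (q.1 : ℝ) ^ 2| = |eigen β q| := by rw [eigen, if_neg hq]
    rw [if_pos hq, h2, ← sq_abs (eigen β q)]
    have h3 : |eigen β q| ≤ |eigen β q| ^ 2 := by nlinarith
    have h4 : 0 ≤ (β ^ 2)⁻¹ * |eigen β q| ^ 2 := by positivity
    have h5 := mul_le_mul_of_nonneg_left h3 (by positivity : 0 ≤ Real.pi ^ 2 / 2)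
    linarith

theorem memE_of_coeff_eq (hβ : 0 < β) (hc : Summable fun q => ‖c q‖ ^ 2) {M : Set (ℤ × ℤ)} (hu : Continuous u)
    (hper : Periodic u)
    (h : ∀ q : ℤ × ℤ, coeff u q.1 q.2 = M.indicator (fun q => (eigen β q : ℂ)⁻¹ * c q) q) : MemE u := by
  refine ⟨hper, ?_, ?_⟩
  · obtain ⟨R, hR⟩ := isCompact_Q.exists_bound_of_continuousOn hu.continuousOn
    exact MemLp.of_bound hu.aestronglyMeasurable R ((ae_restrict_iff' measurableSet_Q).2 (ae_of_all _ hR))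
  · refine (hc.mul_left (Real.pi ^ 2 / 2 + (β ^ 2)⁻¹)).of_nonneg_of_le
      (fun q => mul_nonneg (weightE_nonneg q) (sq_nonneg _)) fun q => ?_
    have he : 0 < eigen β q ^ 2 := by
      have := eigen_ne_zero hβ q
      positivity
    have h1 : ‖coeff u q.1 q.2‖ ≤ |eigen β q|⁻¹ * ‖c q‖ := by
      rw [h]
      refine (norm_indicator_le_norm_self _ _).trans_eq ?_
      rw [norm_mul, norm_inv, Complex.norm_real, Real.norm_eq_abs]
    have h2 := pow_le_pow_left₀ (norm_nonneg _) h1 2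
    rw [mul_pow, inv_pow, sq_abs] at h2
    calc weightE q * ‖coeff u q.1 q.2‖ ^ 2
        ≤ (Real.pi ^ 2 / 2 + (β ^ 2)⁻¹) * eigen β q ^ 2 * ((eigen β q ^ 2)⁻¹ * ‖c q‖ ^ 2) :=
          mul_le_mul (weightE_le hβ q) h2 (sq_nonneg _) (by positivity)
      _ = _ := by rw [mul_assoc, mul_inv_cancel_left₀ he.ne']

/-! ### Extension of the nonlinearity -/

/-- The extension of `f` from `[0, π] × ℝ` that is constant in `x` outside of `[0, π]`. -/
def extend (f : ℝ → ℝ → ℝ) (x u : ℝ) : ℝ := f (max 0 (min Real.pi x)) u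

theorem clamp_mem (x : ℝ) : max 0 (min Real.pi x) ∈ Icc 0 Real.pi :=
  ⟨le_max_left _ _, max_le Real.pi_pos.le (min_le_left _ _)⟩

theorem extend_of_mem {x : ℝ} (hx : x ∈ Icc 0 Real.pi) (u : ℝ) : extend f x u = f x u := by
  rw [extend, min_eq_right hx.2, max_eq_right hx.1]

theorem continuous_extend (hf : ContinuousOn (fun p : ℝ × ℝ => f p.1 p.2) (Icc 0 Real.pi ×ˢ univ)) :
    Continuous fun p : ℝ × ℝ => extend f p.1 p.2 :=
  hf.comp_continuous (f := fun p : ℝ × ℝ => (max 0 (min Real.pi p.1), p.2)) (by fun_prop)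
    fun p => ⟨clamp_mem p.1, trivial⟩

theorem action_extend (f : ℝ → ℝ → ℝ) : action (extend f) = action f := by
  ext β u
  refine setIntegral_congr_fun measurableSet_Q fun p hp => ?_
  simp only [primitive, extend_of_mem hp.1]

theorem level_extend (f : ℝ → ℝ → ℝ) : level (extend f) = level f := by
  ext β l m
  simp only [level, action_extend]

theorem isCriticalPoint_extend : IsCriticalPoint (extend f) β m u ↔ IsCriticalPoint f β m u := by
  simp only [IsCriticalPoint, action_extend]

theorem isDistribSolution_extend {v w : ℝ × ℝ → ℝ} :
    IsDistribSolution (extend f) β v w ↔ IsDistribSolution f β v w := by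
  refine forall₃_congr fun φ _ _ => ?_
  rw [setIntegral_congr_fun measurableSet_Q
    fun p (hp : p ∈ Q) => show β * v p * dt (dt φ) p - extend f p.1 (v p + w p) * φ p - β * v p * φ p =
      β * v p * dt (dt φ) p - f p.1 (v p + w p) * φ p - β * v p * φ p by rw [extend_of_mem hp.1]]

/-! ### Existence of a solution -/

theorem kernelPart_mem_Nm (hu : u ∈ trigPoly (galerkinModes m)) : kernelPart u ∈ Nm m := by
  have h := HasCoeffs.modePart hu (neg_mem_galerkinModes m) neg_mem_kernelModes
  refine mem_trigSpan_of_hasCoeffs (T := (galerkinModes m).filter fun q => 2 * q.1.natAbs = q.2.natAbs) (fun q hq => ?_)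
    (a := kernelModes.indicator fun q => coeff u q.1 q.2) fun p => ?_
  · rw [Finset.mem_filter, mem_galerkinModes] at hq
    omega
  · rw [kernelPart, h p]
    refine (Finset.sum_filter_of_ne fun q _ hne => ?_).symm
    by_contra hq
    rw [← mem_kernelModes_iff] at hq
    exact hne (by rw [indicator_of_notMem hq, zero_mul])

theorem rangePart_mem_Em (hu : u ∈ trigPoly (galerkinModes m)) : rangePart u ∈ Em m := by
  have h := HasCoeffs.modePart hu (neg_mem_galerkinModes m) neg_mem_compl_kernelModes
  refine mem_trigSpan_of_hasCoeffs (T := (galerkinModes m).filter fun q => 2 * q.1.natAbs ≠ q.2.natAbs) (fun q hq => ?_)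
    (a := kernelModesᶜ.indicator fun q => coeff u q.1 q.2) fun p => ?_
  · rw [Finset.mem_filter, mem_galerkinModes] at hq
    omega
  · rw [rangePart, h p]
    refine (Finset.sum_filter_of_ne fun q _ hne hq => ?_).symm
    rw [← mem_kernelModes_iff] at hq
    exact hne (by rw [indicator_of_notMem (by simpa using hq), zero_mul])

theorem neg_mem_linkModes (l m : ℕ) : ∀ q ∈ linkModes l m, -q ∈ linkModes l m :=
  neg_mem_of_mem_iff (S := fun j k => ((2 * j ≤ m ∧ 2 * j = k) ∨ (2 * j + k ≤ m ∧ k < 2 * j)) ∨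
    (2 * j + k ≤ l ∧ 2 * j < k)) (mem_linkModes l m)

/-- Critical points at the minimax levels, with a bound that does not depend on `m`. -/
theorem HasGrowth.exists_bounded_critical (h : HasGrowth f s c₁ c₂ C) (hβ : 0 < β) (l : ℕ) :
    ∃ (U : ℕ → ℝ × ℝ → ℝ) (B : ℝ), ∀ m, l ≤ m → U m ∈ trigPoly (galerkinModes m) ∧
      ((action f β (U m) : ℝ) : EReal) = level f β l m ∧ (∀ q ∈ galerkinModes m, gradCoeff f β (U m) q = 0) ∧
      ∀ p, |kernelPart (U m) p| ≤ B ∧ |rangePart (U m) p| ≤ B := by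
  have hex : ∀ m, ∃ u : ℝ × ℝ → ℝ, l ≤ m → u ∈ trigPoly (galerkinModes m) ∧
      ((action f β u : ℝ) : EReal) = level f β l m ∧ ∀ q ∈ galerkinModes m, gradCoeff f β u q = 0 := fun m => by
    by_cases hlm : l ≤ m
    · obtain ⟨M, hM⟩ := h.exists_action_le ((m : ℝ) ^ 2)
      obtain ⟨u, hu, h1, h2⟩ := exists_critical_at_level (f := f) (β := β) h.continuous hlm
        (hM β _ (neg_mem_galerkinModes m) fun q hq => eigen_le_of_mem_linkModes hβ (galerkinModes_subset m hq))
      exact ⟨u, fun _ => ⟨hu, h1, h2⟩⟩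
    · exact ⟨0, fun h' => absurd h' hlm⟩
  choose U hU using hex
  obtain ⟨M, hM⟩ := h.exists_action_le ((l : ℝ) ^ 2)
  obtain ⟨K, hK⟩ := h.exists_integral_abs_le M
  obtain ⟨D, hD0, hD⟩ := exists_abs_rangePart_le
  obtain ⟨D', hD0', hD'⟩ := exists_abs_kernelPart_le hβ
  refine ⟨U, (D + D') * K, fun m hlm => ?_⟩
  obtain ⟨hu, h1, h2⟩ := hU m hlm
  refine ⟨hu, h1, h2, ?_⟩
  have h3 : level f β l m ≤ ((M : ℝ) : EReal) := level_le hlm fun u hu => by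
    rw [V_eq] at hu
    exact (hM β _ (neg_mem_linkModes l m) (fun q hq => eigen_le_of_mem_linkModes hβ hq) u hu).trans
      (sub_le_self _ (integral_nonneg fun p => sq_nonneg _))
  rw [← h1, EReal.coe_le_coe_iff] at h3
  have h4 := hK β _ (neg_mem_galerkinModes m) _ hu h3 h2
  have hK0 : 0 ≤ K := (integral_nonneg fun p => abs_nonneg _).trans h4
  refine fun p => ⟨?_, ?_⟩
  · refine (hD' f m _ hu h2 p).trans ((mul_le_mul_of_nonneg_left h4 hD0').trans ?_)
    exact mul_le_mul_of_nonneg_right (le_add_of_nonneg_left hD0) hK0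
  · refine (hD f β m _ h.continuous hβ hu h2 p).trans ((mul_le_mul_of_nonneg_left h4 hD0).trans ?_)
    exact mul_le_mul_of_nonneg_right (le_add_of_nonneg_right hD0') hK0

theorem HasGrowth.exists_solution (h : HasGrowth f s c₁ c₂ C) (hβ : 0 < β) (l : ℕ) :
    ∃ (vm wm : ℕ → ℝ × ℝ → ℝ) (v w : ℝ × ℝ → ℝ) (σ : ℕ → ℕ),
      (∀ m : ℕ, l ≤ m → vm m ∈ Nm m ∧ wm m ∈ Em m ∧ IsCriticalPoint f β m (vm m + wm m) ∧
        ((action f β (vm m + wm m) : ℝ) : EReal) = level f β l m) ∧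
      StrictMono σ ∧ TendstoUniformly (fun i => vm (σ i)) v atTop ∧ TendstoUniformly (fun i => wm (σ i)) w atTop ∧
      MemN v ∧ MemRange w ∧ ContDiff ℝ 2 v ∧
      (∀ γ : NNReal, 0 < γ → γ < 1 / 2 → ∃ K : NNReal, HolderWith K γ w) ∧ IsDistribSolution f β v w := by
  obtain ⟨U, B, hU⟩ := h.exists_bounded_critical hβ l
  obtain ⟨c, σ, v, w, hσ, hc, hv, hw, hvU, hwU, hvc, hwc, hvp, hwp, hvq, hwq, hcq⟩ :=
    exists_galerkin_limit (l := l) (U := fun n => U (l + n)) h.continuous hβ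
      (fun n => (hU _ (Nat.le_add_right _ _)).1) (fun n => (hU _ (Nat.le_add_right _ _)).2.2.1)
      (fun n p => ((hU _ (Nat.le_add_right _ _)).2.2.2 p).1) (fun n p => ((hU _ (Nat.le_add_right _ _)).2.2.2 p).2)
  have hg : Continuous fun p : ℝ × ℝ => f p.1 (v p + w p) :=
    h.continuous.comp (continuous_fst.prodMk (hvc.add hwc))
  refine ⟨fun m => kernelPart (U m), fun m => rangePart (U m), v, w, fun n => l + σ n, fun m hlm => ?_,
    fun i j hij => Nat.add_lt_add_left (hσ hij) l, hvU, hwU, ⟨memE_of_coeff_eq hβ hc hvc hvp hvq, fun j k hjk => ?_⟩,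
    ⟨memE_of_coeff_eq hβ hc hwc hwp hwq, fun j k hjk => ?_⟩, ?_, fun γ h0 h1 => ?_,
    isDistribSolution_solPart hβ hc hv hw hg hcq⟩
  · obtain ⟨hu, h1, h2, -⟩ := hU m hlm
    rw [HasCoeffs.kernelPart_add_rangePart hu (neg_mem_galerkinModes m)]
    exact ⟨kernelPart_mem_Nm hu, rangePart_mem_Em hu, isCriticalPoint_of_gradCoeff_eq_zero h.continuous
      (neg_mem_galerkinModes m) (Em_sup_Nm m) hu h2, h1⟩
  · exact (hvq (j, k)).trans (indicator_of_notMem hjk _)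
  · exact (hwq (j, k)).trans (indicator_of_notMem (by simpa using hjk) _)
  · refine contDiff_of_coeff_eq hβ hg (fun x t => ?_) hvc hvp fun q => ?_
    · simp only [(hvp x t).2, (hwp x t).2]
    · rw [hvq]
      simp only [hcq]
  · rw [hw]
    exact exists_holderWith hβ hc h0 h1

end PeriodicWave

end

theorem mainTheorem4 (f : ℝ → ℝ → ℝ) (s c₁ c₂ C : ℝ)
    (hf : ContDiffOn ℝ 1 (fun p : ℝ × ℝ => f p.1 p.2) (Set.Icc 0 Real.pi ×ˢ Set.univ))
    (hs : 1 < s) (hc₁ : 0 < c₁) (hc : c₁ ≤ c₂) (hratio : 2 * c₂ / (s + 1) < c₁)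
    (hgrowth : ∀ x ∈ Set.Icc 0 Real.pi, ∀ u : ℝ,
      c₁ * |u| ^ (s + 1) - C * |u| ≤ u * f x u ∧ u * f x u ≤ c₂ * |u| ^ (s + 1) + C * |u|) :
    ∃ l₀ : ℕ, ∀ β : ℝ, 0 < β → ∀ l : ℕ, l₀ ≤ l →
      ∃ (vm wm : ℕ → ℝ × ℝ → ℝ) (v w : ℝ × ℝ → ℝ) (σ : ℕ → ℕ),
        -- critical points at the minimax levels
        (∀ m : ℕ, l ≤ m → vm m ∈ PeriodicWave.Nm m ∧ wm m ∈ PeriodicWave.Em m ∧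
          PeriodicWave.IsCriticalPoint f β m (vm m + wm m) ∧
          ((PeriodicWave.action f β (vm m + wm m) : ℝ) : EReal) =
            PeriodicWave.level f β l m) ∧
        -- the Galerkin limit
        StrictMono σ ∧
        TendstoUniformly (fun i => vm (σ i)) v Filter.atTop ∧
        TendstoUniformly (fun i => wm (σ i)) w Filter.atTop ∧
        -- the solution and its regularity
        PeriodicWave.MemN v ∧ PeriodicWave.MemRange w ∧
        ContDiff ℝ 2 v ∧
        (∀ γ : NNReal, 0 < γ → γ < 1 / 2 → ∃ K : NNReal, HolderWith K γ w) ∧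
        PeriodicWave.IsDistribSolution f β v w := by
  refine ⟨0, fun β hβ l _ => ?_⟩
  have hC : C ≤ |C| := le_abs_self C
  have h : PeriodicWave.HasGrowth (PeriodicWave.extend f) s c₁ c₂ |C| :=
    { continuous := PeriodicWave.continuous_extend hf.continuousOn
      one_lt := hs
      pos := hc₁
      ratio := hratio
      nonneg := abs_nonneg C
      lower := fun x u => (sub_le_sub_left (mul_le_mul_of_nonneg_right hC (abs_nonneg u)) _).trans
        (hgrowth _ (PeriodicWave.clamp_mem x) u).1
      upper := fun x u => (hgrowth _ (PeriodicWave.clamp_mem x) u).2.trans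
        (add_le_add_right (mul_le_mul_of_nonneg_right hC (abs_nonneg u)) _) }
  have := h.exists_solution hβ l
  simpa only [PeriodicWave.action_extend, PeriodicWave.level_extend, PeriodicWave.isCriticalPoint_extend,
    PeriodicWave.isDistribSolution_extend] using this
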